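/- Let $k$ be a field (algebras are associative and unital over $k$, algebra maps are unital, $\otimes=\otimes_k$). Let $(\mathcal G,\Delta,\varepsilon,\phi,S,\alpha,\beta)$ be a finite dimensional quasi-Hopf algebra over $k$: $\Delta:\mathcal G\to\mathcal G\otimes\mathcal G$ and $\varepsilon:\mathcal G\to k$ are algebra maps, $\phi=X\otimes Y\otimes Z\in\mathcal G^{\otimes 3}$ (summation suppressed) is invertible with inverse $\phi^{-1}=P\otimes Q\otimes R$, and $$(\mathrm{id}\otimes\Delta)(\Delta(a))\,\phi=\phi\,(\Delta\otimes\mathrm{id})(\Delta(a)),$$ $$(\mathrm{id}\otimes\mathrm{id}\otimes\Delta)(\phi)(\Delta\otimes\mathrm{id}\otimes\mathrm{id})(\phi)=(1\otimes\phi)(\mathrm{id}\otimes\Delta\otimes\mathrm{id})(\phi)(\phi\otimes1),$$ $$(\varepsilon\otimes\mathrm{id})\Delta=\mathrm{id}=(\mathrm{id}\otimes\varepsilon)\Delta,\qquad(\mathrm{id}\otimes\varepsilon\otimes\mathrm{id})(\phi)=1\otimes1;$$ $S$ is a bijective algebra antimorphism and $\alpha,\beta\in\mathcal G$ satisfy $S(a_{(1)})\alpha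 a_{(2)}=\varepsilon(a)\alpha$, $a_{(1)}\beta S(a_{(2)})=\varepsilon(a)\beta$, $X\beta S(Y)\alpha Z=1=S(P)\alpha Q\beta S(R)$. Assume the normalization $\varepsilon(\alpha)=1$ (equivalently $\varepsilon(\beta)=1$). Let $(\mathcal A,\rho,\phi_\rho)$ be a right $\mathcal G$-comodule algebra, i.e. $\rho:\mathcal A\to\mathcal A\otimes\mathcal G$ is an algebra map and $\phi_\rho\in\mathcal A\otimes\mathcal G\otimes\mathcal G$ is invertible with $$\phi_\rho(\rho\otimes\mathrm{id})(\rho(a))=(\mathrm{id}\otimes\Delta)(\rho(a))\phi_\rho,\quad(1\otimes\phi)(\mathrm{id}\otimes\Delta\otimes\mathrm{id})(\phi_\rho)(\phi_\rho\otimes1)=(\mathrm{id}\otimes\mathrm{id}\otimes\Delta)(\phi_\rho)(\rho\otimes\mathrm{id}\otimes\mathrm{id})(\phi_\rho),$$ $$(\mathrm{id}\otimes\varepsilon)\rho=\mathrm{id},\qquad(\mathrm{id}\otimes\varepsilon\otimes\mathrm{id})(\phi_\rho)=(\mathrm{id}\otimes\mathrm{id}\otimes\varepsilon)(\phi_\rho)=1\otimes1.$$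 Let $(\mathcal B,\lambda,\phi_\lambda)$ be a left $\mathcal G$-comodule algebra, i.e. $\lambda:\mathcal B\to\mathcal G\otimes\mathcal B$ is an algebra map and $\phi_\lambda\in\mathcal G\otimes\mathcal G\otimes\mathcal B$ is invertible with $$(\mathrm{id}\otimes\lambda)(\lambda(b))\phi_\lambda=\phi_\lambda(\Delta\otimes\mathrm{id})(\lambda(b)),\quad(1\otimes\phi_\lambda)(\mathrm{id}\otimes\Delta\otimes\mathrm{id})(\phi_\lambda)(\phi\otimes1)=(\mathrm{id}\otimes\mathrm{id}\otimes\lambda)(\phi_\lambda)(\Delta\otimes\mathrm{id}\otimes\mathrm{id})(\phi_\lambda),$$ $$(\varepsilon\otimes\mathrm{id})\lambda=\mathrm{id},\qquad(\mathrm{id}\otimes\varepsilon\otimes\mathrm{id})(\phi_\lambda)=(\varepsilon\otimes\mathrm{id}\otimes\mathrm{id})(\phi_\lambda)=1\otimes1.$$ Write $\phi_\lambda^{-1}=\bar\phi_\lambda^1\otimes\bar\phi_\lambda^2\otimes\bar\phi_\lambda^3$ and $\phi_\rho^{-1}=\bar\phi_\rho^1\otimes\bar\phi_\rho^2\otimes\bar\phi_\rho^3$.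 On the dual space $\hat{\mathcal G}$ put $\langle\varphi\psi|a\rangle=\langle\varphi\otimes\psi|\Delta(a)\rangle$, $\hat1=\varepsilon$, $\langle\varphi_{(1)}\otimes\varphi_{(2)}|a\otimes b\rangle=\langle\varphi|ab\rangle$, $\langle a\rightharpoonup\varphi|b\rangle=\langle\varphi|ba\rangle$, $\langle\varphi\leftharpoonup a|b\rangle=\langle\varphi|ab\rangle$, $\hat S^{-1}(\varphi)=\varphi\circ S^{-1}$, and let $\varphi\triangleright A=(\mathrm{id}\otimes\varphi)(\rho(A))$ and $B\triangleleft\varphi=(\varphi\otimes\mathrm{id})(\lambda(B))$ for $A\in\mathcal A$, $B\in\mathcal B$. Let $\mathcal M=\mathcal A\otimes\mathcal B$ and extend $\lambda,\rho,\phi_\lambda,\phi_\rho$ trivially to $\mathcal M$. Let $\delta=(\mathrm{id}\otimes\rho)\circ\lambda:\mathcal M\to\mathcal G\otimes\mathcal M\otimes\mathcal G$ and $\Psi=(1\otimes1\otimes\phi_\rho^{-1})(\phi_\lambda\otimes1\otimes1)\in\mathcal G^{\otimes2}\otimes\mathcal M\otimes\mathcal G^{\otimes2}$. Let $$f^{-1}=\Delta(S(P)\alpha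 Q)\cdot(K\beta S(N)\otimes L\beta S(M))\cdot(S\otimes S)(\Delta^{op}(R)),\qquad K\otimes L\otimes M\otimes N=(\Delta\otimes\mathrm{id}\otimes\mathrm{id})(\phi)(\phi^{-1}\otimes1),$$ be the inverse of Drinfeld's twist, $h^{-1}=(S^{-1}\otimes S^{-1})((f^{-1})^{21})$, and $$\Omega=\Omega^1\otimes\dots\otimes\Omega^5=\big((h^{-1})^{21}\otimes1\otimes1\otimes1\big)\,(S^{-1}\otimes S^{-1}\otimes\mathrm{id}\otimes\mathrm{id}\otimes\mathrm{id})(\Psi).$$ The diagonal crossed product $\mathcal M_1=\mathcal M\bowtie\hat{\mathcal G}$ is the vector space $\mathcal M\otimes\hat{\mathcal G}$ with the product $$(m\bowtie\varphi)(n\bowtie\psi)=m\,(\varphi_{(1)}\triangleright n\triangleleft\hat S^{-1}(\varphi_{(3)}))\,\Omega^3\bowtie(\Omega^2\rightharpoonup\varphi_{(2)}\leftharpoonup\Omega^4)(\Omega^1\rightharpoonup\psi\leftharpoonup\Omega^5),$$ where $\varphi\triangleright n\triangleleft\psi=(\psi\otimes\mathrm{id}\otimes\varphi)(\delta(n))$.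 Embed $\mathcal A,\mathcal B$ in $\mathcal M_1$ by $A\mapsto(A\otimes1)\bowtie\hat1$ and $B\mapsto(1\otimes B)\bowtie\hat1$. With $q=q^1\otimes q^2=S(\bar\phi_\lambda^1)\alpha\bar\phi_\lambda^2\otimes\bar\phi_\lambda^3\in\mathcal G\otimes\mathcal M$ and $\rho(m)=m_{(0)}\otimes m_{(1)}$ on $\mathcal M$, let $$\Gamma(\varphi)=(q^2)_{(0)}\bowtie\big(S^{-1}(q^1)\rightharpoonup\varphi\leftharpoonup(q^2)_{(1)}\big),\qquad\varphi\in\hat{\mathcal G}.$$ (So $\Gamma(\varphi)=(\varphi\otimes\mathrm{id})(\boldsymbol\Gamma)$ for the universal $\lambda\rho$-intertwiner $\boldsymbol\Gamma\in\mathcal G\otimes\mathcal M_1$.) Then $\mathcal M_1$ is an associative algebra with unit $(1\otimes1)\bowtie\hat1$, and: (i) There is a linear bijection $\mu:\mathcal A\otimes\hat{\mathcal G}\otimes\mathcal B\to\mathcal M_1$ with $\mu(A\otimes\varphi\otimes B)=A\,\Gamma(\varphi)\,B$. (ii) The algebra structure on $\mathcal A\otimes\hat{\mathcal G}\otimes\mathcal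 B$ induced by $\mu$ (the two-sided crossed product) has unit $1_{\mathcal A}\otimes\hat1\otimes1_{\mathcal B}$ and product $$(A\otimes\varphi\otimes B)(A'\otimes\psi\otimes B')=A(\varphi_{(1)}\triangleright A')\bar\phi_\rho^1\otimes\big[\bar\phi_\lambda^1\rightharpoonup\varphi_{(2)}\leftharpoonup\bar\phi_\rho^2\big]\big[\bar\phi_\lambda^2\rightharpoonup\psi_{(1)}\leftharpoonup\bar\phi_\rho^3\big]\otimes\bar\phi_\lambda^3(B\triangleleft\psi_{(2)})B'.$$ -/

import Mathlib

open scoped TensorProduct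

noncomputable section

namespace QuasiHopf

/-! Triple and higher tensor products are bracketed to the right, `X ⊗ (Y ⊗ (Z ⊗ W))`. -/

section TensorLegs

variable {k : Type*} [Field k]
variable {X X₁ X₂ Y Z W : Type*} [Ring X] [Ring X₁] [Ring X₂] [Ring Y] [Ring Z] [Ring W]
variable [Algebra k X] [Algebra k X₁] [Algebra k X₂] [Algebra k Y] [Algebra k Z] [Algebra k W]

/-- `f ⊗ id : X ⊗ Y → X₁ ⊗ (X₂ ⊗ Y)` for an algebra map `f : X → X₁ ⊗ X₂`. -/
def splitLeft (Y : Type*) [Ring Y] [Algebra k Y] (f : X →ₐ[k] X₁ ⊗[k] X₂) :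
    X ⊗[k] Y →ₐ[k] X₁ ⊗[k] (X₂ ⊗[k] Y) :=
  (Algebra.TensorProduct.assoc k k k X₁ X₂ Y).toAlgHom.comp
    (Algebra.TensorProduct.map f (AlgHom.id k Y))

/-- `id ⊗ f : Y ⊗ X → Y ⊗ X'`. -/
def onRight (Y : Type*) [Ring Y] [Algebra k Y] (f : X →ₐ[k] Z) : Y ⊗[k] X →ₐ[k] Y ⊗[k] Z :=
  Algebra.TensorProduct.map (AlgHom.id k Y) f

/-- `x ↦ x ⊗ 1`, as a map `X ⊗ (Y ⊗ Z) → X ⊗ (Y ⊗ (Z ⊗ W))`. -/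
def padRight (W : Type*) [Ring W] [Algebra k W] :
    X ⊗[k] (Y ⊗[k] Z) →ₐ[k] X ⊗[k] (Y ⊗[k] (Z ⊗[k] W)) :=
  onRight X (onRight Y Algebra.TensorProduct.includeLeft)

/-- `x ↦ 1 ⊗ x`, as a map `X → W ⊗ X`. -/
def padLeft (W : Type*) [Ring W] [Algebra k W] : X →ₐ[k] W ⊗[k] X :=
  Algebra.TensorProduct.includeRight

/-- `ε ⊗ id : X ⊗ Y → Y` for an algebra map `ε : X → k`. -/
def killLeft (Y : Type*) [Ring Y] [Algebra k Y] (ε : X →ₐ[k] k) : X ⊗[k] Y →ₐ[k] Y :=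
  (Algebra.TensorProduct.lid k Y).toAlgHom.comp (Algebra.TensorProduct.map ε (AlgHom.id k Y))

/-- `id ⊗ ε : Y ⊗ X → Y` for an algebra map `ε : X → k`. -/
def killRight (Y : Type*) [Ring Y] [Algebra k Y] (ε : X →ₐ[k] k) : Y ⊗[k] X →ₐ[k] Y :=
  (Algebra.TensorProduct.rid k k Y).toAlgHom.comp (Algebra.TensorProduct.map (AlgHom.id k Y) ε)

/-- The linear map `x ⊗ y ↦ f x * g y`. -/
def mulMap {V U E : Type*} [AddCommMonoid V] [Module k V] [AddCommMonoid U] [Module k U]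
    [Semiring E] [Algebra k E] (f : V →ₗ[k] E) (g : U →ₗ[k] E) : V ⊗[k] U →ₗ[k] E :=
  LinearMap.mul' k E ∘ₗ TensorProduct.map f g

@[simp] theorem mulMap_tmul {V U E : Type*} [AddCommMonoid V] [Module k V] [AddCommMonoid U]
    [Module k U] [Semiring E] [Algebra k E] (f : V →ₗ[k] E) (g : U →ₗ[k] E) (x : V) (y : U) :
    mulMap f g (x ⊗ₜ[k] y) = f x * g y := rfl

end TensorLegs

/-- A quasi-bialgebra over a field `k`: an algebra `G` with a coproduct `Δ`, a counit `ε` and an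
invertible reassociator `φ`. -/
structure QuasiBialgebra (k G : Type*) [Field k] [Ring G] [Algebra k G] where
  /-- the coproduct `Δ` -/
  comul : G →ₐ[k] G ⊗[k] G
  /-- the counit `ε` -/
  counit : G →ₐ[k] k
  /-- the reassociator `φ` -/
  phi : (G ⊗[k] (G ⊗[k] G))ˣ
  /-- `(id ⊗ Δ)(Δ a) φ = φ (Δ ⊗ id)(Δ a)` -/
  quasi_coassoc : ∀ a : G, onRight G comul (comul a) * (phi : G ⊗[k] (G ⊗[k] G)) =
    (phi : G ⊗[k] (G ⊗[k] G)) * splitLeft G comul (comul a)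
  /-- `(id ⊗ id ⊗ Δ)(φ) (Δ ⊗ id ⊗ id)(φ) = (1 ⊗ φ) (id ⊗ Δ ⊗ id)(φ) (φ ⊗ 1)` -/
  pentagon : onRight G (onRight G comul) (phi : G ⊗[k] (G ⊗[k] G)) *
      splitLeft (G ⊗[k] G) comul (phi : G ⊗[k] (G ⊗[k] G)) =
    padLeft G (phi : G ⊗[k] (G ⊗[k] G)) *
      onRight G (splitLeft G comul) (phi : G ⊗[k] (G ⊗[k] G)) *
      padRight G (phi : G ⊗[k] (G ⊗[k] G))
  /-- `(ε ⊗ id) ∘ Δ = id` -/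
  counit_left : ∀ a : G, killLeft G counit (comul a) = a
  /-- `(id ⊗ ε) ∘ Δ = id` -/
  counit_right : ∀ a : G, killRight G counit (comul a) = a
  /-- `(id ⊗ ε ⊗ id)(φ) = 1 ⊗ 1` -/
  counit_phi : onRight G (killLeft G counit) (phi : G ⊗[k] (G ⊗[k] G)) = 1

/-- A quasi-Hopf algebra with invertible antipode `S` (an algebra antimorphism) and elements
`α`, `β`. -/
structure QuasiHopfAlgebra (k G : Type*) [Field k] [Ring G] [Algebra k G] extends
    QuasiBialgebra k G where
  /-- the antipode `S` -/
  S : G ≃ₗ[k] G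
  /-- the element `α` -/
  α : G
  /-- the element `β` -/
  β : G
  S_mul : ∀ a b : G, S (a * b) = S b * S a
  /-- `S(a₁) α a₂ = α ε(a)` -/
  antipode_left : ∀ a : G,
    mulMap (LinearMap.mulRight k α ∘ₗ S.toLinearMap) LinearMap.id (comul a) = counit a • α
  /-- `a₁ β S(a₂) = β ε(a)` -/
  antipode_right : ∀ a : G,
    mulMap (LinearMap.mulRight k β) S.toLinearMap (comul a) = counit a • β
  /-- `X β S(Y) α Z = 1`, where `φ = X ⊗ Y ⊗ Z` -/
  antipode_phi :
    mulMap (LinearMap.mulRight k β)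
      (mulMap (LinearMap.mulRight k α ∘ₗ S.toLinearMap) LinearMap.id)
      (phi : G ⊗[k] (G ⊗[k] G)) = 1
  /-- `S(P) α Q β S(R) = 1`, where `φ⁻¹ = P ⊗ Q ⊗ R` -/
  antipode_phi_inv :
    mulMap (LinearMap.mulRight k α ∘ₗ S.toLinearMap)
      (mulMap (LinearMap.mulRight k β) S.toLinearMap)
      ((phi⁻¹ : (G ⊗[k] (G ⊗[k] G))ˣ) : G ⊗[k] (G ⊗[k] G)) = 1

/-- A left coaction `(λ, φ_λ)` of a quasi-bialgebra `G` on an algebra `M`. -/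
structure LeftCoaction {k G : Type*} [Field k] [Ring G] [Algebra k G] (Q : QuasiBialgebra k G)
    (M : Type*) [Ring M] [Algebra k M] where
  /-- the algebra map `λ` -/
  coact : M →ₐ[k] G ⊗[k] M
  /-- the reassociator `φ_λ` -/
  phi : (G ⊗[k] (G ⊗[k] M))ˣ
  /-- `(id ⊗ λ)(λ m) φ_λ = φ_λ (Δ ⊗ id)(λ m)` -/
  quasi_coassoc : ∀ m : M, onRight G coact (coact m) * (phi : G ⊗[k] (G ⊗[k] M)) =
    (phi : G ⊗[k] (G ⊗[k] M)) * splitLeft M Q.comul (coact m)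
  /-- `(1 ⊗ φ_λ) (id ⊗ Δ ⊗ id)(φ_λ) (φ ⊗ 1) = (id ⊗ id ⊗ λ)(φ_λ) (Δ ⊗ id ⊗ id)(φ_λ)` -/
  pentagon : padLeft G (phi : G ⊗[k] (G ⊗[k] M)) *
      onRight G (splitLeft M Q.comul) (phi : G ⊗[k] (G ⊗[k] M)) *
      padRight M (Q.phi : G ⊗[k] (G ⊗[k] G)) =
    onRight G (onRight G coact) (phi : G ⊗[k] (G ⊗[k] M)) *
      splitLeft (G ⊗[k] M) Q.comul (phi : G ⊗[k] (G ⊗[k] M))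
  /-- `(ε ⊗ id) ∘ λ = id` -/
  counit_coact : ∀ m : M, killLeft M Q.counit (coact m) = m
  /-- `(id ⊗ ε ⊗ id)(φ_λ) = 1 ⊗ 1` -/
  counit_phi_mid : onRight G (killLeft M Q.counit) (phi : G ⊗[k] (G ⊗[k] M)) = 1
  /-- `(ε ⊗ id ⊗ id)(φ_λ) = 1 ⊗ 1` -/
  counit_phi_left : killLeft (G ⊗[k] M) Q.counit (phi : G ⊗[k] (G ⊗[k] M)) = 1

/-- A right coaction `(ρ, φ_ρ)` of a quasi-bialgebra `G` on an algebra `M`. -/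
structure RightCoaction {k G : Type*} [Field k] [Ring G] [Algebra k G] (Q : QuasiBialgebra k G)
    (M : Type*) [Ring M] [Algebra k M] where
  /-- the algebra map `ρ` -/
  coact : M →ₐ[k] M ⊗[k] G
  /-- the reassociator `φ_ρ` -/
  phi : (M ⊗[k] (G ⊗[k] G))ˣ
  /-- `φ_ρ (ρ ⊗ id)(ρ m) = (id ⊗ Δ)(ρ m) φ_ρ` -/
  quasi_coassoc : ∀ m : M, (phi : M ⊗[k] (G ⊗[k] G)) * splitLeft G coact (coact m) =
    onRight M Q.comul (coact m) * (phi : M ⊗[k] (G ⊗[k] G))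
  /-- `(1 ⊗ φ) (id ⊗ Δ ⊗ id)(φ_ρ) (φ_ρ ⊗ 1) = (id ⊗ id ⊗ Δ)(φ_ρ) (ρ ⊗ id ⊗ id)(φ_ρ)` -/
  pentagon : padLeft M (Q.phi : G ⊗[k] (G ⊗[k] G)) *
      onRight M (splitLeft G Q.comul) (phi : M ⊗[k] (G ⊗[k] G)) *
      padRight G (phi : M ⊗[k] (G ⊗[k] G)) =
    onRight M (onRight G Q.comul) (phi : M ⊗[k] (G ⊗[k] G)) *
      splitLeft (G ⊗[k] G) coact (phi : M ⊗[k] (G ⊗[k] G))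
  /-- `(id ⊗ ε) ∘ ρ = id` -/
  counit_coact : ∀ m : M, killRight M Q.counit (coact m) = m
  /-- `(id ⊗ ε ⊗ id)(φ_ρ) = 1 ⊗ 1` -/
  counit_phi_mid : onRight M (killLeft G Q.counit) (phi : M ⊗[k] (G ⊗[k] G)) = 1
  /-- `(id ⊗ id ⊗ ε)(φ_ρ) = 1 ⊗ 1` -/
  counit_phi_right : onRight M (killRight G Q.counit) (phi : M ⊗[k] (G ⊗[k] G)) = 1

/-! ### The dual space `Ĝ` -/

section Dual

variable {k G : Type*} [Field k] [Ring G] [Algebra k G]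

/-- `a ⇀ φ`, that is `⟨a ⇀ φ | b⟩ = ⟨φ | b a⟩`. -/
def leftHit : G →ₗ[k] Module.End k (Module.Dual k G) :=
  Module.Dual.transpose ∘ₗ (LinearMap.mul k G).flip

/-- `φ ↼ a`, that is `⟨φ ↼ a | b⟩ = ⟨φ | a b⟩`. -/
def rightHit : G →ₗ[k] Module.End k (Module.Dual k G) :=
  Module.Dual.transpose ∘ₗ LinearMap.mul k G

@[simp] theorem leftHit_apply (a b : G) (φ : Module.Dual k G) :
    leftHit a φ b = φ (b * a) := rfl

@[simp] theorem rightHit_apply (a b : G) (φ : Module.Dual k G) :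
    rightHit a φ b = φ (a * b) := rfl

/-- The (non-associative) product of `Ĝ`: `⟨φ ψ | a⟩ = ⟨φ ⊗ ψ | Δ a⟩`. -/
def dualMul (Q : QuasiBialgebra k G) :
    Module.Dual k G →ₗ[k] Module.Dual k G →ₗ[k] Module.Dual k G :=
  TensorProduct.curry
    (Module.Dual.transpose Q.comul.toLinearMap ∘ₗ TensorProduct.dualDistrib k G G)

theorem dualMul_apply (Q : QuasiBialgebra k G) (φ ψ : Module.Dual k G) (a : G) :
    dualMul Q φ ψ a = TensorProduct.dualDistrib k G G (φ ⊗ₜ ψ) (Q.comul a) := rfl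

/-- The unit of `Ĝ`, which is the counit of `G`. -/
def dualOne (Q : QuasiBialgebra k G) : Module.Dual k G := Q.counit.toLinearMap

/-- The coproduct of `Ĝ` (for finite dimensional `G`): `⟨Δ̂ φ | a ⊗ b⟩ = ⟨φ | a b⟩`. -/
def dualComul [FiniteDimensional k G] :
    Module.Dual k G →ₗ[k] Module.Dual k G ⊗[k] Module.Dual k G :=
  (TensorProduct.dualDistribEquiv k G G).symm.toLinearMap ∘ₗ
    Module.Dual.transpose (LinearMap.mul' k G)

theorem dualDistrib_dualComul [FiniteDimensional k G] (φ : Module.Dual k G) (a b : G) :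
    TensorProduct.dualDistrib k G G (dualComul φ) (a ⊗ₜ b) = φ (a * b) := by
  have h : TensorProduct.dualDistribEquiv k G G (dualComul φ) =
      Module.Dual.transpose (LinearMap.mul' k G) φ :=
    LinearEquiv.apply_symm_apply _ _
  exact congrArg (fun f => f (a ⊗ₜ[k] b)) h

/-- The iterated coproduct `φ ↦ φ₁ ⊗ (φ₂ ⊗ φ₃)` of `Ĝ`. -/
def dualComul₂ [FiniteDimensional k G] :
    Module.Dual k G →ₗ[k] Module.Dual k G ⊗[k] (Module.Dual k G ⊗[k] Module.Dual k G) :=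
  LinearMap.lTensor _ dualComul ∘ₗ dualComul

end Dual

/-! ### The actions of `Ĝ` -/

section Actions

variable {k G M : Type*} [Field k] [Ring G] [Algebra k G] [Ring M] [Algebra k M]

/-- `φ ▷ m = (id ⊗ φ)(ρ m)`. -/
def dualActLeft (ρ : M →ₐ[k] M ⊗[k] G) (φ : Module.Dual k G) (m : M) : M :=
  TensorProduct.rid k M (LinearMap.lTensor M φ (ρ m))

/-- `m ◁ φ = (φ ⊗ id)(λ m)`. -/
def dualActRight (l : M →ₐ[k] G ⊗[k] M) (m : M) (φ : Module.Dual k G) : M :=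
  TensorProduct.lid k M (LinearMap.rTensor M φ (l m))

/-- The functional `ψ ⊗ id ⊗ φ : G ⊗ M ⊗ G → M`. -/
def contract (ψ φ : Module.Dual k G) : G ⊗[k] (M ⊗[k] G) →ₗ[k] M :=
  (TensorProduct.lid k M).toLinearMap ∘ₗ
    TensorProduct.map ψ ((TensorProduct.rid k M).toLinearMap ∘ₗ LinearMap.lTensor M φ)

@[simp] theorem contract_tmul (ψ φ : Module.Dual k G) (a b : G) (m : M) :
    contract ψ φ (a ⊗ₜ[k] (m ⊗ₜ[k] b)) = ψ a • φ b • m := rfl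

end Actions

/-! ### Elements attached to a quasi-Hopf algebra -/

section Twist

variable {k G : Type*} [Field k] [Ring G] [Algebra k G]

/-- `δ = (K ⊗ L)(β ⊗ β)(S(N) ⊗ S(M))`, where
`K ⊗ L ⊗ M ⊗ N = (Δ ⊗ id ⊗ id)(φ) (φ⁻¹ ⊗ 1)`. -/
def drinfeldDelta (H : QuasiHopfAlgebra k G) : G ⊗[k] G :=
  mulMap ((TensorProduct.mk k G G).flip 1 ∘ₗ LinearMap.mulRight k H.β)
    (mulMap (TensorProduct.mk k G G 1 ∘ₗ LinearMap.mulRight k H.β)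
      (mulMap (TensorProduct.mk k G G 1 ∘ₗ H.S.toLinearMap)
        ((TensorProduct.mk k G G).flip 1 ∘ₗ H.S.toLinearMap)))
    (splitLeft (G ⊗[k] G) H.comul (H.phi : G ⊗[k] (G ⊗[k] G)) *
      padRight G ((H.phi⁻¹ : (G ⊗[k] (G ⊗[k] G))ˣ) : G ⊗[k] (G ⊗[k] G)))

/-- The inverse of Drinfeld's twist,
`f⁻¹ = Δ(S(P) α Q) · δ · (S ⊗ S)(Δᵒᵖ(R))`, where `φ⁻¹ = P ⊗ Q ⊗ R`. -/
def drinfeldTwistInv (H : QuasiHopfAlgebra k G) : G ⊗[k] G :=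
  mulMap (H.comul.toLinearMap ∘ₗ LinearMap.mulRight k H.α ∘ₗ H.S.toLinearMap)
    (mulMap (LinearMap.mulRight k (drinfeldDelta H) ∘ₗ H.comul.toLinearMap)
      (TensorProduct.map H.S.toLinearMap H.S.toLinearMap ∘ₗ
        (TensorProduct.comm k G G).toLinearMap ∘ₗ H.comul.toLinearMap))
    ((H.phi⁻¹ : (G ⊗[k] (G ⊗[k] G))ˣ) : G ⊗[k] (G ⊗[k] G))

/-- `h⁻¹ = (S⁻¹ ⊗ S⁻¹)((f⁻¹)²¹)`. -/
def hInv (H : QuasiHopfAlgebra k G) : G ⊗[k] G :=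
  TensorProduct.map H.S.symm.toLinearMap H.S.symm.toLinearMap
    (TensorProduct.comm k G G (drinfeldTwistInv H))

/-- `q_λ = S(φ̄¹) α φ̄² ⊗ φ̄³`, where `φ_λ⁻¹ = φ̄¹ ⊗ φ̄² ⊗ φ̄³` is given as `w`. -/
def qElement {M : Type*} [Ring M] [Algebra k M] (H : QuasiHopfAlgebra k G)
    (w : G ⊗[k] (G ⊗[k] M)) : G ⊗[k] M :=
  LinearMap.rTensor M (mulMap (LinearMap.mulRight k H.α ∘ₗ H.S.toLinearMap) LinearMap.id)
    ((TensorProduct.assoc k G G M).symm w)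

end Twist

/-! ### The right diagonal crossed product `M ⋈_δ Ĝ`

It is the vector space `M ⊗ Ĝ` with the bilinear product `rightDiagMul`. -/

section Diagonal

variable {k G M : Type*} [Field k] [Ring G] [Algebra k G] [Ring M] [Algebra k M]

/-- `Ω_R = (h⁻¹)²¹ · (S⁻¹ ⊗ S⁻¹ ⊗ id ⊗ id ⊗ id)(Ψ)`. -/
def OmegaR (H : QuasiHopfAlgebra k G) (Ψ : G ⊗[k] (G ⊗[k] (M ⊗[k] (G ⊗[k] G)))) :
    G ⊗[k] (G ⊗[k] (M ⊗[k] (G ⊗[k] G))) :=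
  Algebra.TensorProduct.assoc k k k G G (M ⊗[k] (G ⊗[k] G))
      (TensorProduct.comm k G G (hInv H) ⊗ₜ[k] (1 : M ⊗[k] (G ⊗[k] G))) *
    TensorProduct.map H.S.symm.toLinearMap
      (TensorProduct.map H.S.symm.toLinearMap LinearMap.id) Ψ

/-- For `Ω = Ω¹ ⊗ Ω² ⊗ Ω³ ⊗ Ω⁴ ⊗ Ω⁵` the endomorphism
`m ⊗ (φ ⊗ ψ) ↦ m Ω³ ⊗ ((Ω² ⇀ φ ↼ Ω⁴) ⊗ (Ω¹ ⇀ ψ ↼ Ω⁵))` of `M ⊗ (Ĝ ⊗ Ĝ)`. -/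
def omegaAct : G ⊗[k] (G ⊗[k] (M ⊗[k] (G ⊗[k] G))) →ₗ[k]
    Module.End k (M ⊗[k] (Module.Dual k G ⊗[k] Module.Dual k G)) :=
  mulMap (E := Module.End k (M ⊗[k] (Module.Dual k G ⊗[k] Module.Dual k G)))
    (LinearMap.lTensorHom M ∘ₗ LinearMap.lTensorHom (Module.Dual k G) ∘ₗ leftHit)
    (mulMap (LinearMap.lTensorHom M ∘ₗ LinearMap.rTensorHom (Module.Dual k G) ∘ₗ leftHit)
      (mulMap (LinearMap.rTensorHom (Module.Dual k G ⊗[k] Module.Dual k G) ∘ₗ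
          (LinearMap.mul k M).flip)
        (mulMap (LinearMap.lTensorHom M ∘ₗ LinearMap.rTensorHom (Module.Dual k G) ∘ₗ rightHit)
          (LinearMap.lTensorHom M ∘ₗ LinearMap.lTensorHom (Module.Dual k G) ∘ₗ rightHit))))

theorem omegaAct_tmul (a₁ a₂ a₄ a₅ : G) (x m : M) (φ ψ : Module.Dual k G) :
    omegaAct (a₁ ⊗ₜ[k] (a₂ ⊗ₜ[k] (x ⊗ₜ[k] (a₄ ⊗ₜ[k] a₅)))) (m ⊗ₜ[k] (φ ⊗ₜ[k] ψ)) =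
      (m * x) ⊗ₜ[k] (leftHit a₂ (rightHit a₄ φ) ⊗ₜ[k] leftHit a₁ (rightHit a₅ ψ)) := rfl

/-- The linear map `χ₁ ⊗ (χ₂ ⊗ χ₃) ↦ (n ↦ (χ₁ ▷ n ◁ Ŝ⁻¹(χ₃)) ⊗ χ₂)`, where
`φ ▷ n ◁ ψ = (ψ ⊗ id ⊗ φ)(δ n)` and `Ŝ⁻¹(χ) = χ ∘ S⁻¹`. -/
def tripleAct (H : QuasiHopfAlgebra k G) (δ : M →ₐ[k] G ⊗[k] (M ⊗[k] G)) :
    Module.Dual k G ⊗[k] (Module.Dual k G ⊗[k] Module.Dual k G) →ₗ[k]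
      (M →ₗ[k] M ⊗[k] Module.Dual k G) :=
  TensorProduct.lift
    { toFun := fun χ₁ => TensorProduct.lift
        (LinearMap.mk₂ k
          (fun χ₂ χ₃ => (TensorProduct.mk k M (Module.Dual k G)).flip χ₂ ∘ₗ
            contract (χ₃ ∘ₗ H.S.symm.toLinearMap) χ₁ ∘ₗ δ.toLinearMap)
          (by intros; ext; simp)
          (by intros; ext; simp)
          (by intros; ext; simp [contract, LinearMap.add_comp, TensorProduct.map_add_left])
          (by intros; ext; simp [contract, LinearMap.smul_comp, TensorProduct.map_smul_left,
                TensorProduct.smul_tmul']))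
      map_add' := by
        intros; ext
        simp [contract, LinearMap.lTensor_add, LinearMap.comp_add, TensorProduct.map_add_right]
      map_smul' := by
        intros; ext
        simp [contract, LinearMap.lTensor_smul, LinearMap.comp_smul, TensorProduct.map_smul_right,
          TensorProduct.smul_tmul'] }

theorem tripleAct_tmul (H : QuasiHopfAlgebra k G) (δ : M →ₐ[k] G ⊗[k] (M ⊗[k] G))
    (χ₁ χ₂ χ₃ : Module.Dual k G) (n : M) :
    tripleAct H δ (χ₁ ⊗ₜ[k] (χ₂ ⊗ₜ[k] χ₃)) n =
      contract (χ₃ ∘ₗ H.S.symm.toLinearMap) χ₁ (δ n) ⊗ₜ[k] χ₂ := rfl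

/-- The product of the right diagonal crossed product,
`(m ⋈ φ)(n ⋈ ψ) = m (φ₁ ▷ n ◁ Ŝ⁻¹(φ₃)) Ω³ ⋈ (Ω² ⇀ φ₂ ↼ Ω⁴)(Ω¹ ⇀ ψ ↼ Ω⁵)` with `Ω = Ω_R`. -/
def rightDiagMul [FiniteDimensional k G] (H : QuasiHopfAlgebra k G)
    (δ : M →ₐ[k] G ⊗[k] (M ⊗[k] G)) (Ψ : G ⊗[k] (G ⊗[k] (M ⊗[k] (G ⊗[k] G)))) :
    M ⊗[k] Module.Dual k G →ₗ[k] M ⊗[k] Module.Dual k G →ₗ[k] M ⊗[k] Module.Dual k G :=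
  TensorProduct.lift <| LinearMap.mk₂ k
    (fun m φ => TensorProduct.lift <| LinearMap.mk₂ k
      (fun n ψ =>
        LinearMap.lTensor M (TensorProduct.lift (dualMul H.toQuasiBialgebra))
          (omegaAct (OmegaR H Ψ)
            (TensorProduct.assoc k M (Module.Dual k G) (Module.Dual k G)
              (LinearMap.rTensor (Module.Dual k G) (LinearMap.mul k M m)
                (tripleAct H δ (dualComul₂ φ) n) ⊗ₜ[k] ψ))))
      (by intros; simp [TensorProduct.add_tmul])
      (by intros; simp [← TensorProduct.smul_tmul'])
      (by intros; simp [TensorProduct.tmul_add])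
      (by intros; simp))
    (by intros; ext; simp [TensorProduct.add_tmul])
    (by intros; ext; simp [← TensorProduct.smul_tmul'])
    (by intros; ext; simp [TensorProduct.add_tmul])
    (by intros; ext; simp [← TensorProduct.smul_tmul'])

theorem rightDiagMul_tmul [FiniteDimensional k G] (H : QuasiHopfAlgebra k G)
    (δ : M →ₐ[k] G ⊗[k] (M ⊗[k] G)) (Ψ : G ⊗[k] (G ⊗[k] (M ⊗[k] (G ⊗[k] G))))
    (m n : M) (φ ψ : Module.Dual k G) :
    rightDiagMul H δ Ψ (m ⊗ₜ[k] φ) (n ⊗ₜ[k] ψ) =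
      LinearMap.lTensor M (TensorProduct.lift (dualMul H.toQuasiBialgebra))
        (omegaAct (OmegaR H Ψ)
          (TensorProduct.assoc k M (Module.Dual k G) (Module.Dual k G)
            (LinearMap.rTensor (Module.Dual k G) (LinearMap.mul k M m)
              (tripleAct H δ (dualComul₂ φ) n) ⊗ₜ[k] ψ))) := rfl

/-- The linear map `a ⊗ m ⊗ b ↦ m ⋈ (S⁻¹(a) ⇀ φ ↼ b)`. -/
def implement (H : QuasiHopfAlgebra k G) (φ : Module.Dual k G) :
    G ⊗[k] (M ⊗[k] G) →ₗ[k] M ⊗[k] Module.Dual k G :=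
  LinearMap.lTensor M
      ((mulMap (E := Module.End k (Module.Dual k G))
        (leftHit ∘ₗ H.S.symm.toLinearMap) rightHit).flip φ) ∘ₗ
    (TensorProduct.leftComm k G M G).toLinearMap

@[simp] theorem implement_tmul (H : QuasiHopfAlgebra k G) (φ : Module.Dual k G) (a b : G) (m : M) :
    implement H φ (a ⊗ₜ[k] (m ⊗ₜ[k] b)) = m ⊗ₜ[k] leftHit (H.S.symm a) (rightHit b φ) := rfl

/-- `Γ(φ) = (q²)₀ ⋈ (S⁻¹(q¹) ⇀ φ ↼ (q²)₁)`, where `q = q¹ ⊗ q²` is `q_λ` and `ρ(m) = m₀ ⊗ m₁`. -/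
def gammaMap (H : QuasiHopfAlgebra k G) (ρ : M →ₐ[k] M ⊗[k] G) (q : G ⊗[k] M)
    (φ : Module.Dual k G) : M ⊗[k] Module.Dual k G :=
  implement H φ (onRight G ρ q)

end Diagonal

/-! ### The algebra `M₁ = (A ⊗ B) ⋈ Ĝ` -/

section TwoSided

variable {k G A B : Type*} [Field k] [Ring G] [Algebra k G] [Ring A] [Algebra k A]
  [Ring B] [Algebra k B]

/-- The trivial extension `a ⊗ b ↦ b₋₁ ⊗ (a ⊗ b₀)` of a left coaction on `B`. -/
def extLeft (A : Type*) [Ring A] [Algebra k A] (l : B →ₐ[k] G ⊗[k] B) :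
    A ⊗[k] B →ₐ[k] G ⊗[k] (A ⊗[k] B) :=
  (Algebra.TensorProduct.leftComm k A G B).toAlgHom.comp (onRight A l)

/-- The trivial extension `a ⊗ b ↦ (a₀ ⊗ b) ⊗ a₁` of a right coaction on `A`. -/
def extRight (B : Type*) [Ring B] [Algebra k B] (ρ : A →ₐ[k] A ⊗[k] G) :
    A ⊗[k] B →ₐ[k] (A ⊗[k] B) ⊗[k] G :=
  (Algebra.TensorProduct.assoc k k k A B G).symm.toAlgHom.comp
    ((onRight A (Algebra.TensorProduct.comm k G B).toAlgHom).comp (splitLeft B ρ))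

/-- The inclusion `G ⊗ G ⊗ B → G ⊗ G ⊗ (A ⊗ B)`. -/
def extPhiLeft (A : Type*) [Ring A] [Algebra k A] :
    G ⊗[k] (G ⊗[k] B) →ₐ[k] G ⊗[k] (G ⊗[k] (A ⊗[k] B)) :=
  onRight G (onRight G Algebra.TensorProduct.includeRight)

/-- The inclusion `A ⊗ G ⊗ G → (A ⊗ B) ⊗ G ⊗ G`. -/
def extPhiRight (B : Type*) [Ring B] [Algebra k B] :
    A ⊗[k] (G ⊗[k] G) →ₐ[k] (A ⊗[k] B) ⊗[k] (G ⊗[k] G) :=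
  Algebra.TensorProduct.map Algebra.TensorProduct.includeLeft (AlgHom.id k (G ⊗[k] G))

variable {Q : QuasiBialgebra k G}

/-- The two-sided coaction `δ_r = (id ⊗ ρ) ∘ λ` on `A ⊗ B`. -/
def deltaR (R : RightCoaction Q A) (L : LeftCoaction Q B) :
    A ⊗[k] B →ₐ[k] G ⊗[k] ((A ⊗[k] B) ⊗[k] G) :=
  (onRight G (extRight B R.coact)).comp (extLeft A L.coact)

/-- Its reassociator `Ψ = [1 ⊗ 1 ⊗ φ_ρ⁻¹] [φ_λ ⊗ 1 ⊗ 1]`. -/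
def PsiR (R : RightCoaction Q A) (L : LeftCoaction Q B) :
    G ⊗[k] (G ⊗[k] ((A ⊗[k] B) ⊗[k] (G ⊗[k] G))) :=
  padLeft G (padLeft G (extPhiRight B
      ((R.phi⁻¹ : (A ⊗[k] (G ⊗[k] G))ˣ) : A ⊗[k] (G ⊗[k] G)))) *
    padRight (G ⊗[k] G) (extPhiLeft A (L.phi : G ⊗[k] (G ⊗[k] B)))

variable {H : QuasiHopfAlgebra k G}

/-- The underlying vector space `(A ⊗ B) ⊗ Ĝ` of `M₁ = (A ⊗ B) ⋈ Ĝ`. -/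
abbrev CrossedSpace (k G A B : Type*) [Field k] [Ring G] [Algebra k G] [Ring A] [Algebra k A]
    [Ring B] [Algebra k B] : Type _ :=
  (A ⊗[k] B) ⊗[k] Module.Dual k G

/-- The product of `M₁`, the right diagonal crossed product for `(δ_r, Ψ)`. -/
def crossedMul [FiniteDimensional k G] (R : RightCoaction H.toQuasiBialgebra A)
    (L : LeftCoaction H.toQuasiBialgebra B) :
    CrossedSpace k G A B →ₗ[k] CrossedSpace k G A B →ₗ[k] CrossedSpace k G A B :=
  rightDiagMul H (deltaR R L) (PsiR R L)

/-- The embedding `a ↦ (a ⊗ 1) ⋈ 1̂` of `A` in `M₁`. -/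
def inclA (H : QuasiHopfAlgebra k G) (B : Type*) [Ring B] [Algebra k B] (a : A) :
    CrossedSpace k G A B :=
  (a ⊗ₜ[k] (1 : B)) ⊗ₜ[k] dualOne H.toQuasiBialgebra

/-- The embedding `b ↦ (1 ⊗ b) ⋈ 1̂` of `B` in `M₁`. -/
def inclB (H : QuasiHopfAlgebra k G) (A : Type*) [Ring A] [Algebra k A] (b : B) :
    CrossedSpace k G A B :=
  ((1 : A) ⊗ₜ[k] b) ⊗ₜ[k] dualOne H.toQuasiBialgebra

/-- The unit `(1 ⊗ 1) ⋈ 1̂` of `M₁`. -/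
def crossedOne (H : QuasiHopfAlgebra k G) (A B : Type*) [Ring A] [Algebra k A]
    [Ring B] [Algebra k B] : CrossedSpace k G A B :=
  (1 : A ⊗[k] B) ⊗ₜ[k] dualOne H.toQuasiBialgebra

/-- The map `Γ : Ĝ → M₁` with `Γ(φ) = (φ ⊗ id)(𝚪)` for the universal `λρ`-intertwiner `𝚪`. -/
def crossedGamma (R : RightCoaction H.toQuasiBialgebra A)
    (L : LeftCoaction H.toQuasiBialgebra B) (φ : Module.Dual k G) : CrossedSpace k G A B :=
  gammaMap H (extRight B R.coact)
    (qElement H (extPhiLeft A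
      ((L.phi⁻¹ : (G ⊗[k] (G ⊗[k] B))ˣ) : G ⊗[k] (G ⊗[k] B)))) φ

end TwoSided

end QuasiHopf

end

open scoped TensorProduct

noncomputable section

namespace QuasiHopf

set_option maxSynthPendingDepth 20

/-! ### Induction on pure tensors and the leg maps -/

section Legs

variable {k : Type*} [Field k]

/-! Inside `M₁` the element `a Γ(φ) b` is obtained by multiplying `q = S(φ̄¹) α φ̄² ⊗ φ̄³` by `λ(b)`
and letting `S⁻¹` of the resulting `G`-leg act on `φ`. This recipe is `muEquiv`. Its inverse uses
the companion `p = φ_λ² S⁻¹(φ_λ¹ β) ⊗ φ_λ³`: the pentagon of `φ_λ` and the two normalizations of `α,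
β` give the zigzag identities `qInsert_pMap` and `pInsert_qMap`, and these give (i).

For the product, identify `M ⊗ Ĝ` with `Hom(G, M)`. Both the diagonal product and the claimed
product are then functions of the form `x ↦ (φ ⊗ ψ)((u ⊗ 1)(1 ⊗ Δ(x) ⊗ 1)(1 ⊗ v))` with `u ∈ A ⊗ G ⊗
G` and `v ∈ G ⊗ G ⊗ B` (`dualPair`), with the same `u` (`leftFactor`). The right coaction therefore
plays no part in comparing them, and multiplicativity of `muEquiv` reduces to one identity in `G ⊗ G
⊗ B`, `twistedMap_inv_mul`.

That identity contains the coproduct of `S⁻¹(q¹)`, hence Drinfeld's twist. Two facts are needed: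
`f⁻¹` intertwines `Δ ∘ S` with `(S ⊗ S) Δᵒᵖ`, and `γ f⁻¹ = (S ⊗ S) Δᵒᵖ(S⁻¹(α))`. Both are instances
of the uniqueness of an antipode up to a twist: along `Δ : G → G ⊗ G`, the data `(Δ ∘ S, Δ(α),
Δ(β))` are compared with `((S ⊗ S) Δᵒᵖ, γ, δ)`. The first fact is formal. The second requires the
zigzag `Δ(X) δ (S ⊗ S)(Δᵒᵖ(Y)) γ Δ(Z) = 1` (`zigzagMap_phi`), a pentagon computation in six tensor
factors, and an inverse of `f⁻¹`, which is where finite dimension enters beyond duality.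

Associativity and the unit laws are not checked on the diagonal product. They are proved for the
transported product `starMul`, where `A` and `B` sit on opposite sides of `Δ(x)` and the
reassociator `φ` released by the pentagon of `φ_ρ` is absorbed by that of `φ_λ`; bijectivity of
`muEquiv` then carries them back to `M₁`. The normalization `ε(α) = 1` makes `muEquiv` fix `(a ⊗ b)
⊗ 1̂`, so the embedded copies of `A` and `B` and the unit correspond on both sides. -/

theorem induction₂ {X Y : Type*} [AddCommGroup X] [AddCommGroup Y] [Module k X] [Module k Y]
    {P : X ⊗[k] Y → Prop} (t : X ⊗[k] Y) (tmul : ∀ x y, P (x ⊗ₜ y))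
    (add : ∀ s t, P s → P t → P (s + t)) : P t :=
  -- Zero is the pure tensor `0 ⊗ 0`, so no separate zero case is needed.
  TensorProduct.induction_on t (by simpa using tmul 0 0) tmul add

theorem induction₃ {X Y Z : Type*} [AddCommGroup X] [AddCommGroup Y] [AddCommGroup Z]
    [Module k X] [Module k Y] [Module k Z] {P : X ⊗[k] (Y ⊗[k] Z) → Prop}
    (t : X ⊗[k] (Y ⊗[k] Z)) (tmul : ∀ x y z, P (x ⊗ₜ (y ⊗ₜ z)))
    (add : ∀ s t, P s → P t → P (s + t)) : P t := by
  refine induction₂ t (fun x s => ?_) add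
  induction s using induction₂ with
  | tmul y z => exact tmul x y z
  | add s t hs ht => rw [TensorProduct.tmul_add]; exact add _ _ hs ht

theorem induction₄ {X Y Z W : Type*} [AddCommGroup X] [AddCommGroup Y] [AddCommGroup Z]
    [AddCommGroup W] [Module k X] [Module k Y] [Module k Z] [Module k W]
    {P : X ⊗[k] (Y ⊗[k] (Z ⊗[k] W)) → Prop}
    (t : X ⊗[k] (Y ⊗[k] (Z ⊗[k] W))) (tmul : ∀ x y z w, P (x ⊗ₜ (y ⊗ₜ (z ⊗ₜ w))))
    (add : ∀ s t, P s → P t → P (s + t)) : P t := by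
  refine induction₂ t (fun x s => ?_) add
  induction s using induction₃ with
  | tmul y z w => exact tmul x y z w
  | add s t hs ht => rw [TensorProduct.tmul_add]; exact add _ _ hs ht

variable {X X₁ X₂ Y Z W : Type*} [Ring X] [Ring X₁] [Ring X₂] [Ring Y] [Ring Z] [Ring W]
variable [Algebra k X] [Algebra k X₁] [Algebra k X₂] [Algebra k Y] [Algebra k Z] [Algebra k W]

theorem splitLeft_tmul (f : X →ₐ[k] X₁ ⊗[k] X₂) (x : X) (y : Y) :
    splitLeft Y f (x ⊗ₜ y) = Algebra.TensorProduct.assoc k k k X₁ X₂ Y (f x ⊗ₜ y) := rfl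

theorem onRight_tmul (f : X →ₐ[k] Z) (x : X) (y : Y) : onRight Y f (y ⊗ₜ x) = y ⊗ₜ f x := rfl

theorem padLeft_apply (x : X) : padLeft W x = (1 : W) ⊗ₜ[k] x := rfl

theorem padRight_tmul (x : X) (y : Y) (z : Z) :
    padRight W (x ⊗ₜ[k] (y ⊗ₜ[k] z)) = x ⊗ₜ (y ⊗ₜ (z ⊗ₜ 1)) := rfl

theorem killLeft_tmul (ε : X →ₐ[k] k) (x : X) (y : Y) : killLeft Y ε (x ⊗ₜ y) = ε x • y := rfl

theorem killRight_tmul (ε : X →ₐ[k] k) (x : X) (y : Y) : killRight Y ε (y ⊗ₜ x) = ε x • y := rfl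

theorem assoc_tmul (x : X) (y : Y) (z : Z) :
    Algebra.TensorProduct.assoc k k k X Y Z ((x ⊗ₜ y) ⊗ₜ z) = x ⊗ₜ (y ⊗ₜ z) := rfl

end Legs

theorem QuasiBialgebra.coassoc_inv {k G : Type*} [Field k] [Ring G] [Algebra k G]
    (Q : QuasiBialgebra k G) (a : G) :
    (Q.phi⁻¹).val * onRight G Q.comul (Q.comul a) =
      splitLeft G Q.comul (Q.comul a) * (Q.phi⁻¹).val := by
  rw [Units.inv_mul_eq_iff_eq_mul, ← mul_assoc, Units.eq_mul_inv_iff_mul_eq, Q.quasi_coassoc]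

/-! ### Naturality of the leg maps -/

section Naturality

variable {k : Type*} [Field k]
variable {X X₁ X₂ Y Z W : Type*} [Ring X] [Ring X₁] [Ring X₂] [Ring Y] [Ring Z] [Ring W]
variable [Algebra k X] [Algebra k X₁] [Algebra k X₂] [Algebra k Y] [Algebra k Z] [Algebra k W]

theorem onRight_onRight (f : Z →ₐ[k] W) (g : X →ₐ[k] Z) (w : Y ⊗[k] X) :
    onRight Y f (onRight Y g w) = onRight Y (f.comp g) w := by
  induction w using induction₂ with
  | add s t hs ht => simp only [map_add, hs, ht]
  | tmul x y => rfl

theorem onRight_eq_self {f : X →ₐ[k] X} (h : ∀ x, f x = x) (w : Y ⊗[k] X) :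
    onRight Y f w = w := by
  induction w using induction₂ with
  | add s t hs ht => simp only [map_add, hs, ht]
  | tmul x y => rw [onRight_tmul, h]

theorem splitLeft_onRight (f : X →ₐ[k] X₁ ⊗[k] X₂) (g : Y →ₐ[k] Z) (w : X ⊗[k] Y) :
    splitLeft Z f (onRight X g w) = onRight X₁ (onRight X₂ g) (splitLeft Y f w) := by
  induction w using induction₂ with
  | add s t hs ht => simp only [map_add, hs, ht]
  | tmul x y =>
    rw [onRight_tmul, splitLeft_tmul, splitLeft_tmul]
    generalize f x = m
    induction m using induction₂ with
    | add s t hs ht => simp only [TensorProduct.add_tmul, map_add, hs, ht]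
    | tmul a b => rfl

theorem killLeft_onRight (ε : X →ₐ[k] k) (g : Y →ₐ[k] Z) (w : X ⊗[k] Y) :
    killLeft Z ε (onRight X g w) = g (killLeft Y ε w) := by
  induction w using induction₂ with
  | add s t hs ht => simp only [map_add, hs, ht]
  | tmul x y => rw [onRight_tmul, killLeft_tmul, killLeft_tmul, map_smul]

theorem map_inv_mul_map (f : X →ₐ[k] Y) (u : Xˣ) : f u⁻¹.val * f u.val = 1 := by
  rw [← map_mul, Units.inv_mul, map_one]

theorem map_mul_map_inv (f : X →ₐ[k] Y) (u : Xˣ) : f u.val * f u⁻¹.val = 1 := by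
  rw [← map_mul, Units.mul_inv, map_one]

theorem map_inv_eq_one {f : X →ₐ[k] Y} {u : Xˣ} (h : f u.val = 1) : f u⁻¹.val = 1 := by
  simpa [h] using map_inv_mul_map f u

end Naturality

/-! ### Counit identities for the reassociator -/

namespace QuasiBialgebra

variable {k G : Type*} [Field k] [Ring G] [Algebra k G] (Q : QuasiBialgebra k G)
  {T : Type*} [Ring T] [Algebra k T]

theorem killLeft_splitLeft (w : G ⊗[k] T) :
    killLeft (G ⊗[k] T) Q.counit (splitLeft T Q.comul w) = w := by
  induction w using induction₂ with
  | add s t hs ht => simp only [map_add, hs, ht]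
  | tmul x y =>
    rw [splitLeft_tmul]
    conv_rhs => rw [← Q.counit_left x]
    generalize Q.comul x = m
    induction m using induction₂ with
    | add s t hs ht => simp only [TensorProduct.add_tmul, map_add, hs, ht]
    | tmul a b => simp [killLeft_tmul, TensorProduct.smul_tmul']

theorem onRight_killLeft_splitLeft (w : G ⊗[k] T) :
    onRight G (killLeft T Q.counit) (splitLeft T Q.comul w) = w := by
  induction w using induction₂ with
  | add s t hs ht => simp only [map_add, hs, ht]
  | tmul x y =>
    rw [splitLeft_tmul]
    conv_rhs => rw [← Q.counit_right x]
    generalize Q.comul x = m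
    induction m using induction₂ with
    | add s t hs ht => simp only [TensorProduct.add_tmul, map_add, hs, ht]
    | tmul a b =>
      simp [onRight_tmul, killLeft_tmul, killRight_tmul, TensorProduct.smul_tmul']

/-- Applying `ε` to the second leg of the pentagon turns it into `φ = (1 ⊗ (ε ⊗ id ⊗ id)(φ)) φ`, and
`φ` cancels. -/
theorem counit_phi_left : killLeft (G ⊗[k] G) Q.counit Q.phi.val = 1 := by
  have h := congrArg (onRight G (killLeft (G ⊗[k] G) Q.counit)) Q.pentagon
  have h₁ : onRight G (killLeft (G ⊗[k] G) Q.counit) (onRight G (onRight G Q.comul) Q.phi.val) =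
      1 := by
    rw [onRight_onRight, show (killLeft (G ⊗[k] G) Q.counit).comp (onRight G Q.comul) =
      Q.comul.comp (killLeft G Q.counit) from AlgHom.ext (killLeft_onRight _ _),
      ← onRight_onRight, Q.counit_phi, map_one]
  have h₂ : onRight G (killLeft (G ⊗[k] G) Q.counit) (padLeft G Q.phi.val) =
      padLeft G (killLeft (G ⊗[k] G) Q.counit Q.phi.val) := rfl
  have h₃ : onRight G (killLeft (G ⊗[k] G) Q.counit) (padRight G Q.phi.val) = 1 := by
    rw [padRight, onRight_onRight,
      show (killLeft (G ⊗[k] G) Q.counit).comp (onRight G Algebra.TensorProduct.includeLeft) =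
      (Algebra.TensorProduct.includeLeft (R := k) (S := k) (B := G)).comp (killLeft G Q.counit)
      from AlgHom.ext (killLeft_onRight _ _), ← onRight_onRight, Q.counit_phi, map_one]
  simp only [map_mul] at h
  rw [h₁, h₂, h₃, onRight_killLeft_splitLeft, onRight_onRight, one_mul, mul_one,
    onRight_eq_self (f := AlgHom.comp _ _) Q.killLeft_splitLeft] at h
  have h' := congrArg (fun x => killLeft (G ⊗[k] G) Q.counit (x * Q.phi⁻¹.val)) h
  simp only [mul_assoc, Units.mul_inv, mul_one, map_one] at h'
  simpa [padLeft_apply, killLeft_tmul] using h'.symm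

/-- The same argument on the third leg of the pentagon: it becomes `φ = φ ((id ⊗ id ⊗ ε)(φ) ⊗ 1)`.
-/
theorem counit_phi_right : onRight G (killRight G Q.counit) Q.phi.val = 1 := by
  set e : G ⊗[k] (G ⊗[k] (G ⊗[k] G)) →ₐ[k] G ⊗[k] (G ⊗[k] G) :=
    onRight G (onRight G (killLeft G Q.counit)) with he
  have h := congrArg e Q.pentagon
  have h₁ : e (onRight G (onRight G Q.comul) Q.phi.val) = Q.phi.val := by
    rw [he, onRight_onRight, onRight_eq_self]
    intro x
    rw [AlgHom.comp_apply, onRight_onRight, onRight_eq_self]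
    exact Q.counit_left
  have h₂ : e (splitLeft (G ⊗[k] G) Q.comul Q.phi.val) = 1 := by
    rw [he, ← splitLeft_onRight, Q.counit_phi, map_one]
  have h₃ : e (padLeft G Q.phi.val) = 1 := by
    rw [he, padLeft_apply, onRight_tmul, Q.counit_phi]; rfl
  have h₄ : e (onRight G (splitLeft G Q.comul) Q.phi.val) = Q.phi.val := by
    rw [he, onRight_onRight, onRight_eq_self]
    exact Q.onRight_killLeft_splitLeft
  have h₅ : ∀ t, e (padRight G t) =
      onRight G Algebra.TensorProduct.includeLeft (onRight G (killRight G Q.counit) t) := by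
    intro t
    induction t using induction₃ with
    | add s t hs ht => simp only [map_add, hs, ht]
    | tmul x y z =>
      simp [he, padRight_tmul, onRight_tmul, killLeft_tmul, killRight_tmul]
  simp only [map_mul] at h
  rw [h₁, h₂, h₃, h₄, h₅, one_mul, mul_one] at h
  have h' := congrArg (fun x => onRight G (killRight G Q.counit) (Q.phi⁻¹.val * x)) h
  simp only [Units.inv_mul_cancel_left, Units.inv_mul, map_one] at h'
  rw [onRight_onRight, onRight_eq_self] at h'
  · exact h'.symm
  · intro x; simp [killRight_tmul]

/-- The left coaction of `G` on itself by `Δ`. -/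
def selfCoaction : LeftCoaction Q G where
  coact := Q.comul
  phi := Q.phi
  quasi_coassoc := Q.quasi_coassoc
  pentagon := Q.pentagon.symm
  counit_coact := Q.counit_left
  counit_phi_mid := Q.counit_phi
  counit_phi_left := Q.counit_phi_left

/-- Quasi-coassociativity with a spectator leg: the factor `1 ⊗ 1 ⊗ 1 ⊗ d` commutes with anything
padded by `1` on the right. -/
theorem coassoc_padRight (w : G ⊗[k] T) :
    padRight T Q.phi⁻¹.val * onRight G (splitLeft T Q.comul) (splitLeft T Q.comul w) =
      splitLeft (G ⊗[k] T) Q.comul (splitLeft T Q.comul w) * padRight T Q.phi⁻¹.val := by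
  induction w using induction₂ with
  | add s t hs ht => simp only [map_add, mul_add, add_mul, hs, ht]
  | tmul c d =>
  have h₁ : ∀ m : G ⊗[k] G, onRight G (splitLeft T Q.comul)
      (Algebra.TensorProduct.assoc k k k G G T (m ⊗ₜ d)) =
      padRight T (onRight G Q.comul m) * (1 ⊗ₜ (1 ⊗ₜ (1 ⊗ₜ d))) := by
    intro m
    induction m using induction₂ with
    | add s t hs ht => simp only [TensorProduct.add_tmul, map_add, add_mul, hs, ht]
    | tmul a b =>
      rw [assoc_tmul, onRight_tmul, onRight_tmul, splitLeft_tmul]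
      generalize Q.comul b = n
      induction n using induction₂ with
      | add s t hs ht =>
        simp only [TensorProduct.add_tmul, TensorProduct.tmul_add, map_add, add_mul, hs, ht]
      | tmul a b => simp [padRight_tmul]
  have h₂ : ∀ m : G ⊗[k] G, splitLeft (G ⊗[k] T) Q.comul
      (Algebra.TensorProduct.assoc k k k G G T (m ⊗ₜ d)) =
      (1 ⊗ₜ (1 ⊗ₜ (1 ⊗ₜ d))) * padRight T (splitLeft G Q.comul m) := by
    intro m
    induction m using induction₂ with
    | add s t hs ht => simp only [TensorProduct.add_tmul, map_add, mul_add, hs, ht]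
    | tmul a b =>
      rw [assoc_tmul, splitLeft_tmul, splitLeft_tmul]
      generalize Q.comul a = n
      induction n using induction₂ with
      | add s t hs ht =>
        simp only [TensorProduct.add_tmul, map_add, mul_add, hs, ht]
      | tmul a b => simp [padRight_tmul]
  have h₃ : ∀ m : G ⊗[k] (G ⊗[k] G), padRight T m * (1 ⊗ₜ (1 ⊗ₜ (1 ⊗ₜ d))) =
      (1 ⊗ₜ (1 ⊗ₜ (1 ⊗ₜ d))) * padRight T m := by
    intro m
    induction m using induction₃ with
    | add s t hs ht => simp only [map_add, mul_add, add_mul, hs, ht]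
    | tmul a b c => simp [padRight_tmul]
  rw [splitLeft_tmul, h₁, h₂, ← mul_assoc, ← map_mul, mul_assoc, ← map_mul, Q.coassoc_inv, h₃]

end QuasiBialgebra

/-! ### Rearranged pentagons of a left coaction -/

namespace LeftCoaction

variable {k G : Type*} [Field k] [Ring G] [Algebra k G] {Q : QuasiBialgebra k G}
  {T : Type*} [Ring T] [Algebra k T] (L : LeftCoaction Q T)

theorem coassoc_inv (m : T) :
    L.phi⁻¹.val * onRight G L.coact (L.coact m) =
      splitLeft T Q.comul (L.coact m) * L.phi⁻¹.val := by
  rw [Units.inv_mul_eq_iff_eq_mul, ← mul_assoc, Units.eq_mul_inv_iff_mul_eq, L.quasi_coassoc]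

theorem counit_phi_inv_mid : onRight G (killLeft T Q.counit) L.phi⁻¹.val = 1 :=
  map_inv_eq_one L.counit_phi_mid

theorem counit_phi_inv_left : killLeft (G ⊗[k] T) Q.counit L.phi⁻¹.val = 1 :=
  map_inv_eq_one L.counit_phi_left

/-- `(id ⊗ id ⊗ λ)(φ_λ⁻¹) (1 ⊗ φ_λ) = (Δ ⊗ id ⊗ id)(φ_λ) (φ⁻¹ ⊗ 1) (id ⊗ Δ ⊗ id)(φ_λ⁻¹)` -/
theorem pentagon_inv_mul : onRight G (onRight G L.coact) L.phi⁻¹.val * padLeft G L.phi.val =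
    splitLeft (G ⊗[k] T) Q.comul L.phi.val * padRight T Q.phi⁻¹.val *
      onRight G (splitLeft T Q.comul) L.phi⁻¹.val := by
  have h := congrArg (fun x => onRight G (onRight G L.coact) L.phi⁻¹.val * x *
    padRight T Q.phi⁻¹.val * onRight G (splitLeft T Q.comul) L.phi⁻¹.val) L.pentagon
  simp only [← mul_assoc] at h
  rw [map_inv_mul_map, one_mul] at h
  simpa only [mul_assoc, mul_one, map_mul_map_inv, mul_inv_cancel_left,
    show ∀ x, padRight T Q.phi.val * (padRight T Q.phi⁻¹.val * x) = x from fun x => by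
      rw [← mul_assoc, map_mul_map_inv, one_mul]] using h

/-- `(1 ⊗ φ_λ⁻¹) (id ⊗ id ⊗ λ)(φ_λ) = (id ⊗ Δ ⊗ id)(φ_λ) (φ ⊗ 1) (Δ ⊗ id ⊗ id)(φ_λ⁻¹)` -/
theorem inv_mul_pentagon : padLeft G L.phi⁻¹.val * onRight G (onRight G L.coact) L.phi.val =
    onRight G (splitLeft T Q.comul) L.phi.val * padRight T Q.phi.val *
      splitLeft (G ⊗[k] T) Q.comul L.phi⁻¹.val := by
  have h := congrArg (fun x => padLeft G L.phi⁻¹.val * x *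
    splitLeft (G ⊗[k] T) Q.comul L.phi⁻¹.val) L.pentagon
  simp only [← mul_assoc] at h
  rw [map_inv_mul_map, one_mul] at h
  rw [h, mul_assoc _ _ (splitLeft (G ⊗[k] T) Q.comul L.phi⁻¹.val), map_mul_map_inv, mul_one]

/-- `(φ⁻¹ ⊗ 1) (id ⊗ Δ ⊗ id)(φ_λ⁻¹) (1 ⊗ φ_λ⁻¹) = (Δ ⊗ id ⊗ id)(φ_λ⁻¹) (id ⊗ id ⊗ λ)(φ_λ⁻¹)` -/
theorem pentagon_inv : padRight T Q.phi⁻¹.val * onRight G (splitLeft T Q.comul) L.phi⁻¹.val *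
      padLeft G L.phi⁻¹.val =
    splitLeft (G ⊗[k] T) Q.comul L.phi⁻¹.val * onRight G (onRight G L.coact) L.phi⁻¹.val := by
  have h := congrArg (fun x => splitLeft (G ⊗[k] T) Q.comul L.phi⁻¹.val * x *
    padLeft G L.phi⁻¹.val) L.pentagon_inv_mul
  simp only [← mul_assoc] at h
  rw [map_inv_mul_map, one_mul, mul_assoc _ (padLeft G L.phi.val), map_mul_map_inv, mul_one] at h
  exact h.symm

end LeftCoaction

/-! ### Elementary properties of the antipode -/

namespace QuasiHopfAlgebra

variable {k G : Type*} [Field k] [Ring G] [Algebra k G] (H : QuasiHopfAlgebra k G)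

theorem S_one : H.S 1 = 1 := by
  simpa using (H.S_mul (H.S.symm 1) 1).symm

theorem S_symm_mul (a b : G) : H.S.symm (a * b) = H.S.symm b * H.S.symm a :=
  H.S.injective (by simp [H.S_mul])

theorem S_symm_one : H.S.symm 1 = 1 := H.S.injective (by simp [H.S_one])

end QuasiHopfAlgebra

/-! ### Comparing two antipodes along an algebra map -/

section Twist

variable {k G E : Type*} [Field k] [Ring G] [Algebra k G] [Ring E] [Algebra k E]
  (H : QuasiHopfAlgebra k G) (j : G →ₐ[k] E) (S' : G →ₗ[k] E) (δ γ : E)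

/-- `x ⊗ y ⊗ z ↦ j(S(x) α y) δ S'(z)`. -/
def twistMap : G ⊗[k] (G ⊗[k] G) →ₗ[k] E :=
  mulMap (j.toLinearMap ∘ₗ LinearMap.mulRight k H.α ∘ₗ H.S.toLinearMap)
    (mulMap (LinearMap.mulRight k δ ∘ₗ j.toLinearMap) S')

theorem twistMap_tmul (x y z : G) :
    twistMap H j S' δ (x ⊗ₜ (y ⊗ₜ z)) = j (H.S x * H.α) * (j y * δ * S' z) := rfl

variable {H j S' δ γ}

/-- The pattern of all contraction lemmas below. On pure tensors the coproduct is replaced by an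
arbitrary `m : G ⊗ G`, for which `key` is linear and exhibits the left side of an antipode axiom as
an inner factor; putting the coproduct back collapses that factor to a counit. Here the factor is
`S(c₁) α c₂`. -/
theorem twistMap_splitLeft_mul (hS' : ∀ a b, S' (a * b) = S' b * S' a)
    (w : G ⊗[k] G) (t : G ⊗[k] (G ⊗[k] G)) :
    twistMap H j S' δ (splitLeft G H.comul w * t) =
      twistMap H j S' δ t * S' (killLeft G H.counit w) := by
  induction w using induction₂ with
  | add s t hs ht => simp only [map_add, add_mul, mul_add, hs, ht]
  | tmul c d =>
  induction t using induction₃ with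
  | add s t hs ht => simp only [map_add, mul_add, add_mul, hs, ht]
  | tmul x y z =>
  have key : ∀ m : G ⊗[k] G, twistMap H j S' δ
      (Algebra.TensorProduct.assoc k k k G G G (m ⊗ₜ d) * (x ⊗ₜ (y ⊗ₜ z))) =
      j (H.S x * mulMap (LinearMap.mulRight k H.α ∘ₗ H.S.toLinearMap) LinearMap.id m * y) *
        δ * S' z * S' d := by
    intro m
    induction m using induction₂ with
    | add s t hs ht => simp only [TensorProduct.add_tmul, map_add, mul_add, add_mul, hs, ht]
    | tmul a b =>
      simp [twistMap_tmul, H.S_mul, hS', mul_assoc]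
  rw [splitLeft_tmul, key, H.antipode_left, twistMap_tmul, killLeft_tmul]
  simp [mul_assoc]

theorem twistMap_mul_onRight (hS' : ∀ a b, S' (a * b) = S' b * S' a)
    (hδ : ∀ a, mulMap (LinearMap.mulRight k δ ∘ₗ j.toLinearMap) S' (H.comul a) =
      H.counit a • δ)
    (w : G ⊗[k] G) (t : G ⊗[k] (G ⊗[k] G)) :
    twistMap H j S' δ (t * onRight G H.comul w) =
      j (H.S (killRight G H.counit w)) * twistMap H j S' δ t := by
  induction w using induction₂ with
  | add s t hs ht => simp only [map_add, add_mul, mul_add, hs, ht]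
  | tmul c d =>
  induction t using induction₃ with
  | add s t hs ht => simp only [map_add, mul_add, add_mul, hs, ht]
  | tmul x y z =>
  have key : ∀ m : G ⊗[k] G, twistMap H j S' δ ((x ⊗ₜ (y ⊗ₜ z)) * (c ⊗ₜ m)) =
      j (H.S c * H.S x * H.α * y) *
        mulMap (LinearMap.mulRight k δ ∘ₗ j.toLinearMap) S' m * S' z := by
    intro m
    induction m using induction₂ with
    | add s t hs ht => simp only [TensorProduct.tmul_add, map_add, mul_add, add_mul, hs, ht]
    | tmul a b => simp [twistMap_tmul, H.S_mul, hS', mul_assoc]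
  rw [onRight_tmul, key, hδ, twistMap_tmul, killRight_tmul]
  simp [mul_assoc]

/-- Apply `twistMap` to `φ⁻¹ (id ⊗ Δ)Δ(a) = (Δ ⊗ id)Δ(a) φ⁻¹`. On the left the pair `Δ(a₂)` is
absorbed by `δ`, leaving `S(a)`; on the right `Δ(a₁)` is absorbed by `α`, leaving `S'(a)`. -/
theorem map_antipode_mul_twist (hS' : ∀ a b, S' (a * b) = S' b * S' a)
    (hδ : ∀ a, mulMap (LinearMap.mulRight k δ ∘ₗ j.toLinearMap) S' (H.comul a) =
      H.counit a • δ) (a : G) :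
    j (H.S a) * twistMap H j S' δ (H.phi⁻¹).val = twistMap H j S' δ (H.phi⁻¹).val * S' a := by
  have h := congrArg (twistMap H j S' δ) (H.coassoc_inv a)
  rwa [twistMap_mul_onRight hS' hδ, twistMap_splitLeft_mul hS', H.counit_left,
    H.counit_right] at h

variable (H j S' δ γ)

/-- `x ⊗ y ⊗ z ↦ j(x) δ S'(y) γ j(z)`. -/
def zigzagMap : G ⊗[k] (G ⊗[k] G) →ₗ[k] E :=
  mulMap (LinearMap.mulRight k δ ∘ₗ j.toLinearMap)
    (mulMap (LinearMap.mulRight k γ ∘ₗ S') j.toLinearMap)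

theorem zigzagMap_tmul (x y z : G) :
    zigzagMap j S' δ γ (x ⊗ₜ[k] (y ⊗ₜ[k] z)) = j x * δ * (S' y * γ * j z) := rfl

/-- `x ⊗ y ⊗ z ⊗ w ↦ j(S(x) α y) δ S'(z) γ j(w)`. -/
def twistZigzagMap : G ⊗[k] (G ⊗[k] (G ⊗[k] G)) →ₗ[k] E :=
  mulMap (j.toLinearMap ∘ₗ LinearMap.mulRight k H.α ∘ₗ H.S.toLinearMap) (zigzagMap j S' δ γ)

theorem twistZigzagMap_tmul (x y z w : G) :
    twistZigzagMap H j S' δ γ (x ⊗ₜ[k] (y ⊗ₜ[k] (z ⊗ₜ[k] w))) =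
      j (H.S x * H.α) * (j y * δ * (S' z * γ * j w)) := rfl

variable {H j S' δ γ}

theorem twistZigzagMap_padRight (t : G ⊗[k] (G ⊗[k] G)) :
    twistZigzagMap H j S' δ γ (padRight G t) = twistMap H j S' δ t * γ := by
  induction t using induction₃ with
  | add s t hs ht => simp only [map_add, add_mul, hs, ht]
  | tmul x y z => simp [padRight_tmul, twistZigzagMap_tmul, twistMap_tmul, mul_assoc]

theorem twistZigzagMap_padLeft (t : G ⊗[k] (G ⊗[k] G)) :
    twistZigzagMap H j S' δ γ (padLeft G t) = j H.α * zigzagMap j S' δ γ t := by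
  induction t using induction₃ with
  | add s t hs ht => simp only [map_add, mul_add, hs, ht]
  | tmul x y z =>
    simp [padLeft_apply, zigzagMap_tmul, twistZigzagMap_tmul, H.S_one]

theorem twistZigzagMap_splitLeft_mul (hS' : ∀ a b, S' (a * b) = S' b * S' a)
    (w : G ⊗[k] (G ⊗[k] G)) (t : G ⊗[k] (G ⊗[k] (G ⊗[k] G))) :
    twistZigzagMap H j S' δ γ (splitLeft (G ⊗[k] G) H.comul w * t) =
      twistZigzagMap H j S' δ γ (padLeft G (padLeft G (killLeft (G ⊗[k] G) H.counit w)) * t) := by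
  induction w using induction₃ with
  | add s t hs ht => simp only [map_add, add_mul, hs, ht]
  | tmul c d e =>
  induction t using induction₄ with
  | add s t hs ht => simp only [map_add, mul_add, hs, ht]
  | tmul x y z w =>
  have key : ∀ m : G ⊗[k] G, twistZigzagMap H j S' δ γ
      (Algebra.TensorProduct.assoc k k k G G (G ⊗[k] G) (m ⊗ₜ (d ⊗ₜ e)) *
        (x ⊗ₜ (y ⊗ₜ (z ⊗ₜ w)))) =
      j (H.S x * mulMap (LinearMap.mulRight k H.α ∘ₗ H.S.toLinearMap) LinearMap.id m * y) *
        δ * S' (d * z) * γ * j (e * w) := by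
    intro m
    induction m using induction₂ with
    | add s t hs ht => simp only [TensorProduct.add_tmul, map_add, mul_add, add_mul, hs, ht]
    | tmul a b => simp [twistZigzagMap_tmul, H.S_mul, hS', mul_assoc]
  rw [splitLeft_tmul, key, H.antipode_left, killLeft_tmul]
  simp [padLeft_apply, twistZigzagMap_tmul, mul_assoc]

theorem twistZigzagMap_onRight_mul (hS' : ∀ a b, S' (a * b) = S' b * S' a)
    (hγ : ∀ a, mulMap (LinearMap.mulRight k γ ∘ₗ S') j.toLinearMap (H.comul a) =
      H.counit a • γ)
    (w : G ⊗[k] (G ⊗[k] G)) (t : G ⊗[k] (G ⊗[k] (G ⊗[k] G))) :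
    twistZigzagMap H j S' δ γ (onRight G (onRight G H.comul) w * t) =
      twistZigzagMap H j S' δ γ
        (onRight G Algebra.TensorProduct.includeLeft (onRight G (killRight G H.counit) w) * t) := by
  induction w using induction₃ with
  | add s t hs ht => simp only [map_add, add_mul, hs, ht]
  | tmul c d e =>
  induction t using induction₄ with
  | add s t hs ht => simp only [map_add, mul_add, hs, ht]
  | tmul x y z w =>
  have key : ∀ m : G ⊗[k] G, twistZigzagMap H j S' δ γ
      ((c ⊗ₜ (d ⊗ₜ m)) * (x ⊗ₜ (y ⊗ₜ (z ⊗ₜ w)))) =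
      j (H.S (c * x) * H.α * d * y) * δ * S' z *
        mulMap (LinearMap.mulRight k γ ∘ₗ S') j.toLinearMap m * j w := by
    intro m
    induction m using induction₂ with
    | add s t hs ht => simp only [TensorProduct.tmul_add, map_add, mul_add, add_mul, hs, ht]
    | tmul a b => simp [twistZigzagMap_tmul, H.S_mul, hS', mul_assoc]
  rw [onRight_tmul, onRight_tmul, key, hγ, onRight_tmul, killRight_tmul]
  simp [onRight_tmul, twistZigzagMap_tmul, mul_assoc]

theorem twistZigzagMap_mul_split (hS' : ∀ a b, S' (a * b) = S' b * S' a)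
    (hδ : ∀ a, mulMap (LinearMap.mulRight k δ ∘ₗ j.toLinearMap) S' (H.comul a) =
      H.counit a • δ)
    (w : G ⊗[k] (G ⊗[k] G)) (t : G ⊗[k] (G ⊗[k] (G ⊗[k] G))) :
    twistZigzagMap H j S' δ γ (t * onRight G (splitLeft G H.comul) w) =
      twistZigzagMap H j S' δ γ
        (t * onRight G (padLeft G)
          (onRight G (padLeft G) (onRight G (killLeft G H.counit) w))) := by
  induction w using induction₃ with
  | add s t hs ht => simp only [map_add, mul_add, hs, ht]
  | tmul c d e =>
  induction t using induction₄ with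
  | add s t hs ht => simp only [map_add, add_mul, hs, ht]
  | tmul x y z w =>
  have key : ∀ m : G ⊗[k] G, twistZigzagMap H j S' δ γ
      ((x ⊗ₜ (y ⊗ₜ (z ⊗ₜ w))) * (c ⊗ₜ Algebra.TensorProduct.assoc k k k G G G (m ⊗ₜ e))) =
      j (H.S (x * c) * H.α * y) *
        mulMap (LinearMap.mulRight k δ ∘ₗ j.toLinearMap) S' m * S' z * γ * j (w * e) := by
    intro m
    induction m using induction₂ with
    | add s t hs ht =>
      simp only [TensorProduct.add_tmul, TensorProduct.tmul_add, map_add, mul_add, add_mul, hs, ht]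
    | tmul a b => simp [twistZigzagMap_tmul, H.S_mul, hS', mul_assoc]
  rw [onRight_tmul, splitLeft_tmul, key, hδ, onRight_tmul, killLeft_tmul]
  simp [onRight_tmul, padLeft_apply, twistZigzagMap_tmul, mul_assoc]

end Twist

/-! ### Invertibility of the comparison element -/

section TwistInverse

variable {k G E : Type*} [Field k] [Ring G] [Algebra k G] [Ring E] [Algebra k E]
  {H : QuasiHopfAlgebra k G} {j : G →ₐ[k] E} {S' : G →ₗ[k] E} {δ γ : E}

/-- Apply `twistZigzagMap` to `(id ⊗ id ⊗ Δ)(φ⁻¹)(1 ⊗ φ) = (Δ ⊗ id ⊗ id)(φ)(φ⁻¹ ⊗ 1)(id ⊗ Δ ⊗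
id)(φ⁻¹)`. Every leg carrying a coproduct straddles one of `α`, `δ`, `γ` and collapses to a counit,
so those factors become `1`. What remains is `j(α)` times the zigzag on the left and the twist times
`γ` on the right. -/
theorem twist_mul_of_zigzag (hS' : ∀ a b, S' (a * b) = S' b * S' a)
    (hδ : ∀ a, mulMap (LinearMap.mulRight k δ ∘ₗ j.toLinearMap) S' (H.comul a) =
      H.counit a • δ)
    (hγ : ∀ a, mulMap (LinearMap.mulRight k γ ∘ₗ S') j.toLinearMap (H.comul a) =
      H.counit a • γ)
    (h : zigzagMap j S' δ γ H.phi.val = 1) :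
    twistMap H j S' δ H.phi⁻¹.val * γ = j H.α := by
  have e := congrArg (twistZigzagMap H j S' δ γ)
    H.toQuasiBialgebra.selfCoaction.pentagon_inv_mul
  change twistZigzagMap H j S' δ γ (onRight G (onRight G H.comul) H.phi⁻¹.val * padLeft G H.phi.val)
    = twistZigzagMap H j S' δ γ (splitLeft (G ⊗[k] G) H.comul H.phi.val * padRight G H.phi⁻¹.val *
      onRight G (splitLeft G H.comul) H.phi⁻¹.val) at e
  rw [twistZigzagMap_onRight_mul hS' hγ, twistZigzagMap_mul_split hS' hδ,
    map_inv_eq_one H.counit_phi_right, map_inv_eq_one H.counit_phi, map_one, map_one, map_one,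
    one_mul, mul_one, twistZigzagMap_padLeft, h, mul_one,
    twistZigzagMap_splitLeft_mul hS', H.counit_phi_left, map_one, map_one, one_mul,
    twistZigzagMap_padRight] at e
  exact e.symm

/-- With `F` the twist, a right inverse is `S'(P) γ j(Q β S(R))`: moving `S'(P)` to the left across
`F` turns it into `j(S(P))`, then `F γ = j(α)`, and the product is `j(S(P) α Q β S(R)) = 1`. -/
theorem exists_twist_mul_eq_one (hS' : ∀ a b, S' (a * b) = S' b * S' a)
    (hδ : ∀ a, mulMap (LinearMap.mulRight k δ ∘ₗ j.toLinearMap) S' (H.comul a) =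
      H.counit a • δ)
    (h : twistMap H j S' δ H.phi⁻¹.val * γ = j H.α) :
    ∃ f, twistMap H j S' δ H.phi⁻¹.val * f = 1 := by
  let F : G ⊗[k] (G ⊗[k] G) →ₗ[k] E := mulMap (LinearMap.mulRight k γ ∘ₗ S')
    (j.toLinearMap ∘ₗ mulMap (LinearMap.mulRight k H.β) H.S.toLinearMap)
  refine ⟨F H.phi⁻¹.val, ?_⟩
  have key : ∀ t, twistMap H j S' δ H.phi⁻¹.val * F t =
      j (mulMap (LinearMap.mulRight k H.α ∘ₗ H.S.toLinearMap)
        (mulMap (LinearMap.mulRight k H.β) H.S.toLinearMap) t) := by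
    intro t
    induction t using induction₃ with
    | add s t hs ht => simp only [map_add, mul_add, hs, ht]
    | tmul x y z =>
      have e : F (x ⊗ₜ (y ⊗ₜ z)) = S' x * γ * j (y * H.β * H.S z) := rfl
      rw [e, ← mul_assoc, ← mul_assoc, ← map_antipode_mul_twist hS' hδ, mul_assoc _ _ γ, h]
      simp [mul_assoc]
  rw [key, H.antipode_phi_inv, map_one]

/-- For the twist `F`, both `F γ F` and `F S'(S⁻¹(α))` equal `j(α) F`, so it remains to cancel `F`
on the left. -/
theorem gamma_mul_twist [FiniteDimensional k E] (hS' : ∀ a b, S' (a * b) = S' b * S' a)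
    (hδ : ∀ a, mulMap (LinearMap.mulRight k δ ∘ₗ j.toLinearMap) S' (H.comul a) =
      H.counit a • δ)
    (h : twistMap H j S' δ H.phi⁻¹.val * γ = j H.α) :
    γ * twistMap H j S' δ H.phi⁻¹.val = S' (H.S.symm H.α) := by
  obtain ⟨f, hf⟩ := exists_twist_mul_eq_one hS' hδ h
  have hf' : f * twistMap H j S' δ H.phi⁻¹.val = 1 := by
    -- Left multiplication by the twist is surjective, hence injective on the finite dimensional
    -- `E`; the right inverse is therefore also a left inverse.
    have hs : Function.Surjective (LinearMap.mulLeft k (twistMap H j S' δ H.phi⁻¹.val)) :=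
      fun x => ⟨f * x, by simp [← mul_assoc, hf]⟩
    apply LinearMap.injective_iff_surjective.mpr hs
    simp [← mul_assoc, hf]
  have e := map_antipode_mul_twist hS' hδ (H.S.symm H.α)
  rw [LinearEquiv.apply_symm_apply, ← h, mul_assoc] at e
  simpa [← mul_assoc, hf'] using congrArg (f * ·) e

end TwistInverse

/-! ### Drinfeld's elements `δ` and `γ` -/

section Drinfeld

variable {k G : Type*} [Field k] [Ring G] [Algebra k G] (H : QuasiHopfAlgebra k G)

/-- `a ↦ S(a₂) ⊗ S(a₁)`. -/
def antiComul : G →ₗ[k] G ⊗[k] G :=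
  TensorProduct.map H.S.toLinearMap H.S.toLinearMap ∘ₗ
    (TensorProduct.comm k G G).toLinearMap ∘ₗ H.comul.toLinearMap

/-- `x ⊗ y ↦ S(y) ⊗ S(x)`. -/
def antiFlip : G ⊗[k] G →ₗ[k] G ⊗[k] G :=
  TensorProduct.map H.S.toLinearMap H.S.toLinearMap ∘ₗ (TensorProduct.comm k G G).toLinearMap

theorem antiFlip_tmul (x y : G) : antiFlip H (x ⊗ₜ y) = H.S y ⊗ₜ H.S x := rfl

theorem antiComul_apply (a : G) : antiComul H a = antiFlip H (H.comul a) := rfl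

theorem antiFlip_mul (s t : G ⊗[k] G) : antiFlip H (s * t) = antiFlip H t * antiFlip H s := by
  induction s using induction₂ with
  | add a b ha hb => simp only [map_add, mul_add, add_mul, ha, hb]
  | tmul x y =>
    induction t using induction₂ with
    | add a b ha hb => simp only [map_add, mul_add, add_mul, ha, hb]
    | tmul z w => simp [antiFlip_tmul, H.S_mul]

theorem antiComul_mul (a b : G) : antiComul H (a * b) = antiComul H b * antiComul H a := by
  simp [antiComul_apply, antiFlip_mul]

/-- `x ⊗ y ⊗ z ⊗ w ↦ x β S(w) ⊗ y β S(z)`. -/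
def deltaMap : G ⊗[k] (G ⊗[k] (G ⊗[k] G)) →ₗ[k] G ⊗[k] G :=
  mulMap ((TensorProduct.mk k G G).flip 1 ∘ₗ LinearMap.mulRight k H.β)
    (mulMap (TensorProduct.mk k G G 1 ∘ₗ LinearMap.mulRight k H.β)
      (mulMap (TensorProduct.mk k G G 1 ∘ₗ H.S.toLinearMap)
        ((TensorProduct.mk k G G).flip 1 ∘ₗ H.S.toLinearMap)))

theorem deltaMap_tmul (x y z w : G) : deltaMap H (x ⊗ₜ (y ⊗ₜ (z ⊗ₜ w))) =
    (x * H.β * H.S w) ⊗ₜ (y * H.β * H.S z) := by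
  simp [deltaMap]

theorem drinfeldDelta_eq : drinfeldDelta H = deltaMap H
    (splitLeft (G ⊗[k] G) H.comul H.phi.val * padRight G H.phi⁻¹.val) := rfl

theorem drinfeldTwistInv_eq : drinfeldTwistInv H =
    twistMap H H.comul (antiComul H) (drinfeldDelta H) H.phi⁻¹.val := rfl

/-- Multiplying `Δ(c)` on the left and `(S ⊗ S)Δᵒᵖ(d)` on the right of `deltaMap` amounts to left
multiplication of its argument by the four legs `c₁ ⊗ c₂ ⊗ d₁ ⊗ d₂`, since legs 1, 4 and legs 2, 3
are paired. -/
theorem comul_mul_deltaMap (w : G ⊗[k] G) (t : G ⊗[k] (G ⊗[k] (G ⊗[k] G))) :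
    mulMap (LinearMap.mulRight k (deltaMap H t) ∘ₗ H.comul.toLinearMap) (antiComul H) w =
      deltaMap H (splitLeft (G ⊗[k] G) H.comul (onRight G H.comul w) * t) := by
  induction w using induction₂ with
  | add s t hs ht => simp only [map_add, add_mul, hs, ht]
  | tmul c d =>
  rw [mulMap_tmul, onRight_tmul, splitLeft_tmul, antiComul_apply]
  simp only [LinearMap.comp_apply, LinearMap.mulRight_apply, AlgHom.toLinearMap_apply]
  generalize H.comul c = m
  generalize H.comul d = n
  induction m using induction₂ with
  | add s t hs ht => simp only [TensorProduct.add_tmul, map_add, add_mul, hs, ht]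
  | tmul a b =>
  induction n using induction₂ with
  | add s t hs ht =>
    simp only [TensorProduct.tmul_add, map_add, add_mul, mul_add, hs, ht]
  | tmul a' b' =>
  induction t using induction₄ with
  | add s t hs ht => simp only [map_add, add_mul, mul_add, hs, ht]
  | tmul x y z w => simp [deltaMap_tmul, antiFlip_tmul, H.S_mul, mul_assoc]

theorem deltaMap_mul_split (w : G ⊗[k] (G ⊗[k] G)) (t : G ⊗[k] (G ⊗[k] (G ⊗[k] G))) :
    deltaMap H (t * onRight G (splitLeft G H.comul) w) =
      deltaMap H (t * onRight G (padLeft G)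
        (onRight G (padLeft G) (onRight G (killLeft G H.counit) w))) := by
  induction w using induction₃ with
  | add s t hs ht => simp only [map_add, mul_add, hs, ht]
  | tmul c d e =>
  induction t using induction₄ with
  | add s t hs ht => simp only [map_add, add_mul, hs, ht]
  | tmul x y z w =>
  have key : ∀ m : G ⊗[k] G, deltaMap H
      ((x ⊗ₜ (y ⊗ₜ (z ⊗ₜ w))) * (c ⊗ₜ Algebra.TensorProduct.assoc k k k G G G (m ⊗ₜ e))) =
      (x * c * H.β * H.S (w * e)) ⊗ₜ
        (y * mulMap (LinearMap.mulRight k H.β) H.S.toLinearMap m * H.S z) := by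
    intro m
    induction m using induction₂ with
    | add s t hs ht =>
      simp only [TensorProduct.add_tmul, TensorProduct.tmul_add, map_add, mul_add, add_mul, hs, ht]
    | tmul a b => simp [deltaMap_tmul, H.S_mul, mul_assoc]
  rw [onRight_tmul, splitLeft_tmul, key, H.antipode_right, onRight_tmul, killLeft_tmul]
  simp [onRight_tmul, padLeft_apply, deltaMap_tmul, mul_assoc]

theorem deltaMap_mul_comul (a : G) (t : G ⊗[k] (G ⊗[k] (G ⊗[k] G))) :
    deltaMap H (t * onRight G (padLeft G) (onRight G (padLeft G) (H.comul a))) =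
      H.counit a • deltaMap H t := by
  induction t using induction₄ with
  | add s t hs ht => simp only [map_add, add_mul, smul_add, hs, ht]
  | tmul x y z w =>
  have key : ∀ m : G ⊗[k] G, deltaMap H
      ((x ⊗ₜ (y ⊗ₜ (z ⊗ₜ w))) * onRight G (padLeft G) (onRight G (padLeft G) m)) =
      (x * mulMap (LinearMap.mulRight k H.β) H.S.toLinearMap m * H.S w) ⊗ₜ
        (y * H.β * H.S z) := by
    intro m
    induction m using induction₂ with
    | add s t hs ht =>
      simp only [TensorProduct.add_tmul, map_add, mul_add, add_mul, hs, ht]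
    | tmul a b => simp [deltaMap_tmul, onRight_tmul, padLeft_apply, H.S_mul, mul_assoc]
  rw [key, H.antipode_right, deltaMap_tmul]
  simp [TensorProduct.smul_tmul']

/-- Quasi-coassociativity carries the iterated coproduct of `a` from the left of `(Δ ⊗ id ⊗
id)(φ)(φ⁻¹ ⊗ 1)` to its right, bringing it to the form `(id ⊗ Δ ⊗ id)(Δ ⊗ id)Δ(a)`. There the nested
pairs collapse around `β`: first legs 2, 3, then legs 1, 4. -/
theorem comul_mul_drinfeldDelta (a : G) :
    mulMap (LinearMap.mulRight k (drinfeldDelta H) ∘ₗ H.comul.toLinearMap) (antiComul H)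
      (H.comul a) = H.counit a • drinfeldDelta H := by
  rw [drinfeldDelta_eq, comul_mul_deltaMap, ← mul_assoc, ← map_mul, H.quasi_coassoc,
    map_mul (splitLeft _ _), mul_assoc, ← H.coassoc_padRight, ← mul_assoc, deltaMap_mul_split,
    H.onRight_killLeft_splitLeft, deltaMap_mul_comul]

/-- `x ⊗ y ⊗ z ⊗ w ↦ S(y) α z ⊗ S(x) α w`. -/
def drinfeldGammaMap : G ⊗[k] (G ⊗[k] (G ⊗[k] G)) →ₗ[k] G ⊗[k] G :=
  mulMap (TensorProduct.mk k G G 1 ∘ₗ LinearMap.mulRight k H.α ∘ₗ H.S.toLinearMap)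
    (mulMap ((TensorProduct.mk k G G).flip 1 ∘ₗ LinearMap.mulRight k H.α ∘ₗ H.S.toLinearMap)
      LinearMap.id)

theorem drinfeldGammaMap_tmul (x y z w : G) : drinfeldGammaMap H (x ⊗ₜ (y ⊗ₜ (z ⊗ₜ w))) =
    (H.S y * H.α * z) ⊗ₜ (H.S x * H.α * w) := by
  simp [drinfeldGammaMap]

/-- Drinfeld's element `γ = S(U) α V ⊗ S(T) α W`, where
`T ⊗ U ⊗ V ⊗ W = (1 ⊗ φ⁻¹) (id ⊗ id ⊗ Δ)(φ)`. -/
def drinfeldGamma : G ⊗[k] G := drinfeldGammaMap H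
  (padLeft G H.phi⁻¹.val * onRight G (onRight G H.comul) H.phi.val)

theorem drinfeldGammaMap_mul_comul (w : G ⊗[k] G) (t : G ⊗[k] (G ⊗[k] (G ⊗[k] G))) :
    mulMap (LinearMap.mulRight k (drinfeldGammaMap H t) ∘ₗ antiComul H) H.comul.toLinearMap w =
      drinfeldGammaMap H (t * splitLeft (G ⊗[k] G) H.comul (onRight G H.comul w)) := by
  induction w using induction₂ with
  | add s t hs ht => simp only [map_add, mul_add, hs, ht]
  | tmul c d =>
  rw [mulMap_tmul, onRight_tmul, splitLeft_tmul, LinearMap.comp_apply, antiComul_apply]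
  simp only [LinearMap.mulRight_apply, AlgHom.toLinearMap_apply]
  generalize H.comul c = m
  generalize H.comul d = n
  induction m using induction₂ with
  | add s t hs ht => simp only [TensorProduct.add_tmul, map_add, add_mul, mul_add, hs, ht]
  | tmul a b =>
  induction n using induction₂ with
  | add s t hs ht =>
    simp only [TensorProduct.tmul_add, map_add, mul_add, hs, ht]
  | tmul a' b' =>
  induction t using induction₄ with
  | add s t hs ht => simp only [map_add, add_mul, mul_add, hs, ht]
  | tmul x y z w => simp [drinfeldGammaMap_tmul, antiFlip_tmul, H.S_mul, mul_assoc]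

theorem drinfeldGammaMap_split_mul (w : G ⊗[k] (G ⊗[k] G)) (t : G ⊗[k] (G ⊗[k] (G ⊗[k] G))) :
    drinfeldGammaMap H (onRight G (splitLeft G H.comul) w * t) =
      drinfeldGammaMap H (onRight G (padLeft G)
        (onRight G (padLeft G) (onRight G (killLeft G H.counit) w)) * t) := by
  induction w using induction₃ with
  | add s t hs ht => simp only [map_add, add_mul, hs, ht]
  | tmul c d e =>
  induction t using induction₄ with
  | add s t hs ht => simp only [map_add, mul_add, hs, ht]
  | tmul x y z w =>
  have key : ∀ m : G ⊗[k] G, drinfeldGammaMap H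
      ((c ⊗ₜ Algebra.TensorProduct.assoc k k k G G G (m ⊗ₜ e)) * (x ⊗ₜ (y ⊗ₜ (z ⊗ₜ w)))) =
      (H.S y * mulMap (LinearMap.mulRight k H.α ∘ₗ H.S.toLinearMap) LinearMap.id m * z) ⊗ₜ
        (H.S x * H.S c * H.α * (e * w)) := by
    intro m
    induction m using induction₂ with
    | add s t hs ht =>
      simp only [TensorProduct.add_tmul, TensorProduct.tmul_add, map_add, mul_add, add_mul, hs, ht]
    | tmul a b => simp [drinfeldGammaMap_tmul, H.S_mul, mul_assoc]
  rw [onRight_tmul, splitLeft_tmul, key, H.antipode_left, onRight_tmul, killLeft_tmul]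
  simp [onRight_tmul, padLeft_apply, drinfeldGammaMap_tmul, mul_assoc, H.S_mul,
    TensorProduct.smul_tmul']

theorem drinfeldGammaMap_comul_mul (a : G) (t : G ⊗[k] (G ⊗[k] (G ⊗[k] G))) :
    drinfeldGammaMap H (onRight G (padLeft G) (onRight G (padLeft G) (H.comul a)) * t) =
      H.counit a • drinfeldGammaMap H t := by
  induction t using induction₄ with
  | add s t hs ht => simp only [map_add, mul_add, smul_add, hs, ht]
  | tmul x y z w =>
  have key : ∀ m : G ⊗[k] G, drinfeldGammaMap H
      (onRight G (padLeft G) (onRight G (padLeft G) m) * (x ⊗ₜ (y ⊗ₜ (z ⊗ₜ w)))) =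
      (H.S y * H.α * z) ⊗ₜ (H.S x *
        mulMap (LinearMap.mulRight k H.α ∘ₗ H.S.toLinearMap) LinearMap.id m * w) := by
    intro m
    induction m using induction₂ with
    | add s t hs ht =>
      simp only [TensorProduct.tmul_add, map_add, mul_add, add_mul, hs, ht]
    | tmul a b => simp [drinfeldGammaMap_tmul, onRight_tmul, padLeft_apply, H.S_mul, mul_assoc]
  rw [key, H.antipode_left, drinfeldGammaMap_tmul]
  simp

theorem coassoc_padLeft (w : G ⊗[k] G) :
    padLeft G H.phi⁻¹.val * onRight G (onRight G H.comul) (onRight G H.comul w) =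
      onRight G (splitLeft G H.comul) (onRight G H.comul w) * padLeft G H.phi⁻¹.val := by
  induction w using induction₂ with
  | add s t hs ht => simp only [map_add, add_mul, mul_add, hs, ht]
  | tmul c d =>
    simp only [onRight_tmul, padLeft_apply, Algebra.TensorProduct.tmul_mul_tmul, one_mul, mul_one,
      H.coassoc_inv]

/-- Mirror image of `comul_mul_drinfeldDelta`: the iterated coproduct moves from right to left, and
the pairs collapse around `α`. -/
theorem drinfeldGamma_mul_comul (a : G) :
    mulMap (LinearMap.mulRight k (drinfeldGamma H) ∘ₗ antiComul H) H.comul.toLinearMap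
      (H.comul a) = H.counit a • drinfeldGamma H := by
  rw [drinfeldGamma, drinfeldGammaMap_mul_comul, splitLeft_onRight, mul_assoc, ← map_mul,
    ← H.quasi_coassoc, map_mul (onRight _ _), ← mul_assoc, coassoc_padLeft, mul_assoc,
    drinfeldGammaMap_split_mul, onRight_onRight (killLeft G H.counit),
    onRight_eq_self (f := AlgHom.comp _ _) H.counit_left, drinfeldGammaMap_comul_mul]

end Drinfeld

/-! ### The zigzag identity for `δ` and `γ`, and the twist relations -/

section Zigzag

variable {k G : Type*} [Field k] [Ring G] [Algebra k G] (H : QuasiHopfAlgebra k G)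

/-- `x ⊗ y ⊗ z ⊗ t ↦ x β S(y) α z ⊗ t`. -/
def snakeMap (T : Type*) [Ring T] [Algebra k T] :
    G ⊗[k] (G ⊗[k] (G ⊗[k] T)) →ₗ[k] G ⊗[k] T :=
  mulMap ((TensorProduct.mk k G T).flip 1 ∘ₗ LinearMap.mulRight k H.β)
    (mulMap ((TensorProduct.mk k G T).flip 1 ∘ₗ LinearMap.mulRight k H.α ∘ₗ H.S.toLinearMap)
      LinearMap.id)

section

variable {T : Type*} [Ring T] [Algebra k T]

theorem snakeMap_tmul (x y z : G) (t : T) : snakeMap H T (x ⊗ₜ (y ⊗ₜ (z ⊗ₜ t))) =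
    (x * H.β * H.S y * H.α * z) ⊗ₜ t := by
  simp [snakeMap, mul_assoc]

theorem snakeMap_split_mul (w : G ⊗[k] (G ⊗[k] T)) (t : G ⊗[k] (G ⊗[k] (G ⊗[k] T))) :
    snakeMap H T (onRight G (splitLeft T H.comul) w * t) =
      snakeMap H T (onRight G (padLeft G)
        (onRight G (padLeft G) (onRight G (killLeft T H.counit) w)) * t) := by
  induction w using induction₃ with
  | add s t hs ht => simp only [map_add, add_mul, hs, ht]
  | tmul c d e =>
  induction t using induction₄ with
  | add s t hs ht => simp only [map_add, mul_add, hs, ht]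
  | tmul x y z w =>
  have key : ∀ m : G ⊗[k] G, snakeMap H T
      ((c ⊗ₜ Algebra.TensorProduct.assoc k k k G G T (m ⊗ₜ e)) * (x ⊗ₜ (y ⊗ₜ (z ⊗ₜ w)))) =
      (c * x * H.β * H.S y * mulMap (LinearMap.mulRight k H.α ∘ₗ H.S.toLinearMap)
        LinearMap.id m * z) ⊗ₜ (e * w) := by
    intro m
    induction m using induction₂ with
    | add s t hs ht =>
      simp only [TensorProduct.add_tmul, TensorProduct.tmul_add, map_add, mul_add, add_mul, hs, ht]
    | tmul a b => simp [snakeMap_tmul, H.S_mul, mul_assoc]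
  rw [onRight_tmul, splitLeft_tmul, key, H.antipode_left, onRight_tmul, killLeft_tmul]
  simp [onRight_tmul, padLeft_apply, snakeMap_tmul, mul_assoc, TensorProduct.smul_tmul']

theorem snakeMap_mul_split (w : G ⊗[k] (G ⊗[k] T)) (t : G ⊗[k] (G ⊗[k] (G ⊗[k] T))) :
    snakeMap H T (t * splitLeft (G ⊗[k] T) H.comul w) =
      snakeMap H T (t * padLeft G (padLeft G (killLeft (G ⊗[k] T) H.counit w))) := by
  induction w using induction₃ with
  | add s t hs ht => simp only [map_add, mul_add, hs, ht]
  | tmul c d e =>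
  induction t using induction₄ with
  | add s t hs ht => simp only [map_add, add_mul, hs, ht]
  | tmul x y z w =>
  have key : ∀ m : G ⊗[k] G, snakeMap H T
      ((x ⊗ₜ (y ⊗ₜ (z ⊗ₜ w))) *
        Algebra.TensorProduct.assoc k k k G G (G ⊗[k] T) (m ⊗ₜ (d ⊗ₜ e))) =
      (x * mulMap (LinearMap.mulRight k H.β) H.S.toLinearMap m * H.S y * H.α * z * d) ⊗ₜ
        (w * e) := by
    intro m
    induction m using induction₂ with
    | add s t hs ht =>
      simp only [TensorProduct.add_tmul, map_add, mul_add, add_mul, hs, ht]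
    | tmul a b => simp [snakeMap_tmul, H.S_mul, mul_assoc]
  rw [splitLeft_tmul, key, H.antipode_right, killLeft_tmul]
  simp [padLeft_apply, snakeMap_tmul, mul_assoc, TensorProduct.smul_tmul']

theorem snakeMap_padRight (w : G ⊗[k] (G ⊗[k] G)) :
    snakeMap H T (padRight T w) = mulMap (LinearMap.mulRight k H.β)
      (mulMap (LinearMap.mulRight k H.α ∘ₗ H.S.toLinearMap) LinearMap.id) w ⊗ₜ 1 := by
  induction w using induction₃ with
  | add s t hs ht => simp only [map_add, TensorProduct.add_tmul, hs, ht]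
  | tmul x y z => simp [padRight_tmul, snakeMap_tmul, mul_assoc]

/-- By the pentagon the argument is `(id ⊗ Δ ⊗ id)(φ_λ)(φ ⊗ 1)(Δ ⊗ id ⊗ id)(φ_λ⁻¹)`. The first
factor collapses around `α`, the last around `β`, and `X β S(Y) α Z = 1` remains. -/
theorem snakeMap_inv_mul (L : LeftCoaction H.toQuasiBialgebra T) :
    snakeMap H T (padLeft G L.phi⁻¹.val * onRight G (onRight G L.coact) L.phi.val) = 1 := by
  rw [L.inv_mul_pentagon, snakeMap_mul_split, L.counit_phi_inv_left, mul_assoc,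
    snakeMap_split_mul, L.counit_phi_mid, map_one, map_one, map_one, map_one, one_mul, mul_one,
    snakeMap_padRight, H.antipode_phi, Algebra.TensorProduct.one_def]

end

/-- `t₁ ⊗ ⋯ ⊗ t₆ ↦ t₁ β S(t₄) α t₅ ⊗ t₂ β S(t₃) α t₆`. -/
def nestedSnakeMap : G ⊗[k] (G ⊗[k] (G ⊗[k] (G ⊗[k] (G ⊗[k] G)))) →ₗ[k] G ⊗[k] G :=
  mulMap ((TensorProduct.mk k G G).flip 1 ∘ₗ LinearMap.mulRight k H.β)
    (mulMap (TensorProduct.mk k G G 1 ∘ₗ LinearMap.mulRight k H.β)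
      (mulMap (TensorProduct.mk k G G 1 ∘ₗ LinearMap.mulRight k H.α ∘ₗ H.S.toLinearMap)
        (mulMap ((TensorProduct.mk k G G).flip 1 ∘ₗ LinearMap.mulRight k H.α ∘ₗ H.S.toLinearMap)
          LinearMap.id)))

theorem nestedSnakeMap_tmul (a b c d e f : G) :
    nestedSnakeMap H (a ⊗ₜ (b ⊗ₜ (c ⊗ₜ (d ⊗ₜ (e ⊗ₜ f))))) =
      (a * H.β * H.S d * H.α * e) ⊗ₜ (b * H.β * H.S c * H.α * f) := by
  simp [nestedSnakeMap, mul_assoc]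

/-- `x ⊗ y ⊗ z ⊗ w ↦ x ⊗ y ⊗ z ⊗ 1 ⊗ 1 ⊗ w`. -/
def outerLegs : G ⊗[k] (G ⊗[k] (G ⊗[k] G)) →ₐ[k]
    G ⊗[k] (G ⊗[k] (G ⊗[k] (G ⊗[k] (G ⊗[k] G)))) :=
  onRight G (onRight G (onRight G ((padLeft G).comp (padLeft G))))

/-- `x ⊗ t ↦ x ⊗ 1 ⊗ 1 ⊗ t`. -/
def skipLegs (T : Type*) [Ring T] [Algebra k T] : G ⊗[k] T →ₐ[k] G ⊗[k] (G ⊗[k] (G ⊗[k] T)) :=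
  onRight G ((padLeft G).comp (padLeft G))

/-- `Δ ⊗ id ⊗ id ⊗ Δ`. -/
def splitOuter : G ⊗[k] (G ⊗[k] (G ⊗[k] G)) →ₐ[k]
    G ⊗[k] (G ⊗[k] (G ⊗[k] (G ⊗[k] (G ⊗[k] G)))) :=
  (splitLeft _ H.comul).comp (onRight G (onRight G (onRight G H.comul)))

theorem splitOuter_tmul (x y z w : G) : splitOuter H (x ⊗ₜ (y ⊗ₜ (z ⊗ₜ w))) =
    Algebra.TensorProduct.assoc k k k G G (G ⊗[k] (G ⊗[k] (G ⊗[k] G)))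
      (H.comul x ⊗ₜ[k] (y ⊗ₜ[k] (z ⊗ₜ[k] H.comul w))) := rfl

/-- Writes the zigzag as two nested snakes on six legs: `γ` occupies legs 3 to 6, `δ` legs 1 to 4,
and `φ` is spread over all six by its coproducts. In this form the three copies of `φ` meet as one
side of the pentagon. -/
theorem zigzagMap_eq_nestedSnakeMap (s t : G ⊗[k] (G ⊗[k] (G ⊗[k] G)))
    (w : G ⊗[k] (G ⊗[k] G)) :
    zigzagMap H.comul (antiComul H) (deltaMap H s) (drinfeldGammaMap H t) w =
      nestedSnakeMap H (padLeft G (padLeft G t) *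
        splitOuter H (onRight G (splitLeft G H.comul) w) *
          onRight G (padRight (X := G) (Y := G) (Z := G) (G ⊗[k] G)) s) := by
  induction w using induction₃ with
  | add s t hs ht => simp only [map_add, add_mul, mul_add, hs, ht]
  | tmul x y z =>
  rw [zigzagMap_tmul, onRight_tmul, splitLeft_tmul, antiComul_apply]
  generalize H.comul y = n
  induction n using induction₂ with
  | add s t hs ht =>
    simp only [TensorProduct.tmul_add, TensorProduct.add_tmul, map_add, add_mul, mul_add, hs, ht]
  | tmul c d =>
  rw [assoc_tmul, splitOuter_tmul]
  generalize H.comul x = m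
  generalize H.comul z = l
  induction m using induction₂ with
  | add s t hs ht => simp only [TensorProduct.add_tmul, map_add, add_mul, mul_add, hs, ht]
  | tmul a b =>
  induction l using induction₂ with
  | add s t hs ht => simp only [TensorProduct.tmul_add, map_add, add_mul, mul_add, hs, ht]
  | tmul e f =>
  induction s using induction₄ with
  | add s t hs ht => simp only [map_add, add_mul, mul_add, hs, ht]
  | tmul s₁ s₂ s₃ s₄ =>
  induction t using induction₄ with
  | add s t hs ht => simp only [map_add, add_mul, mul_add, hs, ht]
  | tmul t₁ t₂ t₃ t₄ =>
    simp [deltaMap_tmul, drinfeldGammaMap_tmul, antiFlip_tmul, padLeft_apply,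
      onRight_tmul, padRight_tmul, Algebra.TensorProduct.one_def, nestedSnakeMap_tmul, H.S_mul,
      mul_assoc]

theorem padLeft_padLeft_eq_splitOuter (w : G ⊗[k] (G ⊗[k] G)) :
    padLeft G (padLeft G (onRight G (onRight G H.comul) w)) = splitOuter H (padLeft G w) := by
  induction w using induction₃ with
  | add s t hs ht => simp only [map_add, hs, ht]
  | tmul x y z =>
    simp [padLeft_apply, splitOuter_tmul, onRight_tmul, Algebra.TensorProduct.one_def]

theorem padRight_eq_splitOuter (w : G ⊗[k] (G ⊗[k] G)) :
    onRight G (padRight (X := G) (Y := G) (Z := G) (G ⊗[k] G)) (splitLeft (G ⊗[k] G) H.comul w) =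
      splitOuter H (padRight G w) := by
  induction w using induction₃ with
  | add s t hs ht => simp only [map_add, hs, ht]
  | tmul x y z =>
    rw [padRight_tmul, splitOuter_tmul, splitLeft_tmul, map_one H.comul]
    generalize H.comul x = m
    induction m using induction₂ with
    | add s t hs ht => simp only [TensorProduct.add_tmul, map_add, hs, ht]
    | tmul a b => rfl

theorem padLeft_mul_splitOuter (w : G ⊗[k] (G ⊗[k] G)) :
    padLeft G (padLeft G (padLeft G H.phi⁻¹.val)) *
        splitOuter H (onRight G (onRight G H.comul) w) =
      splitLeft _ H.comul (onRight G (onRight G ((splitLeft G H.comul).comp H.comul)) w) *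
        padLeft G (padLeft G (padLeft G H.phi⁻¹.val)) := by
  induction w using induction₃ with
  | add s t hs ht => simp only [map_add, add_mul, mul_add, hs, ht]
  | tmul x y z =>
    have h : splitOuter H (onRight G (onRight G H.comul) (x ⊗ₜ (y ⊗ₜ z))) =
      Algebra.TensorProduct.assoc k k k G G (G ⊗[k] (G ⊗[k] (G ⊗[k] G)))
        (H.comul x ⊗ₜ[k] (y ⊗ₜ[k] (onRight G H.comul (H.comul z)))) := by
      rw [onRight_tmul, onRight_tmul]
      generalize H.comul z = m
      induction m using induction₂ with
      | add s t hs ht => simp only [TensorProduct.tmul_add, map_add, hs, ht]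
      | tmul a b => rfl
    rw [h, onRight_tmul, onRight_tmul, splitLeft_tmul]
    generalize H.comul x = m
    induction m using induction₂ with
    | add s t hs ht => simp only [TensorProduct.add_tmul, map_add, mul_add, add_mul, hs, ht]
    | tmul a b =>
      simp only [assoc_tmul, padLeft_apply, Algebra.TensorProduct.tmul_mul_tmul, one_mul, mul_one,
        H.coassoc_inv, AlgHom.comp_apply]

theorem splitOuter_splitLeft (w : G ⊗[k] (G ⊗[k] G)) :
    splitOuter H (splitLeft _ H.comul w) =
      splitLeft _ H.comul (splitLeft _ H.comul (onRight G (onRight G H.comul) w)) := by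
  rw [splitOuter, AlgHom.comp_apply, splitLeft_onRight, splitLeft_onRight,
    splitLeft_onRight]

theorem padRight_padRight (w : G ⊗[k] (G ⊗[k] G)) :
    onRight G (padRight (X := G) (Y := G) (Z := G) (G ⊗[k] G)) (padRight G w) =
      padRight (G ⊗[k] (G ⊗[k] G)) w := by
  induction w using induction₃ with
  | add s t hs ht => simp only [map_add, hs, ht]
  | tmul x y z => rfl

/-- Legs 4 and 5 enclose `α` from the left factor and collapse; the counit left over undoes one of
the two coproducts on the last leg of `w`. -/
theorem nestedSnakeMap_splitInner_mul (w : G ⊗[k] (G ⊗[k] G))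
    (t : G ⊗[k] (G ⊗[k] (G ⊗[k] (G ⊗[k] (G ⊗[k] G))))) :
    nestedSnakeMap H (splitLeft _ H.comul
        (onRight G (onRight G ((splitLeft G H.comul).comp H.comul)) w) * t) =
      nestedSnakeMap H (outerLegs (splitLeft _ H.comul w) * t) := by
  induction w using induction₃ with
  | add s t hs ht => simp only [map_add, add_mul, hs, ht]
  | tmul x y z =>
  rw [onRight_tmul, onRight_tmul, splitLeft_tmul, splitLeft_tmul, AlgHom.comp_apply]
  generalize H.comul x = m
  induction m using induction₂ with
  | add s t hs ht => simp only [TensorProduct.add_tmul, map_add, add_mul, hs, ht]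
  | tmul a b =>
  induction t using induction₂ with
  | add s t hs ht => simp only [map_add, mul_add, hs, ht]
  | tmul t₁ t =>
  induction t using induction₂ with
  | add s t hs ht => simp only [TensorProduct.tmul_add, map_add, mul_add, hs, ht]
  | tmul t₂ t =>
  induction t using induction₄ with
  | add s t hs ht => simp only [TensorProduct.tmul_add, map_add, mul_add, hs, ht]
  | tmul t₃ t₄ t₅ t₆ =>
  have key : ∀ c : G ⊗[k] G, nestedSnakeMap H (Algebra.TensorProduct.assoc k k k G G
      (G ⊗[k] (G ⊗[k] (G ⊗[k] G))) ((a ⊗ₜ[k] b) ⊗ₜ[k] (y ⊗ₜ[k] splitLeft G H.comul c)) *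
        (t₁ ⊗ₜ[k] (t₂ ⊗ₜ[k] (t₃ ⊗ₜ[k] (t₄ ⊗ₜ[k] (t₅ ⊗ₜ[k] t₆)))))) =
      (a * t₁ * H.β * H.S t₄ * H.α * t₅) ⊗ₜ
        (b * t₂ * H.β * H.S (y * t₃) * H.α * killLeft G H.counit c * t₆) := by
    intro c
    induction c using induction₂ with
    | add s t hs ht =>
      simp only [TensorProduct.tmul_add, map_add, add_mul, mul_add, hs, ht]
    | tmul c d =>
    have key' : ∀ m : G ⊗[k] G, nestedSnakeMap H (Algebra.TensorProduct.assoc k k k G G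
        (G ⊗[k] (G ⊗[k] (G ⊗[k] G)))
        ((a ⊗ₜ[k] b) ⊗ₜ[k] (y ⊗ₜ[k] Algebra.TensorProduct.assoc k k k G G G (m ⊗ₜ[k] d))) *
          (t₁ ⊗ₜ[k] (t₂ ⊗ₜ[k] (t₃ ⊗ₜ[k] (t₄ ⊗ₜ[k] (t₅ ⊗ₜ[k] t₆)))))) =
        (a * t₁ * H.β * H.S t₄ *
          mulMap (LinearMap.mulRight k H.α ∘ₗ H.S.toLinearMap) LinearMap.id m * t₅) ⊗ₜ
          (b * t₂ * H.β * H.S (y * t₃) * H.α * d * t₆) := by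
      intro m
      induction m using induction₂ with
      | add s t hs ht =>
        simp only [TensorProduct.tmul_add, TensorProduct.add_tmul, map_add, add_mul, mul_add, hs,
          ht]
      | tmul m n => simp [nestedSnakeMap_tmul, H.S_mul, mul_assoc]
    rw [splitLeft_tmul, key', H.antipode_left, killLeft_tmul]
    simp [TensorProduct.smul_tmul']
  rw [key, H.counit_left]
  simp [outerLegs, onRight_tmul, padLeft_apply, nestedSnakeMap_tmul, H.S_mul,
    mul_assoc]

theorem nestedSnakeMap_mul_splitInner
    (w : G ⊗[k] (G ⊗[k] (G ⊗[k] (G ⊗[k] G))))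
    (t : G ⊗[k] (G ⊗[k] (G ⊗[k] (G ⊗[k] (G ⊗[k] G))))) :
    nestedSnakeMap H (t * onRight G (splitLeft (G ⊗[k] (G ⊗[k] G)) H.comul) w) =
      nestedSnakeMap H (t * skipLegs (G ⊗[k] (G ⊗[k] G))
        (onRight G (killLeft (G ⊗[k] (G ⊗[k] G)) H.counit) w)) := by
  induction w using induction₂ with
  | add s t hs ht => simp only [map_add, mul_add, hs, ht]
  | tmul x w =>
  induction w using induction₄ with
  | add s t hs ht => simp only [TensorProduct.tmul_add, map_add, mul_add, hs, ht]
  | tmul y d e f =>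
  induction t using induction₂ with
  | add s t hs ht => simp only [map_add, add_mul, hs, ht]
  | tmul t₁ t =>
  induction t using induction₂ with
  | add s t hs ht => simp only [TensorProduct.tmul_add, map_add, add_mul, hs, ht]
  | tmul t₂ t =>
  induction t using induction₄ with
  | add s t hs ht => simp only [TensorProduct.tmul_add, map_add, add_mul, hs, ht]
  | tmul t₃ t₄ t₅ t₆ =>
  have key : ∀ m : G ⊗[k] G, nestedSnakeMap H
      ((t₁ ⊗ₜ[k] (t₂ ⊗ₜ[k] (t₃ ⊗ₜ[k] (t₄ ⊗ₜ[k] (t₅ ⊗ₜ[k] t₆))))) *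
        (x ⊗ₜ[k] Algebra.TensorProduct.assoc k k k G G (G ⊗[k] (G ⊗[k] G))
          (m ⊗ₜ[k] (d ⊗ₜ[k] (e ⊗ₜ[k] f))))) =
      (t₁ * x * H.β * H.S (t₄ * d) * H.α * (t₅ * e)) ⊗ₜ
        (t₂ * mulMap (LinearMap.mulRight k H.β) H.S.toLinearMap m * H.S t₃ * H.α * (t₆ * f)) := by
    intro m
    induction m using induction₂ with
    | add s t hs ht =>
      simp only [TensorProduct.tmul_add, TensorProduct.add_tmul, map_add, add_mul, mul_add, hs, ht]
    | tmul m n => simp [nestedSnakeMap_tmul, H.S_mul, mul_assoc]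
  rw [onRight_tmul, splitLeft_tmul, key, H.antipode_right, onRight_tmul, killLeft_tmul]
  simp [skipLegs, onRight_tmul, padLeft_apply, nestedSnakeMap_tmul, H.S_mul, mul_assoc]

theorem nestedSnakeMap_outer_splitRight_mul (w : G ⊗[k] (G ⊗[k] G))
    (t : G ⊗[k] (G ⊗[k] (G ⊗[k] (G ⊗[k] (G ⊗[k] G))))) :
    nestedSnakeMap H (outerLegs (onRight G (onRight G H.comul) w) * t) =
      nestedSnakeMap H (outerLegs (onRight G Algebra.TensorProduct.includeLeft
        (onRight G (killRight G H.counit) w)) * t) := by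
  induction w using induction₃ with
  | add s t hs ht => simp only [map_add, add_mul, hs, ht]
  | tmul x y z =>
  induction t using induction₂ with
  | add s t hs ht => simp only [map_add, mul_add, hs, ht]
  | tmul t₁ t =>
  induction t using induction₂ with
  | add s t hs ht => simp only [TensorProduct.tmul_add, map_add, mul_add, hs, ht]
  | tmul t₂ t =>
  induction t using induction₄ with
  | add s t hs ht => simp only [TensorProduct.tmul_add, map_add, mul_add, hs, ht]
  | tmul t₃ t₄ t₅ t₆ =>
  have key : ∀ m : G ⊗[k] G, nestedSnakeMap H (outerLegs (x ⊗ₜ[k] (y ⊗ₜ[k] m)) *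
        (t₁ ⊗ₜ[k] (t₂ ⊗ₜ[k] (t₃ ⊗ₜ[k] (t₄ ⊗ₜ[k] (t₅ ⊗ₜ[k] t₆)))))) =
      (x * t₁ * H.β * H.S t₄ * H.α * t₅) ⊗ₜ
        (y * t₂ * H.β * H.S t₃ *
          mulMap (LinearMap.mulRight k H.α ∘ₗ H.S.toLinearMap) LinearMap.id m * t₆) := by
    intro m
    induction m using induction₂ with
    | add s t hs ht =>
      simp only [TensorProduct.tmul_add, map_add, add_mul, mul_add, hs, ht]
    | tmul m n =>
      simp [outerLegs, onRight_tmul, padLeft_apply, nestedSnakeMap_tmul, H.S_mul, mul_assoc]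
  rw [onRight_tmul, onRight_tmul, key, H.antipode_left, onRight_tmul, killRight_tmul]
  simp [outerLegs, onRight_tmul, nestedSnakeMap_tmul, mul_assoc]

theorem nestedSnakeMap_mul_outer_split (w : G ⊗[k] (G ⊗[k] G))
    (s : G ⊗[k] (G ⊗[k] (G ⊗[k] G)))
    (t : G ⊗[k] (G ⊗[k] (G ⊗[k] (G ⊗[k] (G ⊗[k] G))))) :
    nestedSnakeMap H (t * outerLegs (onRight G (splitLeft G H.comul) w) *
        skipLegs (G ⊗[k] (G ⊗[k] G)) s) =
      nestedSnakeMap H (t * outerLegs (skipLegs G (onRight G (killLeft G H.counit) w)) *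
        skipLegs (G ⊗[k] (G ⊗[k] G)) s) := by
  induction w using induction₃ with
  | add s t hs ht => simp only [map_add, add_mul, mul_add, hs, ht]
  | tmul x y z =>
  induction s using induction₄ with
  | add s t hs ht => simp only [map_add, mul_add, hs, ht]
  | tmul s₁ s₂ s₃ s₄ =>
  induction t using induction₂ with
  | add s t hs ht => simp only [map_add, add_mul, hs, ht]
  | tmul t₁ t =>
  induction t using induction₂ with
  | add s t hs ht => simp only [TensorProduct.tmul_add, map_add, add_mul, hs, ht]
  | tmul t₂ t =>
  induction t using induction₄ with
  | add s t hs ht => simp only [TensorProduct.tmul_add, map_add, add_mul, hs, ht]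
  | tmul t₃ t₄ t₅ t₆ =>
  have key : ∀ m : G ⊗[k] G, nestedSnakeMap H
      ((t₁ ⊗ₜ[k] (t₂ ⊗ₜ[k] (t₃ ⊗ₜ[k] (t₄ ⊗ₜ[k] (t₅ ⊗ₜ[k] t₆))))) *
        outerLegs (x ⊗ₜ[k] Algebra.TensorProduct.assoc k k k G G G (m ⊗ₜ[k] z)) *
        skipLegs (G ⊗[k] (G ⊗[k] G)) (s₁ ⊗ₜ[k] (s₂ ⊗ₜ[k] (s₃ ⊗ₜ[k] s₄)))) =
      (t₁ * x * s₁ * H.β * H.S (t₄ * s₂) * H.α * (t₅ * s₃)) ⊗ₜ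
        (t₂ * mulMap (LinearMap.mulRight k H.β) H.S.toLinearMap m * H.S t₃ * H.α *
          (t₆ * z * s₄)) := by
    intro m
    induction m using induction₂ with
    | add s t hs ht =>
      simp only [TensorProduct.tmul_add, TensorProduct.add_tmul, map_add, add_mul, mul_add, hs, ht]
    | tmul m n =>
      simp [skipLegs, outerLegs, onRight_tmul, padLeft_apply, nestedSnakeMap_tmul, H.S_mul,
        mul_assoc]
  rw [onRight_tmul, splitLeft_tmul, key, H.antipode_right, onRight_tmul, killLeft_tmul]
  simp [skipLegs, outerLegs, onRight_tmul, padLeft_apply, nestedSnakeMap_tmul, H.S_mul, mul_assoc]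

theorem nestedSnakeMap_outer_padLeft_mul (w : G ⊗[k] (G ⊗[k] G))
    (s : G ⊗[k] (G ⊗[k] (G ⊗[k] G))) :
    nestedSnakeMap H (outerLegs (padLeft G w) * skipLegs (G ⊗[k] (G ⊗[k] G)) s) =
      (1 ⊗ₜ mulMap (LinearMap.mulRight k H.β)
        (mulMap (LinearMap.mulRight k H.α ∘ₗ H.S.toLinearMap) LinearMap.id) w) *
        snakeMap H G s := by
  induction w using induction₃ with
  | add s t hs ht => simp only [map_add, add_mul, TensorProduct.tmul_add, hs, ht]
  | tmul x y z =>
  induction s using induction₄ with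
  | add s t hs ht => simp only [map_add, mul_add, hs, ht]
  | tmul s₁ s₂ s₃ s₄ =>
    simp [skipLegs, outerLegs, onRight_tmul, padLeft_apply, nestedSnakeMap_tmul, snakeMap_tmul,
      mul_assoc]

/-- The pentagon of `φ` placed on legs 1, 2, 3, 6, with `(id ⊗ Δ ⊗ id)(φ⁻¹)` moved to the other
side. -/
theorem outerLegs_splitLeft_mul :
    outerLegs (splitLeft (G ⊗[k] G) H.comul H.phi.val) *
      padRight (G ⊗[k] (G ⊗[k] G)) H.phi⁻¹.val =
    outerLegs (onRight G (onRight G H.comul) H.phi⁻¹.val) * outerLegs (padLeft G H.phi.val) *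
      outerLegs (onRight G (splitLeft G H.comul) H.phi.val) := by
  have h₁ : ∀ t : G ⊗[k] (G ⊗[k] G),
      padRight (G ⊗[k] (G ⊗[k] G)) t = outerLegs (padRight G t) := by
    intro t
    induction t using induction₃ with
    | add s t hs ht => simp only [map_add, hs, ht]
    | tmul x y z => simp [outerLegs, padRight_tmul, onRight_tmul, padLeft_apply,
        Algebra.TensorProduct.one_def]
  have h₂ := H.toQuasiBialgebra.selfCoaction.pentagon_inv_mul
  change onRight G (onRight G H.comul) H.phi⁻¹.val * padLeft G H.phi.val =
    splitLeft (G ⊗[k] G) H.comul H.phi.val * padRight G H.phi⁻¹.val *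
      onRight G (splitLeft G H.comul) H.phi⁻¹.val at h₂
  rw [h₁, ← map_mul, ← map_mul, h₂, ← map_mul, mul_assoc, map_inv_mul_map, mul_one]

theorem padLeft_mul_skipLegs (w : G ⊗[k] (G ⊗[k] G)) :
    padLeft G (padLeft G (padLeft G H.phi⁻¹.val)) *
      skipLegs _ (onRight G (onRight G H.comul) w) =
    skipLegs _ (padLeft G H.phi⁻¹.val * onRight G (onRight G H.comul) w) := by
  rw [map_mul]; rfl

theorem padLeft_mul_padRight (s t : G ⊗[k] (G ⊗[k] G)) :
    padLeft G (padLeft G (padLeft G s)) * padRight (G ⊗[k] (G ⊗[k] G)) t =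
      padRight (G ⊗[k] (G ⊗[k] G)) t * padLeft G (padLeft G (padLeft G s)) := by
  induction t using induction₃ with
  | add s t hs ht => simp only [map_add, add_mul, mul_add, hs, ht]
  | tmul x y z => simp [padLeft_apply, padRight_tmul]

/-- The three uninverted copies of `φ` form `Δ ⊗ id ⊗ id ⊗ Δ` of the right side of the pentagon,
which is replaced by the left side. Each of its two factors is moved past the adjacent `φ⁻¹` by
coassociativity: legs 4, 5 then collapse around `α` and legs 2, 3 around `β`. The two `φ⁻¹` have
disjoint legs and can be swapped. A second pentagon on legs 1, 2, 3, 6, followed by collapses of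
legs 2, 3 and 3, 6, leaves the plain zigzag `X β S(Y) α Z = 1` on legs 2, 3, 6. The remaining legs
1, 4, 5, 6 give the snake of `snakeMap_inv_mul` for the coaction `Δ`. -/
theorem zigzagMap_phi : zigzagMap H.comul (antiComul H) (drinfeldDelta H) (drinfeldGamma H)
    H.phi.val = 1 := by
  have hp := H.pentagon
  rw [drinfeldDelta_eq, drinfeldGamma, zigzagMap_eq_nestedSnakeMap]
  simp only [map_mul (padLeft _), map_mul (onRight _ _)]
  rw [padLeft_padLeft_eq_splitOuter, padRight_eq_splitOuter, padRight_padRight,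
    mul_assoc (padLeft G _) (splitOuter H _), ← map_mul, mul_assoc (padLeft G _),
    ← mul_assoc (splitOuter H _), ← map_mul, ← hp, map_mul (splitOuter H),
    mul_assoc (splitOuter H _),
    ← mul_assoc (padLeft G _), padLeft_mul_splitOuter, splitOuter_splitLeft,
    ← H.coassoc_padRight, mul_assoc, nestedSnakeMap_splitInner_mul, ← mul_assoc, ← mul_assoc,
    nestedSnakeMap_mul_splitInner, H.onRight_killLeft_splitLeft,
    mul_assoc (outerLegs _), padLeft_mul_padRight, ← mul_assoc, mul_assoc, padLeft_mul_skipLegs,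
    outerLegs_splitLeft_mul, nestedSnakeMap_mul_outer_split, H.counit_phi, map_one, map_one,
    mul_one, mul_assoc, nestedSnakeMap_outer_splitRight_mul, map_inv_eq_one H.counit_phi_right,
    map_one, map_one, one_mul, nestedSnakeMap_outer_padLeft_mul, H.antipode_phi]
  exact (one_mul _).trans (snakeMap_inv_mul H H.toQuasiBialgebra.selfCoaction)

theorem comul_mul_drinfeldTwistInv (a : G) :
    H.comul a * drinfeldTwistInv H = drinfeldTwistInv H * antiComul H (H.S.symm a) := by
  rw [drinfeldTwistInv_eq, ← map_antipode_mul_twist (antiComul_mul H) (comul_mul_drinfeldDelta H),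
    LinearEquiv.apply_symm_apply]

/-- Together with `comul_mul_drinfeldTwistInv` at `a = α`, this is Drinfeld's relation `f Δ(α) = γ`,
written with `f⁻¹` only. -/
theorem drinfeldGamma_mul_drinfeldTwistInv [FiniteDimensional k G] :
    drinfeldGamma H * drinfeldTwistInv H = antiComul H (H.S.symm H.α) :=
  gamma_mul_twist (antiComul_mul H) (comul_mul_drinfeldDelta H)
    (twist_mul_of_zigzag (antiComul_mul H) (comul_mul_drinfeldDelta H) (drinfeldGamma_mul_comul H)
      (zigzagMap_phi H))

end Zigzag

/-! ### The elements `q` and `p` and their zigzag identities -/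

section QElement

variable {k G T : Type*} [Field k] [Ring G] [Algebra k G] [Ring T] [Algebra k T]
  (H : QuasiHopfAlgebra k G)

/-- `x ⊗ y ⊗ t ↦ S(x) α y ⊗ t`. -/
def qMap (T : Type*) [Ring T] [Algebra k T] : G ⊗[k] (G ⊗[k] T) →ₗ[k] G ⊗[k] T :=
  LinearMap.rTensor T (mulMap (LinearMap.mulRight k H.α ∘ₗ H.S.toLinearMap) LinearMap.id) ∘ₗ
    (TensorProduct.assoc k G G T).symm.toLinearMap

theorem qMap_tmul (x y : G) (t : T) : qMap H T (x ⊗ₜ (y ⊗ₜ t)) = (H.S x * H.α * y) ⊗ₜ t := rfl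

theorem qElement_eq (w : G ⊗[k] (G ⊗[k] T)) : qElement H w = qMap H T w := rfl

theorem qMap_splitLeft_mul (w : G ⊗[k] T) (t : G ⊗[k] (G ⊗[k] T)) :
    qMap H T (splitLeft T H.comul w * t) = padLeft G (killLeft T H.counit w) * qMap H T t := by
  induction w using induction₂ with
  | add s t hs ht => simp only [map_add, add_mul, hs, ht]
  | tmul c d =>
  induction t using induction₃ with
  | add s t hs ht => simp only [map_add, mul_add, hs, ht]
  | tmul x y z =>
  have key : ∀ m : G ⊗[k] G, qMap H T
      (Algebra.TensorProduct.assoc k k k G G T (m ⊗ₜ d) * (x ⊗ₜ (y ⊗ₜ z))) =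
      (H.S x * mulMap (LinearMap.mulRight k H.α ∘ₗ H.S.toLinearMap) LinearMap.id m * y) ⊗ₜ
        (d * z) := by
    intro m
    induction m using induction₂ with
    | add s t hs ht => simp only [TensorProduct.add_tmul, map_add, mul_add, add_mul, hs, ht]
    | tmul a b => simp [qMap_tmul, H.S_mul, mul_assoc]
  rw [splitLeft_tmul, key, H.antipode_left, qMap_tmul, killLeft_tmul]
  simp [padLeft_apply, TensorProduct.smul_tmul']

theorem qMap_mul_padLeft (s : G ⊗[k] (G ⊗[k] T)) (w : G ⊗[k] T) :
    qMap H T (s * padLeft G w) = qMap H T s * w := by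
  induction s using induction₃ with
  | add s t hs ht => simp only [map_add, add_mul, hs, ht]
  | tmul x y z =>
  induction w using induction₂ with
  | add s t hs ht => simp only [map_add, mul_add, hs, ht]
  | tmul c d => simp [qMap_tmul, padLeft_apply, mul_assoc]

theorem qMap_onRight {Y : Type*} [Ring Y] [Algebra k Y] (f : T →ₐ[k] Y)
    (s : G ⊗[k] (G ⊗[k] T)) :
    onRight G f (qMap H T s) = qMap H Y (onRight G (onRight G f) s) := by
  induction s using induction₃ with
  | add s t hs ht => simp only [map_add, hs, ht]
  | tmul x y z => rfl

/-- `x ⊗ y ⊗ t ↦ y S⁻¹(x β) ⊗ t`. -/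
def pMap (T : Type*) [Ring T] [Algebra k T] : G ⊗[k] (G ⊗[k] T) →ₗ[k] G ⊗[k] T :=
  LinearMap.rTensor T (mulMap LinearMap.id
      (H.S.symm.toLinearMap ∘ₗ LinearMap.mulRight k H.β) ∘ₗ
        (TensorProduct.comm k G G).toLinearMap) ∘ₗ
    (TensorProduct.assoc k G G T).symm.toLinearMap

theorem pMap_tmul (x y : G) (t : T) :
    pMap H T (x ⊗ₜ (y ⊗ₜ t)) = (y * H.S.symm (x * H.β)) ⊗ₜ t := rfl

theorem pMap_mul_splitLeft (w : G ⊗[k] T) (t : G ⊗[k] (G ⊗[k] T)) :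
    pMap H T (t * splitLeft T H.comul w) = pMap H T t * padLeft G (killLeft T H.counit w) := by
  induction w using induction₂ with
  | add s t hs ht => simp only [map_add, mul_add, hs, ht]
  | tmul c d =>
  induction t using induction₃ with
  | add s t hs ht => simp only [map_add, add_mul, hs, ht]
  | tmul x y z =>
  have key : ∀ m : G ⊗[k] G, pMap H T
      ((x ⊗ₜ (y ⊗ₜ z)) * Algebra.TensorProduct.assoc k k k G G T (m ⊗ₜ d)) =
      (y * H.S.symm (x * mulMap (LinearMap.mulRight k H.β) H.S.toLinearMap m)) ⊗ₜ (z * d) := by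
    intro m
    induction m using induction₂ with
    | add s t hs ht => simp only [TensorProduct.add_tmul, map_add, mul_add, hs, ht]
    | tmul a b => simp [pMap_tmul, H.S_symm_mul, mul_assoc]
  rw [splitLeft_tmul, key, H.antipode_right, pMap_tmul, killLeft_tmul]
  simp [padLeft_apply, TensorProduct.smul_tmul']

variable (L : LeftCoaction H.toQuasiBialgebra T)

/-- `g ⊗ t ↦ (S(g) ⊗ 1) q λ(t)`. -/
def qInsert : G ⊗[k] T →ₗ[k] G ⊗[k] T :=
  mulMap ((TensorProduct.mk k G T).flip 1 ∘ₗ H.S.toLinearMap)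
    (LinearMap.mulLeft k (qMap H T L.phi⁻¹.val) ∘ₗ L.coact.toLinearMap)

theorem qInsert_tmul (g : G) (t : T) :
    qInsert H L (g ⊗ₜ t) = (H.S g ⊗ₜ 1) * (qMap H T L.phi⁻¹.val * L.coact t) := rfl

theorem qInsert_eq (w : G ⊗[k] T) :
    qInsert H L w = qMap H T (L.phi⁻¹.val * onRight G L.coact w) := by
  induction w using induction₂ with
  | add s t hs ht => simp only [map_add, mul_add, hs, ht]
  | tmul c d =>
    rw [qInsert_tmul, onRight_tmul]
    generalize L.phi⁻¹.val = s
    generalize L.coact d = w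
    induction s using induction₃ with
    | add s t hs ht => simp only [map_add, mul_add, add_mul, hs, ht]
    | tmul x y z =>
    induction w using induction₂ with
    | add s t hs ht => simp only [map_add, TensorProduct.tmul_add, mul_add, hs, ht]
    | tmul a b => simp [qMap_tmul, H.S_mul, mul_assoc]

/-- `(S(b₋₁) ⊗ 1) q λ(b₀) = (1 ⊗ b) q`: coassociativity moves the coaction to the left of `φ_λ⁻¹`,
where it collapses around `α`. -/
theorem qInsert_coact (b : T) :
    qInsert H L (L.coact b) = (1 ⊗ₜ b) * qMap H T L.phi⁻¹.val := by
  rw [qInsert_eq, L.coassoc_inv, qMap_splitLeft_mul, L.counit_coact, padLeft_apply]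

theorem qInsert_coact_mul (b : T) (v : G ⊗[k] T) :
    qInsert H L (L.coact b * v) = (1 ⊗ₜ b) * qInsert H L v := by
  induction v using induction₂ with
  | add s t hs ht => simp only [map_add, mul_add, hs, ht]
  | tmul g t =>
    have key : ∀ u : G ⊗[k] T,
        qInsert H L (u * g ⊗ₜ t) = (H.S g ⊗ₜ 1) * (qInsert H L u * L.coact t) := by
      intro u
      induction u using induction₂ with
      | add s t hs ht => simp only [map_add, add_mul, mul_add, hs, ht]
      | tmul c d =>
        rw [Algebra.TensorProduct.tmul_mul_tmul, qInsert_tmul, qInsert_tmul, H.S_mul, map_mul]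
        simp only [← mul_assoc, Algebra.TensorProduct.tmul_mul_tmul, mul_one]
    rw [key, qInsert_coact, qInsert_tmul]
    simp only [← mul_assoc, Algebra.TensorProduct.tmul_mul_tmul, mul_one, one_mul]

/-- Since `S(y S⁻¹(x β)) = x β S(y)`, inserting `p` into `q` produces exactly the snake evaluated in
`snakeMap_inv_mul`. -/
theorem qInsert_pMap : qInsert H L (pMap H T L.phi.val) = 1 := by
  rw [← snakeMap_inv_mul H L]
  generalize L.phi.val = w
  induction w using induction₃ with
  | add s t hs ht => simp only [map_add, mul_add, hs, ht]
  | tmul x y z =>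
    rw [pMap_tmul, qInsert_tmul, onRight_tmul, onRight_tmul]
    generalize L.phi⁻¹.val = s
    generalize L.coact z = w
    induction s using induction₃ with
    | add s t hs ht => simp only [map_add, mul_add, add_mul, hs, ht]
    | tmul s₁ s₂ s₃ =>
    induction w using induction₂ with
    | add s t hs ht => simp only [map_add, TensorProduct.tmul_add, mul_add, hs, ht]
    | tmul a b => simp [qMap_tmul, snakeMap_tmul, padLeft_apply, H.S_mul, mul_assoc]

/-- `g ⊗ t ↦ λ(t) p (S⁻¹(g) ⊗ 1)`. -/
def pInsert : G ⊗[k] T →ₗ[k] G ⊗[k] T :=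
  mulMap (LinearMap.mulRight k (pMap H T L.phi.val) ∘ₗ L.coact.toLinearMap)
    ((TensorProduct.mk k G T).flip 1 ∘ₗ H.S.symm.toLinearMap) ∘ₗ
      (TensorProduct.comm k G T).toLinearMap

theorem pInsert_tmul (g : G) (t : T) :
    pInsert H L (g ⊗ₜ t) = L.coact t * pMap H T L.phi.val * (H.S.symm g ⊗ₜ 1) := rfl

theorem pInsert_eq (w : G ⊗[k] T) :
    pInsert H L w = pMap H T (onRight G L.coact w * L.phi.val) := by
  induction w using induction₂ with
  | add s t hs ht => simp only [map_add, add_mul, hs, ht]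
  | tmul c d =>
    rw [pInsert_tmul, onRight_tmul]
    generalize L.phi.val = s
    generalize L.coact d = w
    induction s using induction₃ with
    | add s t hs ht => simp only [map_add, mul_add, add_mul, hs, ht]
    | tmul x y z =>
    induction w using induction₂ with
    | add s t hs ht => simp only [map_add, TensorProduct.tmul_add, add_mul, hs, ht]
    | tmul a b => simp [pMap_tmul, H.S_symm_mul, mul_assoc]

theorem pInsert_coact (b : T) :
    pInsert H L (L.coact b) = pMap H T L.phi.val * (1 ⊗ₜ b) := by
  rw [pInsert_eq, L.quasi_coassoc, pMap_mul_splitLeft, L.counit_coact, padLeft_apply]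

theorem pInsert_mul_coact (b : T) (v : G ⊗[k] T) :
    pInsert H L (v * L.coact b) = pInsert H L v * (1 ⊗ₜ b) := by
  induction v using induction₂ with
  | add s t hs ht => simp only [map_add, add_mul, hs, ht]
  | tmul g t =>
    have key : ∀ u : G ⊗[k] T,
        pInsert H L (g ⊗ₜ t * u) = L.coact t * pInsert H L u * (H.S.symm g ⊗ₜ 1) := by
      intro u
      induction u using induction₂ with
      | add s t hs ht => simp only [map_add, add_mul, mul_add, hs, ht]
      | tmul c d =>
        rw [Algebra.TensorProduct.tmul_mul_tmul, pInsert_tmul, pInsert_tmul, H.S_symm_mul, map_mul]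
        simp only [mul_assoc, Algebra.TensorProduct.tmul_mul_tmul, mul_one]
    rw [key, pInsert_coact, pInsert_tmul]
    simp only [mul_assoc, Algebra.TensorProduct.tmul_mul_tmul, mul_one, one_mul]

/-- `x ⊗ y ⊗ z ⊗ t ↦ z S⁻¹(S(x) α y β) ⊗ t`. -/
def cosnakeMap (T : Type*) [Ring T] [Algebra k T] :
    G ⊗[k] (G ⊗[k] (G ⊗[k] T)) →ₗ[k] G ⊗[k] T :=
  pMap H T ∘ₗ qMap H (G ⊗[k] T)

theorem cosnakeMap_tmul (x y z : G) (t : T) : cosnakeMap H T (x ⊗ₜ (y ⊗ₜ (z ⊗ₜ t))) =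
    (z * H.S.symm (H.S x * H.α * y * H.β)) ⊗ₜ t := rfl

theorem cosnakeMap_mul_split (w : G ⊗[k] (G ⊗[k] T)) (t : G ⊗[k] (G ⊗[k] (G ⊗[k] T))) :
    cosnakeMap H T (t * onRight G (splitLeft T H.comul) w) =
      cosnakeMap H T (t * onRight G (padLeft G)
        (onRight G (padLeft G) (onRight G (killLeft T H.counit) w))) := by
  induction w using induction₃ with
  | add s t hs ht => simp only [map_add, mul_add, hs, ht]
  | tmul c d e =>
  induction t using induction₄ with
  | add s t hs ht => simp only [map_add, add_mul, hs, ht]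
  | tmul x y z w =>
  have key : ∀ m : G ⊗[k] G, cosnakeMap H T
      ((x ⊗ₜ (y ⊗ₜ (z ⊗ₜ w))) * (c ⊗ₜ Algebra.TensorProduct.assoc k k k G G T (m ⊗ₜ e))) =
      (z * H.S.symm (H.S (x * c) * H.α * y *
        mulMap (LinearMap.mulRight k H.β) H.S.toLinearMap m)) ⊗ₜ (w * e) := by
    intro m
    induction m using induction₂ with
    | add s t hs ht =>
      simp only [TensorProduct.add_tmul, TensorProduct.tmul_add, map_add, mul_add, hs, ht]
    | tmul a b => simp [cosnakeMap_tmul, H.S_mul, H.S_symm_mul, mul_assoc]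
  rw [onRight_tmul, splitLeft_tmul, key, H.antipode_right, onRight_tmul, killLeft_tmul]
  simp [onRight_tmul, padLeft_apply, cosnakeMap_tmul, mul_assoc, TensorProduct.smul_tmul']

/-- Inserting `q` into `p` gives `cosnakeMap` of `(id ⊗ id ⊗ λ)(φ_λ⁻¹)(1 ⊗ φ_λ)`. The pentagon and
two collapses leave only `φ⁻¹`, and pulling the last leg inside `S⁻¹` turns the result into the
second normalization `S(P) α Q β S(R) = 1`. -/
theorem pInsert_qMap : pInsert H L (qMap H T L.phi⁻¹.val) = 1 := by
  have h : pInsert H L (qMap H T L.phi⁻¹.val) =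
      cosnakeMap H T (onRight G (onRight G L.coact) L.phi⁻¹.val * padLeft G L.phi.val) := by
    rw [pInsert_eq, qMap_onRight, cosnakeMap, LinearMap.comp_apply, qMap_mul_padLeft]
  have h' : ∀ t : G ⊗[k] (G ⊗[k] G), cosnakeMap H T (padRight T t) =
      H.S.symm (mulMap (LinearMap.mulRight k H.α ∘ₗ H.S.toLinearMap)
        (mulMap (LinearMap.mulRight k H.β) H.S.toLinearMap) t) ⊗ₜ 1 := by
    intro t
    induction t using induction₃ with
    | add s t hs ht => simp only [map_add, TensorProduct.add_tmul, hs, ht]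
    | tmul x y z => simp [padRight_tmul, cosnakeMap_tmul, H.S_symm_mul, mul_assoc]
  rw [h, L.pentagon_inv_mul, cosnakeMap_mul_split, L.counit_phi_inv_mid, map_one, map_one, mul_one,
    cosnakeMap, LinearMap.comp_apply, qMap_splitLeft_mul, L.counit_phi_left, map_one, one_mul,
    ← LinearMap.comp_apply, ← cosnakeMap, h', H.antipode_phi_inv, H.S_symm_one,
    Algebra.TensorProduct.one_def]

end QElement

/-! ### The identity in `G ⊗ G ⊗ B` behind multiplicativity -/

section TwistedProduct

variable {k G T : Type*} [Field k] [Ring G] [Algebra k G] [Ring T] [Algebra k T]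
  (H : QuasiHopfAlgebra k G)

/-- `x ⊗ y ⊗ z ⊗ w ⊗ t ↦ S(y) α z ⊗ S(x) α w ⊗ t`. -/
def drinfeldGammaMapTensor (T : Type*) [Ring T] [Algebra k T] :
    G ⊗[k] (G ⊗[k] (G ⊗[k] (G ⊗[k] T))) →ₗ[k] G ⊗[k] (G ⊗[k] T) :=
  mulMap (TensorProduct.mk k G (G ⊗[k] T) 1 ∘ₗ (TensorProduct.mk k G T).flip 1 ∘ₗ
      LinearMap.mulRight k H.α ∘ₗ H.S.toLinearMap)
    (mulMap ((TensorProduct.mk k G (G ⊗[k] T)).flip 1 ∘ₗ LinearMap.mulRight k H.α ∘ₗ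
      H.S.toLinearMap) LinearMap.id)

theorem drinfeldGammaMapTensor_tmul (x y z w : G) (t : T) :
    drinfeldGammaMapTensor H T (x ⊗ₜ (y ⊗ₜ (z ⊗ₜ (w ⊗ₜ t)))) =
    (H.S y * H.α * z) ⊗ₜ ((H.S x * H.α * w) ⊗ₜ t) := by
  simp [drinfeldGammaMapTensor, Algebra.TensorProduct.one_def]

/-- Legs 2 and 3 collapse around the inner `α`. The counit this leaves removes one coproduct, so the
outer pair alone reproduces `qMap` of `s`. -/
theorem drinfeldGammaMapTensor_split_mul (s : G ⊗[k] (G ⊗[k] T))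
    (r : G ⊗[k] (G ⊗[k] (G ⊗[k] T))) :
    drinfeldGammaMapTensor H T
        (onRight G ((splitLeft (G ⊗[k] T) H.comul).comp (splitLeft T H.comul)) s *
          padLeft G r) =
      padLeft G (qMap H T s) * qMap H (G ⊗[k] T) r := by
  induction s using induction₂ with
  | add s t hs ht => simp only [map_add, add_mul, hs, ht]
  | tmul u w =>
  have key : ∀ v : G ⊗[k] (G ⊗[k] T), drinfeldGammaMapTensor H T
      (u ⊗ₜ[k] splitLeft (G ⊗[k] T) H.comul v * padLeft G r) =
      padLeft G (qMap H T (u ⊗ₜ[k] killLeft (G ⊗[k] T) H.counit v)) *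
        qMap H (G ⊗[k] T) r := by
    intro v
    induction v using induction₃ with
    | add s t hs ht => simp only [map_add, TensorProduct.tmul_add, add_mul, hs, ht]
    | tmul c d e =>
    induction r using induction₄ with
    | add s t hs ht => simp only [map_add, mul_add, hs, ht]
    | tmul x y z t =>
    have key' : ∀ m : G ⊗[k] G, drinfeldGammaMapTensor H T
        (u ⊗ₜ[k] (Algebra.TensorProduct.assoc k k k G G (G ⊗[k] T) (m ⊗ₜ[k] (d ⊗ₜ[k] e))) *
          padLeft G (x ⊗ₜ[k] (y ⊗ₜ[k] (z ⊗ₜ[k] t)))) =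
        (H.S x * mulMap (LinearMap.mulRight k H.α ∘ₗ H.S.toLinearMap) LinearMap.id m * y) ⊗ₜ
          ((H.S u * H.α * (d * z)) ⊗ₜ (e * t)) := by
      intro m
      induction m using induction₂ with
      | add s t hs ht =>
        simp only [TensorProduct.add_tmul, TensorProduct.tmul_add, map_add, mul_add, add_mul, hs,
          ht]
      | tmul a b => simp [padLeft_apply, drinfeldGammaMapTensor_tmul, H.S_mul, mul_assoc]
    rw [splitLeft_tmul, key', H.antipode_left, killLeft_tmul]
    simp [padLeft_apply, qMap_tmul, mul_assoc, ← TensorProduct.smul_tmul']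
  rw [onRight_tmul, AlgHom.comp_apply, key, H.killLeft_splitLeft]

/-- `x ⊗ y ⊗ t ↦ ∑ S(y) S(h₂) ⊗ S(x) S(h₁) ⊗ t'`, where `h = S⁻¹(g)` and `g ⊗ t' = q λ(t)`. -/
def twistedInsert (x y : G) : G ⊗[k] T →ₗ[k] G ⊗[k] (G ⊗[k] T) :=
  (Algebra.TensorProduct.assoc k k k G G T).toLinearMap ∘ₗ
    LinearMap.rTensor T (LinearMap.mulLeft k (antiFlip H (x ⊗ₜ y)) ∘ₗ antiComul H ∘ₗ
      H.S.symm.toLinearMap)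

theorem twistedInsert_tmul (x y g : G) (t : T) : twistedInsert H x y (g ⊗ₜ t) =
    Algebra.TensorProduct.assoc k k k G G T
      ((antiFlip H (x ⊗ₜ y) * antiComul H (H.S.symm g)) ⊗ₜ[k] t) := rfl

/-- `f⁻¹ ⊗ 1`. -/
def twistPad (T : Type*) [Ring T] [Algebra k T] : G ⊗[k] (G ⊗[k] T) :=
  Algebra.TensorProduct.assoc k k k G G T (drinfeldTwistInv H ⊗ₜ[k] (1 : T))

theorem drinfeldGammaMapTensor_assoc (x y : G) (s : G ⊗[k] (G ⊗[k] (G ⊗[k] G)))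
    (m n l : G ⊗[k] G) (t d : T) :
    drinfeldGammaMapTensor H T (onRight G (padRight (X := G) (Y := G) (Z := G) T) s *
      Algebra.TensorProduct.assoc k k k G G (G ⊗[k] (G ⊗[k] T))
        (m ⊗ₜ[k] Algebra.TensorProduct.assoc k k k G G T (n ⊗ₜ[k] t)) *
      (x ⊗ₜ[k] (y ⊗ₜ[k] Algebra.TensorProduct.assoc k k k G G T (l ⊗ₜ[k] d)))) =
    Algebra.TensorProduct.assoc k k k G G T
      ((antiFlip H (x ⊗ₜ y) * antiFlip H m * drinfeldGammaMap H s * n * l) ⊗ₜ[k] (t * d)) := by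
  induction m using induction₂ with
  | add s t hs ht =>
    simp only [TensorProduct.add_tmul, map_add, add_mul, mul_add, hs, ht]
  | tmul m₁ m₂ =>
  induction n using induction₂ with
  | add s t hs ht =>
    simp only [TensorProduct.add_tmul, TensorProduct.tmul_add, map_add, add_mul, mul_add, hs, ht]
  | tmul n₁ n₂ =>
  induction l using induction₂ with
  | add s t hs ht =>
    simp only [TensorProduct.add_tmul, TensorProduct.tmul_add, map_add, mul_add, hs, ht]
  | tmul l₁ l₂ =>
  induction s using induction₄ with
  | add s t hs ht =>
    simp only [TensorProduct.add_tmul, map_add, add_mul, mul_add, hs, ht]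
  | tmul s₁ s₂ s₃ s₄ =>
    simp [onRight_tmul, padRight_tmul, drinfeldGammaMapTensor_tmul, antiFlip_tmul,
      drinfeldGammaMap_tmul, H.S_mul, mul_assoc]

variable (L : LeftCoaction H.toQuasiBialgebra T)

/-- `x ⊗ y ⊗ t ↦ (S(y) ⊗ S(x)) (S(h₂) ⊗ S(h₁)) ⊗ t'`, where `h = S⁻¹(g)` and
`g ⊗ t' = q λ(t)`. -/
def twistedMap : G ⊗[k] (G ⊗[k] T) →ₗ[k] G ⊗[k] (G ⊗[k] T) :=
  mulMap (TensorProduct.mk k G (G ⊗[k] T) 1 ∘ₗ (TensorProduct.mk k G T).flip 1 ∘ₗ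
      H.S.toLinearMap)
    (mulMap ((TensorProduct.mk k G (G ⊗[k] T)).flip 1 ∘ₗ H.S.toLinearMap)
      ((Algebra.TensorProduct.assoc k k k G G T).toLinearMap ∘ₗ
        LinearMap.rTensor T (antiComul H ∘ₗ H.S.symm.toLinearMap) ∘ₗ
        LinearMap.mulLeft k (qMap H T L.phi⁻¹.val) ∘ₗ L.coact.toLinearMap))

theorem twistedMap_tmul (x y : G) (t : T) : twistedMap H L (x ⊗ₜ (y ⊗ₜ t)) =
    twistedInsert H x y (qMap H T L.phi⁻¹.val * L.coact t) := by
  have key : ∀ w : G ⊗[k] T, (1 ⊗ₜ[k] (H.S x ⊗ₜ[k] 1)) * ((H.S y ⊗ₜ[k] 1) *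
      Algebra.TensorProduct.assoc k k k G G T
        (LinearMap.rTensor T (antiComul H ∘ₗ H.S.symm.toLinearMap) w)) =
      twistedInsert H x y w := by
    intro w
    induction w using induction₂ with
    | add s t hs ht => simp only [map_add, mul_add, hs, ht]
    | tmul g t =>
      rw [LinearMap.rTensor_tmul, twistedInsert_tmul, antiFlip_tmul, LinearMap.comp_apply,
        LinearEquiv.coe_coe]
      generalize antiComul H (H.S.symm g) = m
      induction m using induction₂ with
      | add s t hs ht => simp only [TensorProduct.add_tmul, map_add, mul_add, hs, ht]
      | tmul a b => simp
  exact key _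

theorem onRight_split_padRight (w : G ⊗[k] (G ⊗[k] G)) :
    onRight G (onRight G (splitLeft T H.comul)) (padRight T w) =
      onRight G (padRight (X := G) (Y := G) (Z := G) T) (onRight G (onRight G H.comul) w) := by
  induction w using induction₃ with
  | add s t hs ht => simp only [map_add, hs, ht]
  | tmul x y z =>
    simp only [padRight_tmul, onRight_tmul, splitLeft_tmul]
    generalize H.comul z = m
    induction m using induction₂ with
    | add s t hs ht => simp only [TensorProduct.add_tmul, TensorProduct.tmul_add, map_add, hs, ht]
    | tmul a b => rfl

theorem padLeft_padRight_mul (w : G ⊗[k] (G ⊗[k] T)) :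
    padLeft G (padRight T H.phi⁻¹.val) *
      onRight G (onRight G (splitLeft T H.comul)) (onRight G (splitLeft T H.comul) w) =
    onRight G ((splitLeft (G ⊗[k] T) H.comul).comp (splitLeft T H.comul)) w *
      padLeft G (padRight T H.phi⁻¹.val) := by
  induction w using induction₂ with
  | add s t hs ht => simp only [map_add, mul_add, add_mul, hs, ht]
  | tmul x y =>
    simp only [padLeft_apply, onRight_tmul, Algebra.TensorProduct.tmul_mul_tmul, one_mul, mul_one,
      H.coassoc_padRight, AlgHom.comp_apply]

theorem onRight_split_onRight (w : G ⊗[k] (G ⊗[k] T)) :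
    onRight G (onRight G (splitLeft T H.comul)) (onRight G (onRight G L.coact) w) =
      onRight G (onRight G ((splitLeft T H.comul).comp L.coact)) w := by
  induction w using induction₃ with
  | add s t hs ht => simp only [map_add, hs, ht]
  | tmul x y z => rfl

theorem split_pentagon_inv :
    onRight G (padRight (X := G) (Y := G) (Z := G) T) (onRight G (onRight G H.comul) H.phi⁻¹.val) *
      onRight G (onRight G (splitLeft T H.comul)) (onRight G (splitLeft T H.comul) L.phi⁻¹.val) *
      onRight G (onRight G (splitLeft T H.comul)) (padLeft G L.phi⁻¹.val) =
    splitLeft (G ⊗[k] (G ⊗[k] T)) H.comul (onRight G (splitLeft T H.comul) L.phi⁻¹.val) *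
      onRight G (onRight G ((splitLeft T H.comul).comp L.coact)) L.phi⁻¹.val := by
  have h := congrArg (onRight G (onRight G (splitLeft T H.comul))) L.pentagon_inv
  simp only [map_mul (onRight _ _)] at h
  rw [onRight_split_padRight, ← splitLeft_onRight, onRight_split_onRight] at h
  exact h

/-- Apply `id ⊗ id ⊗ Δ ⊗ id` to the inverted pentagon of `φ_λ`. The factor `(id ⊗ id ⊗ Δ)(φ)` from
`γ` cancels its inverse there, and the `1 ⊗ φ⁻¹` from `γ` passes to the right of `φ_λ⁻¹` by
coassociativity. -/
theorem gamma_pentagon :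
    onRight G (padRight (X := G) (Y := G) (Z := G) T)
        (padLeft G H.phi⁻¹.val * onRight G (onRight G H.comul) H.phi.val) *
      splitLeft (G ⊗[k] (G ⊗[k] T)) H.comul (onRight G (splitLeft T H.comul) L.phi⁻¹.val) *
      onRight G (onRight G ((splitLeft T H.comul).comp L.coact)) L.phi⁻¹.val =
    onRight G ((splitLeft (G ⊗[k] T) H.comul).comp (splitLeft T H.comul)) L.phi⁻¹.val *
      padLeft G (padRight T H.phi⁻¹.val * onRight G (splitLeft T H.comul) L.phi⁻¹.val) := by
  have h := split_pentagon_inv H L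
  let P : G ⊗[k] (G ⊗[k] (G ⊗[k] G)) →ₐ[k] G ⊗[k] (G ⊗[k] (G ⊗[k] (G ⊗[k] T))) :=
    onRight G (padRight (X := G) (Y := G) (Z := G) T)
  change P _ * _ * _ = _ at h
  change P _ * _ * _ = _
  have h₃ : P (onRight G (onRight G H.comul) H.phi.val) *
      (P (onRight G (onRight G H.comul) H.phi⁻¹.val)) = 1 := by
    rw [← map_mul, map_mul_map_inv, map_one]
  rw [map_mul P, mul_assoc, mul_assoc, ← h, mul_assoc (P _), ← mul_assoc (P (onRight _ _ _)), h₃,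
    one_mul, ← mul_assoc]
  change padLeft G (padRight T H.phi⁻¹.val) * _ * _ = _
  rw [padLeft_padRight_mul, mul_assoc, map_mul (padLeft G)]
  rfl

theorem gamma_pentagon_mul (v : G ⊗[k] (G ⊗[k] T)) :
    onRight G (padRight (X := G) (Y := G) (Z := G) T)
        (padLeft G H.phi⁻¹.val * onRight G (onRight G H.comul) H.phi.val) *
      splitLeft (G ⊗[k] (G ⊗[k] T)) H.comul (onRight G (splitLeft T H.comul) L.phi⁻¹.val) *
      onRight G (onRight G ((splitLeft T H.comul).comp L.coact)) (L.phi⁻¹.val * v) =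
    onRight G ((splitLeft (G ⊗[k] T) H.comul).comp (splitLeft T H.comul)) L.phi⁻¹.val *
      padLeft G (padRight T H.phi⁻¹.val * onRight G (splitLeft T H.comul) L.phi⁻¹.val) *
      onRight G (onRight G ((splitLeft T H.comul).comp L.coact)) v := by
  rw [map_mul (onRight G (onRight G ((splitLeft T H.comul).comp L.coact))), ← mul_assoc,
    gamma_pentagon]

variable [FiniteDimensional k G]

/-- Both twist relations enter here: `S⁻¹(S(u) α y) = S⁻¹(y) S⁻¹(α) u`, its middle factor yields `γ
f⁻¹`, and `f⁻¹` then moves to the far right, replacing the factor from `S⁻¹(y)` by `Δ(y)`. -/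
theorem antiComul_antipode_mul (u y : G) :
    antiComul H (H.S.symm (H.S u * H.α * y)) =
      antiComul H u * drinfeldGamma H * H.comul y * drinfeldTwistInv H := by
  rw [H.S_symm_mul, H.S_symm_mul, LinearEquiv.symm_apply_apply, antiComul_mul, antiComul_mul,
    ← drinfeldGamma_mul_drinfeldTwistInv, mul_assoc _ (H.comul y), comul_mul_drinfeldTwistInv]
  simp only [mul_assoc]

theorem twistedInsert_qMap_mul (x y : G) (s : G ⊗[k] (G ⊗[k] T)) (w : G ⊗[k] T) :
    twistedInsert H x y (qMap H T s * w) =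
      drinfeldGammaMapTensor H T
        (onRight G (padRight (X := G) (Y := G) (Z := G) T)
            (padLeft G H.phi⁻¹.val * onRight G (onRight G H.comul) H.phi.val) *
          splitLeft (G ⊗[k] (G ⊗[k] T)) H.comul (onRight G (splitLeft T H.comul) s) *
          (x ⊗ₜ[k] (y ⊗ₜ[k] splitLeft T H.comul w))) * twistPad H T := by
  induction s using induction₃ with
  | add s t hs ht => simp only [map_add, add_mul, mul_add, hs, ht]
  | tmul u v t =>
  induction w using induction₂ with
  | add s t hs ht => simp only [map_add, TensorProduct.tmul_add, add_mul, mul_add, hs, ht]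
  | tmul c d =>
    rw [onRight_tmul, splitLeft_tmul, splitLeft_tmul, splitLeft_tmul, drinfeldGammaMapTensor_assoc,
      qMap_tmul, Algebra.TensorProduct.tmul_mul_tmul, twistedInsert_tmul, mul_assoc (H.S u * H.α),
      antiComul_antipode_mul, twistPad, ← map_mul, Algebra.TensorProduct.tmul_mul_tmul, mul_one,
      map_mul H.comul, ← antiComul_apply, ← drinfeldGamma]
    simp only [mul_assoc]

theorem twistedMap_eq (v : G ⊗[k] (G ⊗[k] T)) : twistedMap H L v =
    drinfeldGammaMapTensor H T
      (onRight G (padRight (X := G) (Y := G) (Z := G) T)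
          (padLeft G H.phi⁻¹.val * onRight G (onRight G H.comul) H.phi.val) *
        splitLeft (G ⊗[k] (G ⊗[k] T)) H.comul (onRight G (splitLeft T H.comul) L.phi⁻¹.val) *
        onRight G (onRight G ((splitLeft T H.comul).comp L.coact)) v) * twistPad H T := by
  induction v using induction₃ with
  | add s t hs ht => simp only [map_add, mul_add, add_mul, hs, ht]
  | tmul x y t => rw [twistedMap_tmul, twistedInsert_qMap_mul]; rfl

/-- Both sides reduce to `1 ⊗ q λ(b)` times `qMap` of `(φ⁻¹ ⊗ 1)(id ⊗ Δ ⊗ id)(φ_λ⁻¹)`, times `(Δ ⊗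
id)(λ(b'))` and `f⁻¹ ⊗ 1`. On the left, `γ` and the pentagon split off one `q`, and `λ(b)` is freed
by a collapse around the other `α`. -/
theorem twistedMap_inv_mul (b b' : T) :
    twistedMap H L (L.phi⁻¹.val * padLeft G (L.coact b * (1 ⊗ₜ b'))) =
      padLeft G (qMap H T L.phi⁻¹.val * L.coact b) *
        onRight G L.coact (qMap H T L.phi⁻¹.val * L.coact b') * L.phi.val * twistPad H T := by
  rw [twistedMap_eq, gamma_pentagon_mul]
  have h₁ : onRight G (onRight G ((splitLeft T H.comul).comp L.coact))
      (padLeft G (L.coact b * (1 ⊗ₜ b'))) =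
      padLeft G (onRight G (splitLeft T H.comul) (onRight G L.coact (L.coact b)) *
        padLeft G (splitLeft T H.comul (L.coact b'))) := by
    rw [onRight_onRight, map_mul (padLeft _), map_mul (onRight _ _), map_mul (padLeft _)]
    rfl
  rw [h₁, mul_assoc, ← map_mul (padLeft G), drinfeldGammaMapTensor_split_mul,
    mul_assoc (padRight T _), ← mul_assoc (onRight G (splitLeft T H.comul) _),
    ← map_mul (onRight _ _), L.coassoc_inv, map_mul (onRight _ _), ← mul_assoc,
    ← mul_assoc, H.coassoc_padRight, mul_assoc, mul_assoc,
    mul_assoc (splitLeft (G ⊗[k] T) H.comul _), qMap_splitLeft_mul, H.killLeft_splitLeft,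
    map_mul (onRight _ _), qMap_onRight, map_mul (padLeft _)]
  simp only [mul_assoc]
  -- The right side: `φ_λ` moves left across `(id ⊗ λ)(λ(b'))`, and `(id ⊗ λ)(q) φ_λ` is `qMap` of
  -- one side of the pentagon.
  rw [← mul_assoc (onRight G L.coact _) L.phi.val, L.quasi_coassoc, mul_assoc L.phi.val,
    ← mul_assoc (qMap H (G ⊗[k] T) (onRight _ _ _)) L.phi.val,
    ← qMap_mul_padLeft H (onRight _ _ _), L.pentagon_inv_mul, mul_assoc, qMap_splitLeft_mul,
    L.counit_phi_left, map_one, one_mul, ← mul_assoc (qMap H (G ⊗[k] T) _) (splitLeft _ _ _),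
    ← qMap_mul_padLeft H _ (splitLeft T H.comul _)]
  simp only [mul_assoc]

end TwistedProduct

/-! ### Elements of `M ⊗ Ĝ` as functions on `G` -/

section Evaluation

variable {k G A B : Type*} [Field k] [Ring G] [Algebra k G] [Ring A] [Algebra k A]
  [Ring B] [Algebra k B]

/-- `φ ⊗ id : G ⊗ X → X`. -/
def dualContract {X : Type*} [AddCommGroup X] [Module k X] (φ : Module.Dual k G) :
    G ⊗[k] X →ₗ[k] X :=
  (TensorProduct.lid k X).toLinearMap ∘ₗ LinearMap.rTensor X φ

theorem dualContract_tmul {X : Type*} [AddCommGroup X] [Module k X] (φ : Module.Dual k G)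
    (g : G) (x : X) : dualContract φ (g ⊗ₜ[k] x) = φ g • x := rfl

/-- `a ⊗ g ⊗ h ⊗ b ↦ φ(g) ψ(h) a ⊗ b`. -/
def evalPair (A B : Type*) [Ring A] [Algebra k A] [Ring B] [Algebra k B]
    (φ ψ : Module.Dual k G) : A ⊗[k] (G ⊗[k] (G ⊗[k] B)) →ₗ[k] A ⊗[k] B :=
  LinearMap.lTensor A (dualContract ψ ∘ₗ dualContract φ)

theorem evalPair_tmul (φ ψ : Module.Dual k G) (a : A) (g h : G) (b : B) :
    evalPair A B φ ψ (a ⊗ₜ (g ⊗ₜ (h ⊗ₜ b))) = (φ g * ψ h) • (a ⊗ₜ b) := by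
  simp [evalPair, dualContract_tmul, smul_smul]

/-- `g ⊗ h ↦ 1 ⊗ g ⊗ h ⊗ 1`. -/
def midLegs (A B : Type*) [Ring A] [Algebra k A] [Ring B] [Algebra k B] :
    G ⊗[k] G →ₐ[k] A ⊗[k] (G ⊗[k] (G ⊗[k] B)) :=
  (padLeft A).comp (onRight G Algebra.TensorProduct.includeLeft)

theorem midLegs_tmul (g h : G) :
    midLegs A B (g ⊗ₜ[k] h) = 1 ⊗ₜ[k] (g ⊗ₜ[k] (h ⊗ₜ[k] 1)) := rfl

variable [FiniteDimensional k G]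

variable (k G) in
/-- `M ⊗ Ĝ` as the space of linear maps `G → M`. -/
def evalEquiv (M : Type*) [AddCommGroup M] [Module k M] :
    M ⊗[k] Module.Dual k G ≃ₗ[k] (G →ₗ[k] M) :=
  (TensorProduct.comm k M (Module.Dual k G)).trans (dualTensorHomEquiv k G M)

theorem evalEquiv_tmul {M : Type*} [AddCommGroup M] [Module k M] (m : M) (φ : Module.Dual k G)
    (x : G) : evalEquiv k G M (m ⊗ₜ φ) x = φ x • m := by
  simp [evalEquiv, dualTensorHomEquiv, dualTensorHom_apply]

variable (Q : QuasiBialgebra k G)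

/-- `(u₁ ⊗ u₂ ⊗ u₃, v₁ ⊗ v₂ ⊗ v₃) ↦ (u₁ ⊗ v₃) ⋈ (v₁ ⇀ φ ↼ u₂)(v₂ ⇀ ψ ↼ u₃)`. -/
def dualPair (φ ψ : Module.Dual k G) (u : A ⊗[k] (G ⊗[k] G)) (v : G ⊗[k] (G ⊗[k] B)) :
    CrossedSpace k G A B :=
  (evalEquiv k G (A ⊗[k] B)).symm (evalPair A B φ ψ ∘ₗ LinearMap.mulRight k (padLeft A v) ∘ₗ
    LinearMap.mulLeft k (padRight B u) ∘ₗ (midLegs A B).toLinearMap ∘ₗ Q.comul.toLinearMap)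

theorem evalEquiv_dualPair (φ ψ : Module.Dual k G) (u : A ⊗[k] (G ⊗[k] G))
    (v : G ⊗[k] (G ⊗[k] B)) (x : G) : evalEquiv k G (A ⊗[k] B) (dualPair Q φ ψ u v) x =
      evalPair A B φ ψ (padRight B u * midLegs A B (Q.comul x) * padLeft A v) := by
  rw [dualPair, LinearEquiv.apply_symm_apply]; rfl

theorem dualPair_add_left (φ ψ : Module.Dual k G) (u u' : A ⊗[k] (G ⊗[k] G))
    (v : G ⊗[k] (G ⊗[k] B)) :
    dualPair Q φ ψ (u + u') v = dualPair Q φ ψ u v + dualPair Q φ ψ u' v := by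
  apply (evalEquiv k G (A ⊗[k] B)).injective
  ext x
  simp only [map_add, LinearMap.add_apply, evalEquiv_dualPair, add_mul]

theorem dualPair_add_right (φ ψ : Module.Dual k G) (u : A ⊗[k] (G ⊗[k] G))
    (v v' : G ⊗[k] (G ⊗[k] B)) :
    dualPair Q φ ψ u (v + v') = dualPair Q φ ψ u v + dualPair Q φ ψ u v' := by
  apply (evalEquiv k G (A ⊗[k] B)).injective
  ext x
  simp only [map_add, LinearMap.add_apply, evalEquiv_dualPair, mul_add]

theorem dualPair_tmul (φ ψ : Module.Dual k G) (u₁ : A) (u₂ u₃ v₁ v₂ : G) (v₃ : B) :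
    dualPair Q φ ψ (u₁ ⊗ₜ (u₂ ⊗ₜ u₃)) (v₁ ⊗ₜ (v₂ ⊗ₜ v₃)) =
      (u₁ ⊗ₜ v₃) ⊗ₜ dualMul Q (leftHit v₁ (rightHit u₂ φ)) (leftHit v₂ (rightHit u₃ ψ)) := by
  apply (evalEquiv k G (A ⊗[k] B)).injective
  ext x
  rw [evalEquiv_dualPair, evalEquiv_tmul, dualMul_apply]
  generalize Q.comul x = m
  induction m using induction₂ with
  | add s t hs ht => simp only [map_add, add_mul, mul_add, add_smul, hs, ht]
  | tmul c d =>
    simp [midLegs_tmul, padRight_tmul, padLeft_apply, evalPair_tmul, mul_assoc]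

theorem dualPair_leftHit (φ ψ : Module.Dual k G) (u : A ⊗[k] (G ⊗[k] G))
    (v : G ⊗[k] (G ⊗[k] B)) (g h : G) :
    dualPair Q (leftHit g φ) (leftHit h ψ) u v =
      dualPair Q φ ψ u (v * (g ⊗ₜ[k] (h ⊗ₜ[k] 1))) := by
  induction u using induction₃ with
  | add s t hs ht => simp only [dualPair_add_left, hs, ht]
  | tmul u₁ u₂ u₃ =>
  induction v using induction₃ with
  | add s t hs ht => simp only [dualPair_add_right, add_mul, hs, ht]
  | tmul v₁ v₂ v₃ =>
    have e : ∀ (x y g : G) (φ : Module.Dual k G), leftHit y (rightHit x (leftHit g φ)) =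
        leftHit (y * g) (rightHit x φ) := by
      intro x y g φ; ext z; simp [mul_assoc]
    simp only [Algebra.TensorProduct.tmul_mul_tmul, dualPair_tmul, mul_one, e]

end Evaluation

/-! ### The diagonal product as a `dualPair` -/

section DiagonalProduct

variable {k G A B : Type*} [Field k] [Ring G] [Algebra k G] [Ring A] [Algebra k A]
  [Ring B] [Algebra k B] (H : QuasiHopfAlgebra k G)

/-- `x ⊗ y ⊗ t ↦ S⁻¹(y) ⊗ S⁻¹(x) ⊗ t`. -/
def untwist (T : Type*) [Ring T] [Algebra k T] :
    G ⊗[k] (G ⊗[k] T) →ₗ[k] G ⊗[k] (G ⊗[k] T) :=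
  (TensorProduct.leftComm k G G T).toLinearMap ∘ₗ
    TensorProduct.map H.S.symm.toLinearMap
      (TensorProduct.map H.S.symm.toLinearMap LinearMap.id)

theorem untwist_tmul {T : Type*} [Ring T] [Algebra k T] (x y : G) (t : T) :
    untwist H T (x ⊗ₜ (y ⊗ₜ t)) = H.S.symm y ⊗ₜ (H.S.symm x ⊗ₜ t) := rfl

theorem untwist_mul {T : Type*} [Ring T] [Algebra k T] (g h : G) (v : G ⊗[k] (G ⊗[k] T)) :
    untwist H T ((g ⊗ₜ[k] (h ⊗ₜ[k] 1)) * v) =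
      untwist H T v * (H.S.symm h ⊗ₜ[k] (H.S.symm g ⊗ₜ[k] 1)) := by
  induction v using induction₃ with
  | add s t hs ht => simp only [map_add, mul_add, add_mul, hs, ht]
  | tmul x y t => simp [untwist_tmul, H.S_symm_mul]

/-- `(a ⊗ 1 ⊗ 1) (ρ(a') ⊗ 1) φ_ρ⁻¹` -/
def leftFactor {Q : QuasiBialgebra k G} (R : RightCoaction Q A) (a a' : A) :
    A ⊗[k] (G ⊗[k] G) :=
  (a ⊗ₜ 1) * onRight A Algebra.TensorProduct.includeLeft (R.coact a') * R.phi⁻¹.val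

variable [FiniteDimensional k G]

/-- Evaluated at `y`, both sides are `φ(n₁ y S⁻¹(n₋₁)) n₀`: the threefold coproduct of `φ` only
records the order of these three factors. -/
theorem tripleAct_dualComul₂ {M : Type*} [Ring M] [Algebra k M]
    (δ : M →ₐ[k] G ⊗[k] (M ⊗[k] G)) (φ : Module.Dual k G) (n : M) :
    tripleAct H δ (dualComul₂ φ) n = implement H φ (δ n) := by
  apply (evalEquiv k G M).injective
  ext y
  have h₁ : ∀ (χ : Module.Dual k G) (t : Module.Dual k G ⊗[k] Module.Dual k G),
      evalEquiv k G M (tripleAct H δ (χ ⊗ₜ t) n) y =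
        contract (TensorProduct.lid k _ (LinearMap.rTensor _ (Module.Dual.eval k G y) t) ∘ₗ
          H.S.symm.toLinearMap) χ (δ n) := by
    intro χ t
    induction t using induction₂ with
    | add s t hs ht =>
      simp only [TensorProduct.tmul_add, map_add, LinearMap.add_apply, hs, ht, contract,
        LinearMap.add_comp, TensorProduct.map_add_left, LinearMap.comp_add]
    | tmul χ₂ χ₃ =>
      rw [tripleAct_tmul, evalEquiv_tmul]
      simp [contract, LinearMap.smul_comp, TensorProduct.map_smul_left]
  have h₂ : ∀ χ : Module.Dual k G, TensorProduct.lid k _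
      (LinearMap.rTensor _ (Module.Dual.eval k G y) (dualComul χ)) = rightHit y χ := by
    intro χ
    ext z
    rw [rightHit_apply, ← dualDistrib_dualComul]
    generalize dualComul χ = t
    induction t using induction₂ with
    | add s t hs ht => simp only [map_add, LinearMap.add_apply, hs, ht]
    | tmul a b => simp
  -- Only the outer coproduct has to be expanded; the inner one has been evaluated in `h₂` as
  -- `rightHit y`.
  obtain ⟨s, hs⟩ := TensorProduct.exists_finset (dualComul φ)
  have h₃ : ∀ h z : G, ∑ i ∈ s, i.1 h * i.2 z = φ (h * z) := by
    intro h z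
    rw [← dualDistrib_dualComul, hs]
    simp
  simp only [dualComul₂, LinearMap.comp_apply, hs, map_sum, LinearMap.lTensor_tmul,
    LinearMap.sum_apply, h₁, h₂]
  generalize δ n = d
  induction d using induction₃ with
  | add s t hs ht =>
    simp only [map_add, LinearMap.add_apply, Finset.sum_add_distrib, hs, ht]
  | tmul g m h =>
    simp only [contract_tmul, implement_tmul, evalEquiv_tmul, leftHit_apply, rightHit_apply,
      ← h₃, Finset.sum_smul, LinearMap.comp_apply, LinearEquiv.coe_coe, smul_smul, mul_comm]

/-- `Ω` and `Ŝ⁻¹` carry `S⁻¹` on every left-acting leg. As `S⁻¹` is antimultiplicative, these legs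
gather into a single `untwist` of a product in `G ⊗ G ⊗ B`, in which `h⁻¹` shows up as `f⁻¹`; the
exchange of legs in `untwist` reflects that `Ω²` acts on `φ` and `Ω¹` on `ψ`. -/
theorem omegaAct_eq_dualPair (r : A ⊗[k] (G ⊗[k] G)) (p : G ⊗[k] (G ⊗[k] B)) (f : G ⊗[k] G)
    (a a' : A) (b b' : B) (g h : G) (φ ψ : Module.Dual k G) :
    LinearMap.lTensor (A ⊗[k] B) (TensorProduct.lift (dualMul H.toQuasiBialgebra))
      (omegaAct
        (Algebra.TensorProduct.assoc k k k G G ((A ⊗[k] B) ⊗[k] (G ⊗[k] G))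
          (TensorProduct.comm k G G
            (TensorProduct.map H.S.symm.toLinearMap H.S.symm.toLinearMap
              (TensorProduct.comm k G G f)) ⊗ₜ[k] (1 : (A ⊗[k] B) ⊗[k] (G ⊗[k] G))) *
          TensorProduct.map H.S.symm.toLinearMap
            (TensorProduct.map H.S.symm.toLinearMap LinearMap.id)
            (padLeft G (padLeft G (extPhiRight B r)) * padRight (G ⊗[k] G) (extPhiLeft A p)))
        (TensorProduct.assoc k (A ⊗[k] B) (Module.Dual k G) (Module.Dual k G)
          (LinearMap.rTensor (Module.Dual k G) (LinearMap.mul k (A ⊗[k] B) (a ⊗ₜ b))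
            (implement H φ (g ⊗ₜ ((a' ⊗ₜ b') ⊗ₜ h))) ⊗ₜ[k] ψ))) =
    dualPair H.toQuasiBialgebra φ ψ ((a ⊗ₜ 1) * (a' ⊗ₜ (h ⊗ₜ 1)) * r)
      (untwist H B (padLeft G (padLeft G b) * padLeft G (g ⊗ₜ b') * p *
        Algebra.TensorProduct.assoc k k k G G B (f ⊗ₜ[k] (1 : B)))) := by
  induction r using induction₃ with
  | add s t hs ht => simp only [map_add, mul_add, add_mul, LinearMap.add_apply,
      dualPair_add_left, hs, ht]
  | tmul r₁ r₂ r₃ =>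
  induction p using induction₃ with
  | add s t hs ht => simp only [map_add, mul_add, add_mul, LinearMap.add_apply,
      dualPair_add_right, hs, ht]
  | tmul p₁ p₂ p₃ =>
  induction f using induction₂ with
  | add s t hs ht => simp only [map_add, TensorProduct.add_tmul, mul_add, add_mul,
      LinearMap.add_apply, dualPair_add_right, hs, ht]
  | tmul f₁ f₂ =>
    have e₁ : extPhiRight B (r₁ ⊗ₜ[k] (r₂ ⊗ₜ[k] r₃)) = (r₁ ⊗ₜ[k] (1 : B)) ⊗ₜ[k] (r₂ ⊗ₜ[k] r₃) :=
      rfl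
    have e₂ : extPhiLeft A (p₁ ⊗ₜ[k] (p₂ ⊗ₜ[k] p₃)) = p₁ ⊗ₜ[k] (p₂ ⊗ₜ[k] ((1 : A) ⊗ₜ[k] p₃)) :=
      rfl
    have e₃ : ∀ (x y s t : G) (χ : Module.Dual k G), leftHit x (rightHit y
        (leftHit s (rightHit t χ))) = leftHit (x * s) (rightHit (t * y) χ) := by
      intro x y s t χ; ext z; simp [mul_assoc]
    rw [e₁, e₂, padRight_tmul, implement_tmul]
    simp only [padLeft_apply, Algebra.TensorProduct.tmul_mul_tmul, one_mul, mul_one,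
      TensorProduct.comm_tmul, TensorProduct.map_tmul, assoc_tmul, LinearMap.id_apply,
      LinearMap.rTensor_tmul, LinearMap.lTensor_tmul, TensorProduct.assoc_tmul, omegaAct_tmul,
      untwist_tmul, dualPair_tmul, TensorProduct.lift.tmul, LinearEquiv.coe_coe, H.S_symm_mul, e₃,
      LinearMap.mul_apply', mul_assoc]

theorem crossedMul_tmul (R : RightCoaction H.toQuasiBialgebra A)
    (L : LeftCoaction H.toQuasiBialgebra B) (a a' : A) (b b' : B) (φ ψ : Module.Dual k G) :
    crossedMul R L ((a ⊗ₜ b) ⊗ₜ φ) ((a' ⊗ₜ b') ⊗ₜ ψ) =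
      dualPair H.toQuasiBialgebra φ ψ (leftFactor R a a')
        (untwist H B (padLeft G (padLeft G b) * padLeft G (L.coact b') * L.phi.val *
          twistPad H B)) := by
  rw [crossedMul, rightDiagMul_tmul, tripleAct_dualComul₂, leftFactor]
  have hδ : deltaR R L (a' ⊗ₜ b') =
      onRight G (extRight B R.coact) (TensorProduct.leftComm k A G B (a' ⊗ₜ L.coact b')) := rfl
  rw [hδ]
  generalize L.coact b' = w
  induction w using induction₂ with
  | add s t hs ht => simp only [map_add, TensorProduct.tmul_add, TensorProduct.add_tmul, mul_add,
      add_mul, dualPair_add_right, hs, ht]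
  | tmul g c =>
    have hρ : onRight G (extRight B R.coact) (TensorProduct.leftComm k A G B (a' ⊗ₜ (g ⊗ₜ c))) =
      g ⊗ₜ[k] (Algebra.TensorProduct.assoc k k k A B G).symm
        (onRight A (Algebra.TensorProduct.comm k G B).toAlgHom
          (Algebra.TensorProduct.assoc k k k A G B (R.coact a' ⊗ₜ[k] c))) := rfl
    rw [hρ]
    generalize R.coact a' = w
    induction w using induction₂ with
    | add s t hs ht => simp only [map_add, TensorProduct.tmul_add, TensorProduct.add_tmul, mul_add,
        add_mul, dualPair_add_left, hs, ht]
    | tmul c' h => exact omegaAct_eq_dualPair H _ _ _ _ _ _ _ _ _ _ _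

end DiagonalProduct

/-! ### The bijection `a ⊗ b ⊗ φ ↦ a Γ(φ) b` -/

section Spread

variable {k G A B : Type*} [Field k] [Ring G] [Algebra k G] [Ring A] [Algebra k A]
  [Ring B] [Algebra k B]

/-- `(a ⊗ g ⊗ t) ⊗ φ ↦ (a ⊗ t) ⊗ (σ(g) ⇀ φ)` -/
def spread (σ : G →ₗ[k] G) :
    (A ⊗[k] (G ⊗[k] B)) ⊗[k] Module.Dual k G →ₗ[k] CrossedSpace k G A B :=
  TensorProduct.lift (LinearMap.lTensorHom (A ⊗[k] B) ∘ₗ leftHit ∘ₗ σ) ∘ₗ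
    (TensorProduct.assoc k G (A ⊗[k] B) (Module.Dual k G)).toLinearMap ∘ₗ
    LinearMap.rTensor _ (TensorProduct.leftComm k A G B).toLinearMap

theorem spread_tmul (σ : G →ₗ[k] G) (a : A) (g : G) (t : B) (φ : Module.Dual k G) :
    spread σ ((a ⊗ₜ (g ⊗ₜ t)) ⊗ₜ φ) = (a ⊗ₜ t) ⊗ₜ leftHit (σ g) φ := rfl

/-- `(a ⊗ t) ⊗ φ ↦ spread σ ((a ⊗ K(t)) ⊗ φ)` -/
def spreadOf (K : B →ₗ[k] G ⊗[k] B) (σ : G →ₗ[k] G) :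
    CrossedSpace k G A B →ₗ[k] CrossedSpace k G A B :=
  spread σ ∘ₗ LinearMap.rTensor _ (LinearMap.lTensor A K)

theorem leftHit_leftHit (g h : G) (φ : Module.Dual k G) :
    leftHit g (leftHit h φ) = leftHit (g * h) φ := by
  ext x; simp [mul_assoc]

theorem leftHit_one (φ : Module.Dual k G) : leftHit 1 φ = φ := by
  ext x; simp

variable (H : QuasiHopfAlgebra k G) (L : LeftCoaction H.toQuasiBialgebra B)

/-- `(a ⊗ b) ⊗ φ ↦ (a ⊗ 1) Γ(φ) (1 ⊗ b)`, as it is computed in `M₁`. -/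
def muMap : CrossedSpace k G A B →ₗ[k] CrossedSpace k G A B :=
  spreadOf (LinearMap.mulLeft k (qMap H B L.phi⁻¹.val) ∘ₗ L.coact.toLinearMap)
    H.S.symm.toLinearMap

/-- The inverse of `muMap`. -/
def nuMap : CrossedSpace k G A B →ₗ[k] CrossedSpace k G A B :=
  spreadOf (LinearMap.mulRight k (pMap H B L.phi.val) ∘ₗ L.coact.toLinearMap) LinearMap.id

theorem muMap_tmul (a : A) (b : B) (φ : Module.Dual k G) : muMap H L ((a ⊗ₜ b) ⊗ₜ φ) =
    spread H.S.symm.toLinearMap ((a ⊗ₜ (qMap H B L.phi⁻¹.val * L.coact b)) ⊗ₜ φ) := rfl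

theorem nuMap_tmul (a : A) (b : B) (φ : Module.Dual k G) : nuMap H L ((a ⊗ₜ b) ⊗ₜ φ) =
    spread LinearMap.id ((a ⊗ₜ (L.coact b * pMap H B L.phi.val)) ⊗ₜ φ) := rfl

/-- Acting after `S⁻¹(g)`, the `G`-leg of `λ(t) p` is multiplied by `S⁻¹(g)` on the right, which is
how `pInsert` is built; `muMap_spread` plays the same role for `qInsert`. -/
theorem nuMap_spread (a : A) (w : G ⊗[k] B) (φ : Module.Dual k G) :
    nuMap H L (spread H.S.symm.toLinearMap ((a ⊗ₜ w) ⊗ₜ φ)) =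
      spread LinearMap.id ((a ⊗ₜ pInsert H L w) ⊗ₜ φ) := by
  induction w using induction₂ with
  | add s t hs ht => simp only [map_add, TensorProduct.tmul_add, TensorProduct.add_tmul, hs, ht]
  | tmul g t =>
    rw [spread_tmul, nuMap_tmul, pInsert_tmul]
    generalize L.coact t * pMap H B L.phi.val = w
    induction w using induction₂ with
    | add s t hs ht =>
      simp only [map_add, TensorProduct.tmul_add, TensorProduct.add_tmul, add_mul, hs, ht]
    | tmul g' t' =>
      simp only [spread_tmul, Algebra.TensorProduct.tmul_mul_tmul, leftHit_leftHit, mul_one]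
      rfl

theorem muMap_spread (a : A) (w : G ⊗[k] B) (φ : Module.Dual k G) :
    muMap H L (spread LinearMap.id ((a ⊗ₜ w) ⊗ₜ φ)) =
      spread H.S.symm.toLinearMap ((a ⊗ₜ qInsert H L w) ⊗ₜ φ) := by
  induction w using induction₂ with
  | add s t hs ht => simp only [map_add, TensorProduct.tmul_add, TensorProduct.add_tmul, hs, ht]
  | tmul g t =>
    rw [spread_tmul, muMap_tmul, qInsert_tmul]
    generalize qMap H B L.phi⁻¹.val * L.coact t = w
    induction w using induction₂ with
    | add s t hs ht =>
      simp only [map_add, TensorProduct.tmul_add, TensorProduct.add_tmul, mul_add, hs, ht]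
    | tmul g' t' =>
      simp only [spread_tmul, Algebra.TensorProduct.tmul_mul_tmul, leftHit_leftHit, one_mul,
        LinearEquiv.coe_coe, H.S_symm_mul, LinearEquiv.symm_apply_apply, LinearMap.id_apply]

theorem spread_one (σ : G →ₗ[k] G) (hσ : σ 1 = 1) (a : A) (b : B) (φ : Module.Dual k G) :
    spread σ ((a ⊗ₜ ((1 : G) ⊗ₜ b)) ⊗ₜ φ) = (a ⊗ₜ b) ⊗ₜ φ := by
  rw [spread_tmul, hσ, leftHit_one]

variable (A) in
/-- `muMap` as a linear bijection. -/
def muEquiv : CrossedSpace k G A B ≃ₗ[k] CrossedSpace k G A B :=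
  LinearEquiv.ofLinearMap (muMap H L) (nuMap H L)
    (by
      refine LinearMap.ext fun X => ?_
      induction X using induction₂ with
      | add s t hs ht => simp only [map_add, hs, ht]
      | tmul x φ =>
      induction x using induction₂ with
      | add s t hs ht => simp only [map_add, TensorProduct.add_tmul, hs, ht]
      | tmul a b =>
      rw [LinearMap.comp_apply, nuMap_tmul, muMap_spread, qInsert_coact_mul, qInsert_pMap, mul_one,
        spread_one _ H.S_symm_one, LinearMap.id_apply])
    (by
      refine LinearMap.ext fun X => ?_
      induction X using induction₂ with
      | add s t hs ht => simp only [map_add, hs, ht]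
      | tmul x φ =>
      induction x using induction₂ with
      | add s t hs ht => simp only [map_add, TensorProduct.add_tmul, hs, ht]
      | tmul a b =>
      rw [LinearMap.comp_apply, muMap_tmul, nuMap_spread, pInsert_mul_coact, pInsert_qMap, one_mul,
        spread_one _ rfl, LinearMap.id_apply])

theorem muEquiv_tmul (a : A) (b : B) (φ : Module.Dual k G) : muEquiv A H L ((a ⊗ₜ b) ⊗ₜ φ) =
    spread H.S.symm.toLinearMap ((a ⊗ₜ (qMap H B L.phi⁻¹.val * L.coact b)) ⊗ₜ φ) := rfl

end Spread

/-! ### The diagonal product transported along the bijection -/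

section Multiplicative

variable {k G A B : Type*} [Field k] [Ring G] [Algebra k G] [Ring A] [Algebra k A]
  [Ring B] [Algebra k B] (H : QuasiHopfAlgebra k G)

theorem untwist_antiFlip {T : Type*} [Ring T] [Algebra k T] (m : G ⊗[k] G) (t : T) :
    untwist H T (Algebra.TensorProduct.assoc k k k G G T (antiFlip H m ⊗ₜ[k] t)) =
      Algebra.TensorProduct.assoc k k k G G T (m ⊗ₜ[k] t) := by
  induction m using induction₂ with
  | add s t hs ht => simp only [map_add, TensorProduct.add_tmul, hs, ht]
  | tmul x y => simp [antiFlip_tmul, untwist_tmul]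

variable [FiniteDimensional k G] (R : RightCoaction H.toQuasiBialgebra A)
  (L : LeftCoaction H.toQuasiBialgebra B)

/-- The module algebra rule `g ⇀ (χ χ') = (g₁ ⇀ χ)(g₂ ⇀ χ')`, from multiplicativity of `Δ`. -/
theorem dualPair_mul_comul (Q : QuasiBialgebra k G) (φ ψ : Module.Dual k G) (u₁ : A)
    (u₂ u₃ v₁ v₂ g : G) (v₃ : B) :
    dualPair Q φ ψ (u₁ ⊗ₜ (u₂ ⊗ₜ u₃)) (Algebra.TensorProduct.assoc k k k G G B
      ((Q.comul g * (v₁ ⊗ₜ v₂)) ⊗ₜ[k] v₃)) =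
      (u₁ ⊗ₜ v₃) ⊗ₜ leftHit g
        (dualMul Q (leftHit v₁ (rightHit u₂ φ)) (leftHit v₂ (rightHit u₃ ψ))) := by
  apply (evalEquiv k G (A ⊗[k] B)).injective
  ext x
  rw [evalEquiv_dualPair, evalEquiv_tmul, leftHit_apply, dualMul_apply, map_mul Q.comul]
  generalize Q.comul x = m
  generalize Q.comul g = n
  induction m using induction₂ with
  | add s t hs ht => simp only [map_add, add_mul, mul_add, add_smul, hs, ht]
  | tmul c d =>
  induction n using induction₂ with
  | add s t hs ht =>
    simp only [map_add, add_mul, mul_add, add_smul, TensorProduct.add_tmul, hs, ht]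
  | tmul c' d' =>
    simp [midLegs_tmul, padRight_tmul, padLeft_apply, evalPair_tmul, mul_assoc]

theorem spread_dualMul (φ ψ : Module.Dual k G) (u₁ : A) (u₂ u₃ v₁ v₂ : G) (w : G ⊗[k] B) :
    spread H.S.symm.toLinearMap ((u₁ ⊗ₜ w) ⊗ₜ dualMul H.toQuasiBialgebra
      (leftHit v₁ (rightHit u₂ φ)) (leftHit v₂ (rightHit u₃ ψ))) =
    dualPair H.toQuasiBialgebra φ ψ (u₁ ⊗ₜ (u₂ ⊗ₜ u₃))
      (untwist H B (twistedInsert H v₁ v₂ w)) := by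
  induction w using induction₂ with
  | add s t hs ht => simp only [map_add, TensorProduct.tmul_add, TensorProduct.add_tmul,
      dualPair_add_right, hs, ht]
  | tmul g t =>
    rw [spread_tmul, twistedInsert_tmul, antiComul_apply, ← antiFlip_mul, untwist_antiFlip,
      dualPair_mul_comul]
    rfl

/-- The left action of `S⁻¹(g)` on a product in `Ĝ` involves `Δ(S⁻¹(g))`. `twistedMap` is the form
this takes after stripping `untwist`, so it can be compared with `crossedMul_spread`. -/
theorem muEquiv_dualPair (φ ψ : Module.Dual k G) (u : A ⊗[k] (G ⊗[k] G))
    (v : G ⊗[k] (G ⊗[k] B)) : muEquiv A H L (dualPair H.toQuasiBialgebra φ ψ u v) =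
      dualPair H.toQuasiBialgebra φ ψ u (untwist H B (twistedMap H L v)) := by
  induction u using induction₃ with
  | add s t hs ht => simp only [dualPair_add_left, map_add, hs, ht]
  | tmul u₁ u₂ u₃ =>
  induction v using induction₃ with
  | add s t hs ht => simp only [dualPair_add_right, map_add, hs, ht]
  | tmul v₁ v₂ v₃ => rw [dualPair_tmul, muEquiv_tmul, twistedMap_tmul, spread_dualMul]

theorem crossedMul_spread (a a' : A) (w w' : G ⊗[k] B) (φ ψ : Module.Dual k G) :
    crossedMul R L (spread H.S.symm.toLinearMap ((a ⊗ₜ w) ⊗ₜ φ))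
        (spread H.S.symm.toLinearMap ((a' ⊗ₜ w') ⊗ₜ ψ)) =
      dualPair H.toQuasiBialgebra φ ψ (leftFactor R a a')
        (untwist H B (padLeft G w * onRight G L.coact w' * L.phi.val * twistPad H B)) := by
  induction w using induction₂ with
  | add s t hs ht => simp only [map_add, TensorProduct.tmul_add, TensorProduct.add_tmul, add_mul,
      LinearMap.add_apply, dualPair_add_right, hs, ht]
  | tmul g t =>
  induction w' using induction₂ with
  | add s t hs ht => simp only [map_add, TensorProduct.tmul_add, TensorProduct.add_tmul, add_mul,
      mul_add, dualPair_add_right, hs, ht]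
  | tmul g' t' =>
    have e : padLeft G (g ⊗ₜ[k] t) * onRight G L.coact (g' ⊗ₜ[k] t') =
        (g' ⊗ₜ[k] (g ⊗ₜ[k] (1 : B))) * (padLeft G (padLeft G t) * padLeft G (L.coact t')) := by
      rw [onRight_tmul]
      generalize L.coact t' = w
      induction w using induction₂ with
      | add s t hs ht => simp only [TensorProduct.tmul_add, map_add, mul_add, hs, ht]
      | tmul x y => simp [padLeft_apply]
    rw [spread_tmul, spread_tmul, crossedMul_tmul, dualPair_leftHit, e,
      mul_assoc (g' ⊗ₜ[k] (g ⊗ₜ[k] (1 : B))) _ L.phi.val,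
      mul_assoc (g' ⊗ₜ[k] (g ⊗ₜ[k] (1 : B))) _ (twistPad H B), untwist_mul]
    rfl

/-- Both sides are `dualPair` with the same `leftFactor`; the `B`-sides agree by
`twistedMap_inv_mul`. -/
theorem crossedMul_muEquiv (a a' : A) (b b' : B) (φ ψ : Module.Dual k G) :
    crossedMul R L (muEquiv A H L ((a ⊗ₜ b) ⊗ₜ φ)) (muEquiv A H L ((a' ⊗ₜ b') ⊗ₜ ψ)) =
      muEquiv A H L (dualPair H.toQuasiBialgebra φ ψ (leftFactor R a a')
        (L.phi⁻¹.val * padLeft G (L.coact b * (1 ⊗ₜ b')))) := by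
  rw [muEquiv_dualPair, twistedMap_inv_mul, muEquiv_tmul, muEquiv_tmul, crossedMul_spread]

end Multiplicative

/-! ### Inverted axioms of a right coaction -/

section CoactionInverses

variable {k G A B : Type*} [Field k] [Ring G] [Algebra k G] [Ring A] [Algebra k A]
  [Ring B] [Algebra k B] {Q : QuasiBialgebra k G}

theorem RightCoaction.coassoc_inv (R : RightCoaction Q A) (a : A) :
    R.phi⁻¹.val * onRight A Q.comul (R.coact a) =
      splitLeft G R.coact (R.coact a) * R.phi⁻¹.val := by
  rw [Units.inv_mul_eq_iff_eq_mul, ← mul_assoc, Units.eq_mul_inv_iff_mul_eq, R.quasi_coassoc]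

/-- `(φ_ρ⁻¹ ⊗ 1) (id ⊗ Δ ⊗ id)(φ_ρ⁻¹) = (ρ ⊗ id ⊗ id)(φ_ρ⁻¹) (id ⊗ id ⊗ Δ)(φ_ρ⁻¹) (1 ⊗ φ)` -/
theorem RightCoaction.pentagon_inv (R : RightCoaction Q A) :
    padRight G R.phi⁻¹.val * onRight A (splitLeft G Q.comul) R.phi⁻¹.val =
      splitLeft (G ⊗[k] G) R.coact R.phi⁻¹.val * onRight A (onRight G Q.comul) R.phi⁻¹.val *
        padLeft A Q.phi.val := by
  let P := splitLeft (G ⊗[k] G) R.coact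
  let C := onRight A (onRight G Q.comul)
  let D := onRight A (splitLeft G Q.comul)
  let E : A ⊗[k] (G ⊗[k] G) →ₐ[k] A ⊗[k] (G ⊗[k] (G ⊗[k] G)) := padRight G
  change E R.phi⁻¹.val * D R.phi⁻¹.val = P R.phi⁻¹.val * C R.phi⁻¹.val * padLeft A Q.phi.val
  have h : padLeft A Q.phi.val * D R.phi.val * E R.phi.val = C R.phi.val * P R.phi.val :=
    R.pentagon
  calc E R.phi⁻¹.val * D R.phi⁻¹.val
      = P R.phi⁻¹.val * (C R.phi⁻¹.val * C R.phi.val) * P R.phi.val *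
          (E R.phi⁻¹.val * D R.phi⁻¹.val) := by
        rw [map_inv_mul_map, mul_one, map_inv_mul_map, one_mul]
    _ = P R.phi⁻¹.val * C R.phi⁻¹.val * (C R.phi.val * P R.phi.val) *
          (E R.phi⁻¹.val * D R.phi⁻¹.val) := by simp only [mul_assoc]
    _ = P R.phi⁻¹.val * C R.phi⁻¹.val * (padLeft A Q.phi.val *
          (D R.phi.val * (E R.phi.val * E R.phi⁻¹.val) * D R.phi⁻¹.val)) := by
        rw [← h]; simp only [mul_assoc]
    _ = _ := by rw [map_mul_map_inv, mul_one, map_mul_map_inv, mul_one]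

end CoactionInverses

/-! ### Associativity of the two-sided product -/

section Associativity

variable {k G A B : Type*} [Field k] [Ring G] [Algebra k G] [Ring A] [Algebra k A]
  [Ring B] [Algebra k B]

/-- `a ⊗ g ⊗ h ⊗ l ⊗ b ↦ φ(g) ψ(h) χ(l) a ⊗ b`. -/
def evalTriple (A B : Type*) [Ring A] [Algebra k A] [Ring B] [Algebra k B]
    (φ ψ χ : Module.Dual k G) : A ⊗[k] (G ⊗[k] (G ⊗[k] (G ⊗[k] B))) →ₗ[k] A ⊗[k] B :=
  LinearMap.lTensor A (dualContract χ ∘ₗ dualContract ψ ∘ₗ dualContract φ)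

theorem evalTriple_tmul (φ ψ χ : Module.Dual k G) (a : A) (g h l : G) (b : B) :
    evalTriple A B φ ψ χ (a ⊗ₜ (g ⊗ₜ (h ⊗ₜ (l ⊗ₜ b)))) = (φ g * ψ h * χ l) • (a ⊗ₜ b) := by
  simp [evalTriple, dualContract_tmul, smul_smul]

theorem evalPair_dualMul_left (Q : QuasiBialgebra k G) (φ ψ χ : Module.Dual k G)
    (g h g' h' : G) (w : A ⊗[k] (G ⊗[k] (G ⊗[k] B))) :
    evalPair A B (dualMul Q (leftHit g' (rightHit g φ)) (leftHit h' (rightHit h ψ))) χ w =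
      evalTriple A B φ ψ χ ((1 ⊗ₜ[k] (g ⊗ₜ[k] (h ⊗ₜ[k] 1))) *
        onRight A (splitLeft (G ⊗[k] B) Q.comul) w *
        (1 ⊗ₜ[k] (g' ⊗ₜ[k] (h' ⊗ₜ[k] 1)))) := by
  induction w using induction₄ with
  | add s t hs ht => simp only [map_add, mul_add, add_mul, hs, ht]
  | tmul a x y b =>
    rw [evalPair_tmul, onRight_tmul, splitLeft_tmul, dualMul_apply]
    generalize Q.comul x = m
    induction m using induction₂ with
    | add s t hs ht =>
      simp only [map_add, mul_add, add_mul, add_smul, TensorProduct.add_tmul,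
        TensorProduct.tmul_add, hs, ht]
    | tmul c d => simp [Algebra.TensorProduct.one_def, evalTriple_tmul, mul_assoc]

theorem evalPair_dualMul_right (Q : QuasiBialgebra k G) (φ ψ χ : Module.Dual k G)
    (g h g' h' : G) (w : A ⊗[k] (G ⊗[k] (G ⊗[k] B))) :
    evalPair A B φ (dualMul Q (leftHit g' (rightHit g ψ)) (leftHit h' (rightHit h χ))) w =
      evalTriple A B φ ψ χ ((1 ⊗ₜ[k] (1 ⊗ₜ[k] (g ⊗ₜ[k] (h ⊗ₜ[k] 1)))) *
        onRight A (onRight G (splitLeft B Q.comul)) w *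
        (1 ⊗ₜ[k] (1 ⊗ₜ[k] (g' ⊗ₜ[k] (h' ⊗ₜ[k] 1))))) := by
  induction w using induction₄ with
  | add s t hs ht => simp only [map_add, mul_add, add_mul, hs, ht]
  | tmul a x y b =>
    rw [evalPair_tmul, onRight_tmul, onRight_tmul, splitLeft_tmul, dualMul_apply]
    generalize Q.comul y = m
    induction m using induction₂ with
    | add s t hs ht =>
      simp only [map_add, mul_add, add_mul, add_smul, TensorProduct.add_tmul,
        TensorProduct.tmul_add, hs, ht]
    | tmul c d => simp [evalTriple_tmul, mul_assoc]

/-- `x ↦ x ⊗ 1`, on four legs. -/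
def padLast (k G A B : Type*) [Field k] [Ring G] [Algebra k G] [Ring A] [Algebra k A]
    [Ring B] [Algebra k B] : A ⊗[k] (G ⊗[k] (G ⊗[k] G)) →ₐ[k] A ⊗[k] (G ⊗[k] (G ⊗[k] (G ⊗[k] B))) :=
  onRight A (padRight B)

variable {Q : QuasiBialgebra k G} (R : RightCoaction Q A) (L : LeftCoaction Q B)

/-- `φ_λ⁻¹ (1 ⊗ λ(b)) (1 ⊗ 1 ⊗ b')` -/
def rightFactor (b b' : B) : G ⊗[k] (G ⊗[k] B) :=
  L.phi⁻¹.val * padLeft G (L.coact b * (1 ⊗ₜ b'))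

theorem leftFactor_mul (a a' a'' : A) :
    leftFactor R (a * a') a'' = (a ⊗ₜ 1) * leftFactor R a' a'' := by
  simp only [leftFactor, ← mul_assoc, Algebra.TensorProduct.tmul_mul_tmul, mul_one]

/-- The `A`-part of associativity: coassociativity of `ρ` and the pentagon of `φ_ρ` compare the two
bracketings, at the cost of a factor `φ` on the right. -/
theorem leftFactor_split (a a' a'' : A) :
    padRight G (leftFactor R a a') * onRight A (splitLeft G Q.comul) (leftFactor R 1 a'') =
      (a ⊗ₜ 1) * splitLeft (G ⊗[k] G) R.coact (leftFactor R a' a'') *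
        onRight A (onRight G Q.comul) R.phi⁻¹.val * padLeft A Q.phi.val := by
  let P := splitLeft (G ⊗[k] G) R.coact
  let C := onRight A (onRight G Q.comul)
  let D := onRight A (splitLeft G Q.comul)
  let E : A ⊗[k] (G ⊗[k] G) →ₐ[k] A ⊗[k] (G ⊗[k] (G ⊗[k] G)) := padRight G
  let I : A ⊗[k] G →ₐ[k] A ⊗[k] (G ⊗[k] G) := onRight A Algebra.TensorProduct.includeLeft
  change E ((a ⊗ₜ 1) * I (R.coact a') * R.phi⁻¹.val) *
    D ((1 : A ⊗[k] (G ⊗[k] G)) * I (R.coact a'') * R.phi⁻¹.val) =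
    (a ⊗ₜ 1) * P ((a' ⊗ₜ 1) * I (R.coact a'') * R.phi⁻¹.val) * C R.phi⁻¹.val * padLeft A Q.phi.val
  have pent : E R.phi⁻¹.val * D R.phi⁻¹.val =
    P R.phi⁻¹.val * C R.phi⁻¹.val * padLeft A Q.phi.val := R.pentagon_inv
  have h₁ : ∀ w, D (I w) = E (onRight A Q.comul w) := by
    intro w
    induction w using induction₂ with
    | add s t hs ht => simp only [map_add, hs, ht]
    | tmul x y =>
      change x ⊗ₜ[k] Algebra.TensorProduct.assoc k k k G G G (Q.comul y ⊗ₜ[k] (1 : G)) =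
        E (x ⊗ₜ[k] Q.comul y)
      generalize Q.comul y = m
      induction m using induction₂ with
      | add s t hs ht =>
        simp only [map_add, TensorProduct.add_tmul, TensorProduct.tmul_add, hs, ht]
      | tmul c d => rfl
  have h₂ : ∀ w, P (I w) = E (splitLeft G R.coact w) := splitLeft_onRight _ _
  have h₃ : E (I (R.coact a')) = P (a' ⊗ₜ 1) := by
    change E (I (R.coact a')) =
      Algebra.TensorProduct.assoc k k k A G (G ⊗[k] G) (R.coact a' ⊗ₜ[k] (1 : G ⊗[k] G))
    generalize R.coact a' = m
    induction m using induction₂ with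
    | add s t hs ht => simp only [map_add, TensorProduct.add_tmul, hs, ht]
    | tmul c d => rfl
  have h₄ : E (a ⊗ₜ 1) = a ⊗ₜ 1 := rfl
  calc E ((a ⊗ₜ 1) * I (R.coact a') * R.phi⁻¹.val) *
        D ((1 : A ⊗[k] (G ⊗[k] G)) * I (R.coact a'') * R.phi⁻¹.val)
      = E (a ⊗ₜ 1) * E (I (R.coact a')) * E (R.phi⁻¹.val * onRight A Q.comul (R.coact a'')) *
          D R.phi⁻¹.val := by
        rw [one_mul, map_mul E, map_mul E, map_mul D, h₁, map_mul E]; simp only [mul_assoc]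
    _ = E (a ⊗ₜ 1) * E (I (R.coact a')) * E (splitLeft G R.coact (R.coact a'')) *
          (E R.phi⁻¹.val * D R.phi⁻¹.val) := by
        rw [R.coassoc_inv, map_mul E]; simp only [mul_assoc]
    _ = _ := by
        rw [pent, h₄, h₃, ← h₂, map_mul P, map_mul P]; simp only [mul_assoc]

/-- The `B`-part of associativity. The defect is a `φ` on the left, matching the one in
`leftFactor_split`. -/
theorem rightFactor_split (b b' b'' : B) :
    padRight B Q.phi.val * (splitLeft (G ⊗[k] B) Q.comul L.phi⁻¹.val *
      onRight G (onRight G L.coact) (rightFactor L b b') * (1 ⊗ₜ (1 ⊗ₜ (1 ⊗ₜ b'')))) =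
    onRight G (splitLeft B Q.comul) L.phi⁻¹.val * padLeft G (splitLeft B Q.comul (L.coact b)) *
      padLeft G (rightFactor L b' b'') := by
  let F : G ⊗[k] (G ⊗[k] G) →ₐ[k] G ⊗[k] (G ⊗[k] (G ⊗[k] B)) := padRight B
  have pent : F Q.phi⁻¹.val * onRight G (splitLeft B Q.comul) L.phi⁻¹.val *
      padLeft G L.phi⁻¹.val =
    splitLeft (G ⊗[k] B) Q.comul L.phi⁻¹.val * onRight G (onRight G L.coact) L.phi⁻¹.val :=
    L.pentagon_inv
  change F Q.phi.val * _ = _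
  have h₁ : onRight G (onRight G L.coact) (padLeft G (L.coact b * (1 ⊗ₜ b'))) =
      padLeft G (onRight G L.coact (L.coact b)) * padLeft G (padLeft G (L.coact b')) := by
    rw [← map_mul (padLeft G)]
    change padLeft G (onRight G L.coact (L.coact b * (1 ⊗ₜ b'))) = _
    rw [map_mul (onRight _ _)]; rfl
  rw [rightFactor, rightFactor, map_mul (onRight _ _), h₁,
    ← mul_assoc (splitLeft (G ⊗[k] B) Q.comul _), ← pent]
  simp only [← mul_assoc]
  rw [map_mul_map_inv, one_mul, mul_assoc (onRight G (splitLeft B Q.comul) _),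
    ← map_mul (padLeft G), L.coassoc_inv]
  simp only [map_mul (padLeft G), mul_assoc]
  rfl

variable (A B) in
theorem onRight_split_padRight_eq_padLast (s : A ⊗[k] (G ⊗[k] G)) :
    onRight A (splitLeft (G ⊗[k] B) Q.comul) (padRight B s) =
      padLast k G A B (onRight A (splitLeft G Q.comul) s) := by
  induction s using induction₃ with
  | add s t hs ht => simp only [map_add, hs, ht]
  | tmul a g h =>
    change a ⊗ₜ[k] Algebra.TensorProduct.assoc k k k G G (G ⊗[k] B)
        (Q.comul g ⊗ₜ[k] (h ⊗ₜ[k] (1 : B))) = padLast k G A B (a ⊗ₜ[k]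
          Algebra.TensorProduct.assoc k k k G G G (Q.comul g ⊗ₜ[k] h))
    generalize Q.comul g = m
    induction m using induction₂ with
    | add s t hs ht =>
      simp only [map_add, TensorProduct.add_tmul, TensorProduct.tmul_add, hs, ht]
    | tmul c d => rfl

variable (A B) in
theorem onRight_split_midLegs (m : G ⊗[k] G) :
    onRight A (splitLeft (G ⊗[k] B) Q.comul) (midLegs A B m) =
      padLast k G A B (padLeft A (splitLeft G Q.comul m)) := by
  induction m using induction₂ with
  | add s t hs ht => simp only [map_add, hs, ht]
  | tmul c d => exact onRight_split_padRight_eq_padLast A B ((1 : A) ⊗ₜ (c ⊗ₜ d))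

variable (A B) in
theorem onRight_onRight_padRight_eq_padLast (s : A ⊗[k] (G ⊗[k] G)) :
    onRight A (onRight G (splitLeft B Q.comul)) (padRight B s) =
      padLast k G A B (onRight A (onRight G Q.comul) s) := by
  induction s using induction₃ with
  | add s t hs ht => simp only [map_add, hs, ht]
  | tmul a g h =>
    change a ⊗ₜ[k] (g ⊗ₜ[k] Algebra.TensorProduct.assoc k k k G G B
        (Q.comul h ⊗ₜ[k] (1 : B))) = padLast k G A B (a ⊗ₜ[k] (g ⊗ₜ[k] Q.comul h))
    generalize Q.comul h = m
    induction m using induction₂ with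
    | add s t hs ht =>
      simp only [map_add, TensorProduct.add_tmul, TensorProduct.tmul_add, hs, ht]
    | tmul c d => rfl

variable (A B) in
theorem onRight_onRight_midLegs (m : G ⊗[k] G) :
    onRight A (onRight G (splitLeft B Q.comul)) (midLegs A B m) =
      padLast k G A B (padLeft A (onRight G Q.comul m)) := by
  induction m using induction₂ with
  | add s t hs ht => simp only [map_add, hs, ht]
  | tmul c d => exact onRight_onRight_padRight_eq_padLast A B ((1 : A) ⊗ₜ (c ⊗ₜ d))

variable (B) in
theorem tmul_mul_split_leftFactor (u₁ a'' : A) (u₂ u₃ : G) :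
    ((1 : A) ⊗ₜ[k] (u₂ ⊗ₜ[k] (u₃ ⊗ₜ[k] (1 : G ⊗[k] B)))) *
        padLast k G A B (onRight A (splitLeft G Q.comul) (leftFactor R u₁ a'')) =
      padLast k G A B (padRight G (u₁ ⊗ₜ[k] (u₂ ⊗ₜ[k] u₃)) *
        onRight A (splitLeft G Q.comul) (leftFactor R 1 a'')) := by
  have e : ((1 : A) ⊗ₜ[k] (u₂ ⊗ₜ[k] (u₃ ⊗ₜ[k] (1 : G ⊗[k] B)))) =
      padLast k G A B ((1 : A) ⊗ₜ[k] (u₂ ⊗ₜ[k] (u₃ ⊗ₜ[k] (1 : G)))) := rfl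
  rw [e, ← map_mul (padLast k G A B), ← mul_one u₁, leftFactor_mul, mul_one,
    map_mul (onRight _ _), ← mul_assoc, onRight_tmul, map_one, padRight_tmul,
    Algebra.TensorProduct.tmul_mul_tmul, one_mul, mul_one]

theorem split_rightFactor_mul_tmul (v₃ b'' : B) (v₁ v₂ : G) :
    splitLeft (G ⊗[k] B) Q.comul (rightFactor L v₃ b'') *
        (v₁ ⊗ₜ[k] (v₂ ⊗ₜ[k] (1 : G ⊗[k] B))) =
      splitLeft (G ⊗[k] B) Q.comul L.phi⁻¹.val *
        onRight G (onRight G L.coact) (v₁ ⊗ₜ[k] (v₂ ⊗ₜ[k] v₃)) * (1 ⊗ₜ (1 ⊗ₜ (1 ⊗ₜ b''))) := by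
  have h : ∀ w : G ⊗[k] B,
      splitLeft (G ⊗[k] B) Q.comul (padLeft G w) = (1 : G) ⊗ₜ[k] ((1 : G) ⊗ₜ[k] w) := by
    intro w
    rw [padLeft_apply, splitLeft_tmul, map_one]; rfl
  rw [rightFactor, map_mul (splitLeft _ _), h, mul_assoc, mul_assoc, onRight_tmul, onRight_tmul]
  simp only [Algebra.TensorProduct.tmul_mul_tmul, one_mul, mul_one]

variable (B) in
theorem tmul_mul_onRight_leftFactor (a u₁ : A) (u₂ u₃ : G) :
    ((1 : A) ⊗ₜ[k] ((1 : G) ⊗ₜ[k] (u₂ ⊗ₜ[k] (u₃ ⊗ₜ[k] (1 : B))))) *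
        padLast k G A B (onRight A (onRight G Q.comul) (leftFactor R a u₁)) =
      padLast k G A B ((a ⊗ₜ 1) * splitLeft (G ⊗[k] G) R.coact (u₁ ⊗ₜ[k] (u₂ ⊗ₜ[k] u₃)) *
        onRight A (onRight G Q.comul) R.phi⁻¹.val) := by
  have e : ((1 : A) ⊗ₜ[k] ((1 : G) ⊗ₜ[k] (u₂ ⊗ₜ[k] (u₃ ⊗ₜ[k] (1 : B))))) =
      padLast k G A B ((1 : A) ⊗ₜ[k] ((1 : G) ⊗ₜ[k] (u₂ ⊗ₜ[k] u₃))) := rfl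
  rw [e, ← map_mul (padLast k G A B), leftFactor, map_mul (onRight _ _), ← mul_assoc]
  congr 2
  rw [splitLeft_tmul]
  generalize R.coact u₁ = m
  induction m using induction₂ with
  | add s t hs ht => simp only [map_add, mul_add, TensorProduct.add_tmul, hs, ht]
  | tmul c d =>
    simp only [onRight_tmul, Algebra.TensorProduct.tmul_mul_tmul, assoc_tmul, one_mul, mul_one,
      Algebra.TensorProduct.includeLeft_apply, Algebra.TensorProduct.one_def, map_one]

theorem onRight_rightFactor_mul_tmul (b v₃ : B) (v₁ v₂ : G) :
    onRight G (splitLeft B Q.comul) (rightFactor L b v₃) *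
        ((1 : G) ⊗ₜ[k] (v₁ ⊗ₜ[k] (v₂ ⊗ₜ[k] (1 : B)))) =
      onRight G (splitLeft B Q.comul) L.phi⁻¹.val *
        padLeft G (splitLeft B Q.comul (L.coact b)) * padLeft G (v₁ ⊗ₜ[k] (v₂ ⊗ₜ[k] v₃)) := by
  have h : ∀ w : G ⊗[k] B,
      onRight G (splitLeft B Q.comul) (padLeft G w) = padLeft G (splitLeft B Q.comul w) :=
    fun w => rfl
  rw [rightFactor, map_mul (onRight _ _), h, mul_assoc, mul_assoc,
    ← padLeft_apply (W := G) (v₁ ⊗ₜ[k] (v₂ ⊗ₜ[k] (1 : B))), ← map_mul (padLeft G),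
    ← map_mul (padLeft G), map_mul (splitLeft _ _), mul_assoc, splitLeft_tmul, map_one]
  simp only [Algebra.TensorProduct.one_def, assoc_tmul, Algebra.TensorProduct.tmul_mul_tmul,
    one_mul, mul_one]

/-- Between the `A`-part and the `B`-part sits an iterated coproduct of `x`; carrying `φ` across it
changes its bracketing. -/
theorem padLast_quasi_coassoc (U : A ⊗[k] (G ⊗[k] (G ⊗[k] G)))
    (V : G ⊗[k] (G ⊗[k] (G ⊗[k] B))) (x : G) :
    padLast k G A B (U * padLeft A Q.phi.val * padLeft A (splitLeft G Q.comul (Q.comul x))) *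
        padLeft A V =
      padLast k G A B (U * padLeft A (onRight G Q.comul (Q.comul x))) *
        padLeft A (padRight B Q.phi.val * V) := by
  rw [mul_assoc U, ← map_mul (padLeft A), ← Q.quasi_coassoc, map_mul (padLeft A),
    map_mul (padLeft A), ← mul_assoc U, map_mul (padLast k G A B), mul_assoc]
  rfl

variable [FiniteDimensional k G] (H : QuasiHopfAlgebra k G)
  (R : RightCoaction H.toQuasiBialgebra A) (L : LeftCoaction H.toQuasiBialgebra B)

/-- The product of `M₁` transported along `muEquiv`. -/
def starMul : CrossedSpace k G A B →ₗ[k] CrossedSpace k G A B →ₗ[k] CrossedSpace k G A B :=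
  ((crossedMul R L).compl₁₂ (muEquiv A H L).toLinearMap (muEquiv A H L).toLinearMap).compr₂
    (muEquiv A H L).symm.toLinearMap

theorem starMul_apply (X Y : CrossedSpace k G A B) : starMul H R L X Y =
    (muEquiv A H L).symm (crossedMul R L (muEquiv A H L X) (muEquiv A H L Y)) := rfl

theorem starMul_tmul (a a' : A) (b b' : B) (φ ψ : Module.Dual k G) :
    starMul H R L ((a ⊗ₜ b) ⊗ₜ φ) ((a' ⊗ₜ b') ⊗ₜ ψ) =
      dualPair H.toQuasiBialgebra φ ψ (leftFactor R a a') (rightFactor L b b') := by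
  rw [starMul_apply, crossedMul_muEquiv, LinearEquiv.symm_apply_apply, rightFactor]

theorem starMul_dualPair_left (a'' : A) (b'' : B) (φ ψ χ : Module.Dual k G)
    (u : A ⊗[k] (G ⊗[k] G)) (v : G ⊗[k] (G ⊗[k] B)) (x : G) :
    evalEquiv k G (A ⊗[k] B)
        (starMul H R L (dualPair H.toQuasiBialgebra φ ψ u v) ((a'' ⊗ₜ b'') ⊗ₜ χ)) x =
      evalTriple A B φ ψ χ (padLast k G A B (padRight G u *
          onRight A (splitLeft G H.comul) (leftFactor R 1 a'') *
          padLeft A (splitLeft G H.comul (H.comul x))) *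
        padLeft A (splitLeft (G ⊗[k] B) H.comul L.phi⁻¹.val * onRight G (onRight G L.coact) v *
          (1 ⊗ₜ (1 ⊗ₜ (1 ⊗ₜ b''))))) := by
  induction u using induction₃ with
  | add s t hs ht =>
    simp only [dualPair_add_left, map_add, add_mul, LinearMap.add_apply, hs, ht]
  | tmul u₁ u₂ u₃ =>
  induction v using induction₃ with
  | add s t hs ht =>
    simp only [dualPair_add_right, map_add, add_mul, mul_add, LinearMap.add_apply, hs, ht]
  | tmul v₁ v₂ v₃ =>
  have h : onRight A (splitLeft (G ⊗[k] B) H.comul) (padLeft A (rightFactor L v₃ b'')) *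
      ((1 : A) ⊗ₜ[k] (v₁ ⊗ₜ[k] (v₂ ⊗ₜ[k] (1 : G ⊗[k] B)))) =
      padLeft A (splitLeft (G ⊗[k] B) H.comul (rightFactor L v₃ b'') *
        (v₁ ⊗ₜ[k] (v₂ ⊗ₜ[k] (1 : G ⊗[k] B)))) := by rw [map_mul (padLeft A)]; rfl
  rw [dualPair_tmul, starMul_tmul, evalEquiv_dualPair, evalPair_dualMul_left,
    map_mul (onRight _ _), map_mul (onRight _ _), onRight_split_padRight_eq_padLast,
    onRight_split_midLegs, ← mul_assoc, ← mul_assoc, tmul_mul_split_leftFactor, mul_assoc, h,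
    split_rightFactor_mul_tmul, ← map_mul (padLast k G A B)]

theorem starMul_dualPair_right (a : A) (b : B) (φ ψ χ : Module.Dual k G)
    (u : A ⊗[k] (G ⊗[k] G)) (v : G ⊗[k] (G ⊗[k] B)) (x : G) :
    evalEquiv k G (A ⊗[k] B)
        (starMul H R L ((a ⊗ₜ b) ⊗ₜ φ) (dualPair H.toQuasiBialgebra ψ χ u v)) x =
      evalTriple A B φ ψ χ (padLast k G A B ((a ⊗ₜ 1) * splitLeft (G ⊗[k] G) R.coact u *
          onRight A (onRight G H.comul) R.phi⁻¹.val *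
          padLeft A (onRight G H.comul (H.comul x))) *
        padLeft A (onRight G (splitLeft B H.comul) L.phi⁻¹.val *
          padLeft G (splitLeft B H.comul (L.coact b)) * padLeft G v)) := by
  induction u using induction₃ with
  | add s t hs ht =>
    simp only [dualPair_add_left, map_add, add_mul, mul_add, LinearMap.add_apply, hs, ht]
  | tmul u₁ u₂ u₃ =>
  induction v using induction₃ with
  | add s t hs ht =>
    simp only [dualPair_add_right, map_add, LinearMap.add_apply, mul_add, hs, ht]
  | tmul v₁ v₂ v₃ =>
  have h : onRight A (onRight G (splitLeft B H.comul)) (padLeft A (rightFactor L b v₃)) *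
      ((1 : A) ⊗ₜ[k] ((1 : G) ⊗ₜ[k] (v₁ ⊗ₜ[k] (v₂ ⊗ₜ[k] (1 : B))))) =
      padLeft A (onRight G (splitLeft B H.comul) (rightFactor L b v₃) *
        ((1 : G) ⊗ₜ[k] (v₁ ⊗ₜ[k] (v₂ ⊗ₜ[k] (1 : B))))) := by rw [map_mul (padLeft A)]; rfl
  rw [dualPair_tmul, starMul_tmul, evalEquiv_dualPair, evalPair_dualMul_right,
    map_mul (onRight _ _), map_mul (onRight _ _), onRight_onRight_padRight_eq_padLast,
    onRight_onRight_midLegs, ← mul_assoc, ← mul_assoc, tmul_mul_onRight_leftFactor, mul_assoc, h,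
    onRight_rightFactor_mul_tmul, ← map_mul (padLast k G A B)]

/-- At `x`, both sides are `φ ⊗ ψ ⊗ χ` applied to an `A`-part, an iterated coproduct of `x` and a
`B`-part. The `φ` released by the `A`-part rebrackets the coproduct and is absorbed by the `B`-part.
-/
theorem starMul_assoc (X Y Z : CrossedSpace k G A B) :
    starMul H R L (starMul H R L X Y) Z = starMul H R L X (starMul H R L Y Z) := by
  induction X using induction₂ with
  | add s t hs ht => simp only [map_add, LinearMap.add_apply, hs, ht]
  | tmul X φ =>
  induction Y using induction₂ with
  | add s t hs ht => simp only [map_add, LinearMap.add_apply, hs, ht]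
  | tmul Y ψ =>
  induction Z using induction₂ with
  | add s t hs ht => simp only [map_add, hs, ht]
  | tmul Z χ =>
  induction X using induction₂ with
  | add s t hs ht => simp only [map_add, LinearMap.add_apply, TensorProduct.add_tmul, hs, ht]
  | tmul a b =>
  induction Y using induction₂ with
  | add s t hs ht => simp only [map_add, LinearMap.add_apply, TensorProduct.add_tmul, hs, ht]
  | tmul a' b' =>
  induction Z using induction₂ with
  | add s t hs ht => simp only [map_add, TensorProduct.add_tmul, hs, ht]
  | tmul a'' b'' =>
  apply (evalEquiv k G (A ⊗[k] B)).injective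
  ext x
  rw [starMul_tmul, starMul_tmul, starMul_dualPair_left, starMul_dualPair_right, leftFactor_split,
    ← rightFactor_split, padLast_quasi_coassoc]

end Associativity

/-! ### Units, the embeddings of `A` and `B`, and `Γ` -/

section Counit

variable {k G A B : Type*} [Field k] [Ring G] [Algebra k G] [Ring A] [Algebra k A]
  [Ring B] [Algebra k B]

theorem killLeft_padLeft (ε : G →ₐ[k] k) (w : B) : killLeft B ε (padLeft G w) = w := by
  rw [padLeft_apply, killLeft_tmul, map_one, one_smul]

theorem onRight_killLeft_leftFactor {Q : QuasiBialgebra k G} (R : RightCoaction Q A) (a a' : A) :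
    onRight A (killLeft G Q.counit) (leftFactor R a a') = (a * a') ⊗ₜ 1 := by
  have h : ∀ w : A ⊗[k] G, onRight A (killLeft G Q.counit)
      (onRight A Algebra.TensorProduct.includeLeft w) = killRight A Q.counit w ⊗ₜ 1 := by
    intro w
    induction w using induction₂ with
    | add s t hs ht => simp only [map_add, TensorProduct.add_tmul, hs, ht]
    | tmul c d =>
      simp [onRight_tmul, killLeft_tmul, killRight_tmul, TensorProduct.smul_tmul']
  rw [leftFactor, map_mul (onRight _ _), map_mul (onRight _ _), h, R.counit_coact,
    map_inv_eq_one R.counit_phi_mid, mul_one, onRight_tmul, map_one,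
    Algebra.TensorProduct.tmul_mul_tmul, one_mul]

theorem onRight_killRight_leftFactor_one {Q : QuasiBialgebra k G} (R : RightCoaction Q A)
    (a : A) : onRight A (killRight G Q.counit) (leftFactor R a 1) = a ⊗ₜ 1 := by
  rw [leftFactor, map_mul (onRight _ _), map_mul (onRight _ _), map_one, map_one, map_one,
    map_inv_eq_one R.counit_phi_right, mul_one, mul_one, onRight_tmul, map_one]

theorem killLeft_rightFactor {Q : QuasiBialgebra k G} (L : LeftCoaction Q B) (b b' : B) :
    killLeft (G ⊗[k] B) Q.counit (rightFactor L b b') = L.coact b * (1 ⊗ₜ b') := by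
  rw [rightFactor, map_mul (killLeft _ _), L.counit_phi_inv_left, one_mul, killLeft_padLeft]

theorem onRight_killLeft_rightFactor {Q : QuasiBialgebra k G} (L : LeftCoaction Q B) (b b' : B) :
    onRight G (killLeft B Q.counit) (rightFactor L b b') = 1 ⊗ₜ (b * b') := by
  rw [rightFactor, map_mul (onRight _ _), L.counit_phi_inv_mid, one_mul, padLeft_apply,
    onRight_tmul, map_mul, L.counit_coact, killLeft_tmul, map_one, one_smul]

/-- Apply `ε` to `S(a₁) α a₂ = ε(a) α` and use `ε(α) = 1`. -/
theorem QuasiHopfAlgebra.counit_S (H : QuasiHopfAlgebra k G) (hα : H.counit H.α = 1) (a : G) :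
    H.counit (H.S a) = H.counit a := by
  have h : ∀ m : G ⊗[k] G, H.counit
      (mulMap (LinearMap.mulRight k H.α ∘ₗ H.S.toLinearMap) LinearMap.id m) =
      H.counit (H.S (killRight G H.counit m)) := by
    intro m
    induction m using induction₂ with
    | add s t hs ht => simp only [map_add, hs, ht]
    | tmul x y => simp [killRight_tmul, hα, mul_comm]
  simpa [H.antipode_left, H.counit_right, hα] using (h (H.comul a)).symm

theorem QuasiHopfAlgebra.counit_S_symm (H : QuasiHopfAlgebra k G) (hα : H.counit H.α = 1)
    (a : G) : H.counit (H.S.symm a) = H.counit a := by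
  rw [← H.counit_S hα, LinearEquiv.apply_symm_apply]

theorem killLeft_qMap (H : QuasiHopfAlgebra k G) (hα : H.counit H.α = 1)
    (s : G ⊗[k] (G ⊗[k] B)) : killLeft B H.counit (qMap H B s) =
      killLeft B H.counit (killLeft (G ⊗[k] B) H.counit s) := by
  induction s using induction₃ with
  | add s t hs ht => simp only [map_add, hs, ht]
  | tmul x y t => simp [qMap_tmul, killLeft_tmul, H.counit_S hα, hα, mul_smul]

theorem spread_dualOne (H : QuasiHopfAlgebra k G) (hα : H.counit H.α = 1) (a : A)
    (w : G ⊗[k] B) :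
    spread H.S.symm.toLinearMap ((a ⊗ₜ w) ⊗ₜ dualOne H.toQuasiBialgebra) =
      (a ⊗ₜ killLeft B H.counit w) ⊗ₜ dualOne H.toQuasiBialgebra := by
  induction w using induction₂ with
  | add s t hs ht => simp only [map_add, TensorProduct.tmul_add, TensorProduct.add_tmul, hs, ht]
  | tmul g t =>
    have h : leftHit (H.S.symm g) (dualOne H.toQuasiBialgebra) =
        H.counit g • dualOne H.toQuasiBialgebra := by
      ext x
      simp [dualOne, H.counit_S_symm hα, mul_comm]
    rw [spread_tmul, LinearEquiv.coe_coe, h, killLeft_tmul]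
    simp only [TensorProduct.tmul_smul, TensorProduct.smul_tmul']

/-- Acting on `1̂ = ε`, the `G`-leg of `q λ(b)` contributes only its counit; `(ε ⊗ id)(q) = 1`
requires `ε(α) = 1`. -/
theorem muEquiv_dualOne (H : QuasiHopfAlgebra k G) (hα : H.counit H.α = 1)
    (L : LeftCoaction H.toQuasiBialgebra B) (a : A) (b : B) :
    muEquiv A H L ((a ⊗ₜ b) ⊗ₜ dualOne H.toQuasiBialgebra) =
      (a ⊗ₜ b) ⊗ₜ dualOne H.toQuasiBialgebra := by
  rw [muEquiv_tmul, spread_dualOne H hα, map_mul (killLeft _ _), killLeft_qMap H hα,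
    L.counit_phi_inv_left, map_one, one_mul, L.counit_coact]

/-- The second leg of `q` lies in `B`, where the extended `ρ` is trivial, so the right action in the
definition of `Γ` is by `1`. -/
theorem crossedGamma_eq_muEquiv (H : QuasiHopfAlgebra k G)
    (R : RightCoaction H.toQuasiBialgebra A) (L : LeftCoaction H.toQuasiBialgebra B)
    (φ : Module.Dual k G) : crossedGamma R L φ = muEquiv A H L ((1 ⊗ₜ 1) ⊗ₜ φ) := by
  rw [crossedGamma, gammaMap, qElement_eq, extPhiLeft, ← qMap_onRight, muEquiv_tmul, map_one,
    mul_one]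
  generalize qMap H B _ = w
  induction w using induction₂ with
  | add s t hs ht => simp only [map_add, TensorProduct.tmul_add, TensorProduct.add_tmul, hs, ht]
  | tmul g t =>
    have h : extRight B R.coact (1 ⊗ₜ t) = (1 ⊗ₜ t) ⊗ₜ 1 := by
      rw [extRight, AlgHom.comp_apply, AlgHom.comp_apply, splitLeft_tmul, map_one]
      rfl
    have h' : rightHit 1 φ = φ := by ext x; simp
    rw [onRight_tmul, onRight_tmul, Algebra.TensorProduct.includeRight_apply, h, implement_tmul,
      spread_tmul, h']
    rfl

variable [FiniteDimensional k G] (Q : QuasiBialgebra k G)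

/-- Pairing a leg with `ε` is multiplicative, so the counit can be applied separately to `u`, to
`Δ(x)` and to `v`. -/
theorem dualPair_dualOne_left (ψ : Module.Dual k G) {u : A ⊗[k] (G ⊗[k] G)}
    {v : G ⊗[k] (G ⊗[k] B)} {a : A} {b : B} (hu : onRight A (killLeft G Q.counit) u = a ⊗ₜ 1)
    (hv : killLeft (G ⊗[k] B) Q.counit v = 1 ⊗ₜ b) :
    dualPair Q (dualOne Q) ψ u v = (a ⊗ₜ b) ⊗ₜ ψ := by
  apply (evalEquiv k G (A ⊗[k] B)).injective
  ext x
  let K := onRight A (killLeft (G ⊗[k] B) Q.counit)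
  have h₁ : ∀ w, evalPair A B (dualOne Q) ψ w = LinearMap.lTensor A (dualContract ψ) (K w) := by
    intro w
    induction w using induction₄ with
    | add s t hs ht => simp only [map_add, hs, ht]
    | tmul a g h b =>
      rw [evalPair_tmul, onRight_tmul, killLeft_tmul]
      simp [dualContract_tmul, dualOne, mul_smul]
  have h₂ : ∀ u, K (padRight B u) =
      onRight A Algebra.TensorProduct.includeLeft (onRight A (killLeft G Q.counit) u) := by
    intro u
    induction u using induction₃ with
    | add s t hs ht => simp only [map_add, hs, ht]
    | tmul a g h =>
      simp [K, padRight_tmul, onRight_tmul, killLeft_tmul, TensorProduct.tmul_smul]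
  have h₃ : ∀ m, K (midLegs A B m) = 1 ⊗ₜ (killLeft G Q.counit m ⊗ₜ 1) := by
    intro m
    induction m using induction₂ with
    | add s t hs ht =>
      simp only [map_add, TensorProduct.add_tmul, TensorProduct.tmul_add, hs, ht]
    | tmul g h =>
      simp [K, midLegs_tmul, onRight_tmul, killLeft_tmul, TensorProduct.smul_tmul']
  have h₄ : K (padLeft A v) = padLeft A (killLeft (G ⊗[k] B) Q.counit v) := rfl
  rw [evalEquiv_dualPair, h₁, map_mul K, map_mul K, h₂, h₃, h₄, hu, hv, Q.counit_left,
    evalEquiv_tmul]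
  simp [onRight_tmul, padLeft_apply, dualContract_tmul]

theorem dualPair_dualOne_right (φ : Module.Dual k G) {u : A ⊗[k] (G ⊗[k] G)}
    {v : G ⊗[k] (G ⊗[k] B)} {a : A} {b : B} (hu : onRight A (killRight G Q.counit) u = a ⊗ₜ 1)
    (hv : onRight G (killLeft B Q.counit) v = 1 ⊗ₜ b) :
    dualPair Q φ (dualOne Q) u v = (a ⊗ₜ b) ⊗ₜ φ := by
  apply (evalEquiv k G (A ⊗[k] B)).injective
  ext x
  let K := onRight A (onRight G (killLeft B Q.counit))
  have h₁ : ∀ w, evalPair A B φ (dualOne Q) w = LinearMap.lTensor A (dualContract φ) (K w) := by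
    intro w
    induction w using induction₄ with
    | add s t hs ht => simp only [map_add, hs, ht]
    | tmul a g h b =>
      rw [evalPair_tmul, onRight_tmul, onRight_tmul, killLeft_tmul]
      simp [dualContract_tmul, dualOne, smul_smul, mul_comm]
  have h₂ : ∀ u, K (padRight B u) =
      onRight A Algebra.TensorProduct.includeLeft (onRight A (killRight G Q.counit) u) := by
    intro u
    induction u using induction₃ with
    | add s t hs ht => simp only [map_add, hs, ht]
    | tmul a g h =>
      simp [K, padRight_tmul, onRight_tmul, killLeft_tmul, killRight_tmul,
        TensorProduct.tmul_smul]
  have h₃ : ∀ m, K (midLegs A B m) = 1 ⊗ₜ (killRight G Q.counit m ⊗ₜ 1) := by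
    intro m
    induction m using induction₂ with
    | add s t hs ht =>
      simp only [map_add, TensorProduct.add_tmul, TensorProduct.tmul_add, hs, ht]
    | tmul g h =>
      simp [K, midLegs_tmul, onRight_tmul, killLeft_tmul, killRight_tmul,
        TensorProduct.smul_tmul']
  have h₄ : K (padLeft A v) = padLeft A (onRight G (killLeft B Q.counit) v) := rfl
  rw [evalEquiv_dualPair, h₁, map_mul K, map_mul K, h₂, h₃, h₄, hu, hv, Q.counit_right,
    evalEquiv_tmul]
  simp [onRight_tmul, padLeft_apply, dualContract_tmul]

variable (H : QuasiHopfAlgebra k G) (R : RightCoaction H.toQuasiBialgebra A)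
  (L : LeftCoaction H.toQuasiBialgebra B)

theorem starMul_dualOne_left (a a' : A) (b' : B) (ψ : Module.Dual k G) :
    starMul H R L ((a ⊗ₜ 1) ⊗ₜ dualOne H.toQuasiBialgebra) ((a' ⊗ₜ b') ⊗ₜ ψ) =
      ((a * a') ⊗ₜ b') ⊗ₜ ψ := by
  rw [starMul_tmul]
  refine dualPair_dualOne_left _ ψ (onRight_killLeft_leftFactor R a a') ?_
  rw [killLeft_rightFactor, map_one, one_mul]

theorem starMul_dualOne_right (a : A) (b b' : B) (φ : Module.Dual k G) :
    starMul H R L ((a ⊗ₜ b) ⊗ₜ φ) ((1 ⊗ₜ b') ⊗ₜ dualOne H.toQuasiBialgebra) =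
      (a ⊗ₜ (b * b')) ⊗ₜ φ := by
  rw [starMul_tmul]
  exact dualPair_dualOne_right _ φ (onRight_killRight_leftFactor_one R a)
    (onRight_killLeft_rightFactor L b b')

theorem starMul_one_left (X : CrossedSpace k G A B) :
    starMul H R L ((1 ⊗ₜ 1) ⊗ₜ dualOne H.toQuasiBialgebra) X = X := by
  induction X using induction₂ with
  | add s t hs ht => simp only [map_add, hs, ht]
  | tmul x φ =>
  induction x using induction₂ with
  | add s t hs ht => simp only [map_add, TensorProduct.add_tmul, hs, ht]
  | tmul a b => rw [starMul_dualOne_left, one_mul]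

theorem starMul_one_right (X : CrossedSpace k G A B) :
    starMul H R L X ((1 ⊗ₜ 1) ⊗ₜ dualOne H.toQuasiBialgebra) = X := by
  induction X using induction₂ with
  | add s t hs ht => simp only [map_add, LinearMap.add_apply, hs, ht]
  | tmul x φ =>
  induction x using induction₂ with
  | add s t hs ht => simp only [map_add, LinearMap.add_apply, TensorProduct.add_tmul, hs, ht]
  | tmul a b => rw [starMul_dualOne_right, mul_one]

end Counit

/-! ### Expansion into Sweedler components -/

section Expansion

variable {k G A B : Type*} [Field k] [Ring G] [Algebra k G] [Ring A] [Algebra k A]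
  [Ring B] [Algebra k B]

variable (k G A B) in
/-- `a ⊗ φ ⊗ b ↦ (a ⊗ b) ⊗ φ` -/
def legsEquiv : A ⊗[k] (Module.Dual k G ⊗[k] B) ≃ₗ[k] CrossedSpace k G A B :=
  (TensorProduct.congr (LinearEquiv.refl k A) (TensorProduct.comm k (Module.Dual k G) B)).trans
    (TensorProduct.assoc k A B (Module.Dual k G)).symm

theorem legsEquiv_tmul (a : A) (φ : Module.Dual k G) (b : B) :
    legsEquiv k G A B (a ⊗ₜ (φ ⊗ₜ b)) = (a ⊗ₜ b) ⊗ₜ φ := rfl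

theorem legsEquiv_symm_tmul (a : A) (φ : Module.Dual k G) (b : B) :
    (legsEquiv k G A B).symm ((a ⊗ₜ b) ⊗ₜ φ) = a ⊗ₜ (φ ⊗ₜ b) := rfl

variable [FiniteDimensional k G]

theorem rightHit_eq_sum {ι : Type*} (s : Finset ι) {φ : Module.Dual k G}
    {φ₁ φ₂ : ι → Module.Dual k G} (h : dualComul φ = ∑ i ∈ s, φ₁ i ⊗ₜ[k] φ₂ i) (g : G) :
    rightHit g φ = ∑ i ∈ s, φ₁ i g • φ₂ i := by
  ext x
  rw [rightHit_apply, ← dualDistrib_dualComul, h]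
  simp

theorem leftHit_eq_sum {ι : Type*} (s : Finset ι) {φ : Module.Dual k G}
    {φ₁ φ₂ : ι → Module.Dual k G} (h : dualComul φ = ∑ i ∈ s, φ₁ i ⊗ₜ[k] φ₂ i) (g : G) :
    leftHit g φ = ∑ i ∈ s, φ₂ i g • φ₁ i := by
  ext x
  rw [leftHit_apply, ← dualDistrib_dualComul, h]
  simp [mul_comm]

variable (Q : QuasiBialgebra k G)

theorem dualPair_sum_left {ι : Type*} (s : Finset ι) (φ ψ : Module.Dual k G)
    (u : ι → A ⊗[k] (G ⊗[k] G)) (v : G ⊗[k] (G ⊗[k] B)) :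
    dualPair Q φ ψ (∑ i ∈ s, u i) v = ∑ i ∈ s, dualPair Q φ ψ (u i) v :=
  map_sum (AddMonoidHom.mk' (fun u : A ⊗[k] (G ⊗[k] G) => dualPair Q φ ψ u v)
    fun u u' => dualPair_add_left Q φ ψ u u' v) u s

theorem dualPair_sum_right {ι : Type*} (s : Finset ι) (φ ψ : Module.Dual k G)
    (u : A ⊗[k] (G ⊗[k] G)) (v : ι → G ⊗[k] (G ⊗[k] B)) :
    dualPair Q φ ψ u (∑ i ∈ s, v i) = ∑ i ∈ s, dualPair Q φ ψ u (v i) :=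
  map_sum (AddMonoidHom.mk' (fun v : G ⊗[k] (G ⊗[k] B) => dualPair Q φ ψ u v)
    fun v v' => dualPair_add_right Q φ ψ u v v') v s

/-- The `G`-legs of `m` and `n` act on `φ` from the right and on `ψ` from the left. Expressing these
actions through the coproduct of `Ĝ` turns them into `φ₁ ▷ _` and `_ ◁ ψ₂`. -/
theorem dualPair_expand {ι κ : Type*} (s : Finset ι) (t : Finset κ) {φ ψ : Module.Dual k G}
    {φ₁ φ₂ : ι → Module.Dual k G} {ψ₁ ψ₂ : κ → Module.Dual k G}
    (hφ : dualComul φ = ∑ i ∈ s, φ₁ i ⊗ₜ[k] φ₂ i) (hψ : dualComul ψ = ∑ j ∈ t, ψ₁ j ⊗ₜ[k] ψ₂ j)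
    (a r₁ : A) (l₃ b' : B) (r₂ r₃ l₁ l₂ : G) (m : A ⊗[k] G) (n : G ⊗[k] B) :
    dualPair Q φ ψ
        ((a ⊗ₜ 1) * onRight A Algebra.TensorProduct.includeLeft m * (r₁ ⊗ₜ (r₂ ⊗ₜ r₃)))
        ((l₁ ⊗ₜ (l₂ ⊗ₜ l₃)) * padLeft G (n * (1 ⊗ₜ b'))) =
      ∑ i ∈ s, ∑ j ∈ t,
        ((a * TensorProduct.rid k A (LinearMap.lTensor A (φ₁ i) m) * r₁) ⊗ₜ[k]
          (l₃ * TensorProduct.lid k B (LinearMap.rTensor B (ψ₂ j) n) * b')) ⊗ₜ[k]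
        dualMul Q (leftHit l₁ (rightHit r₂ (φ₂ i))) (leftHit l₂ (rightHit r₃ (ψ₁ j))) := by
  induction m using induction₂ with
  | add s t hs ht =>
    simp only [map_add, mul_add, add_mul, TensorProduct.add_tmul, Finset.sum_add_distrib,
      dualPair_add_left, hs, ht]
  | tmul c d =>
  induction n using induction₂ with
  | add s t hs ht =>
    simp only [map_add, mul_add, add_mul, TensorProduct.add_tmul, TensorProduct.tmul_add,
      Finset.sum_add_distrib, dualPair_add_right, hs, ht]
  | tmul g e =>
    have h₁ : leftHit l₁ (rightHit (d * r₂) φ) = leftHit l₁ (rightHit r₂ (rightHit d φ)) := by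
      ext x; simp [mul_assoc]
    have h₂ : leftHit (l₂ * g) (rightHit r₃ ψ) = leftHit l₂ (rightHit r₃ (leftHit g ψ)) := by
      ext x; simp [mul_assoc]
    simp only [onRight_tmul, padLeft_apply, Algebra.TensorProduct.tmul_mul_tmul, one_mul, mul_one,
      Algebra.TensorProduct.includeLeft_apply, dualPair_tmul]
    rw [h₁, h₂, rightHit_eq_sum s hφ, leftHit_eq_sum t hψ]
    simp only [map_sum, map_smul, LinearMap.sum_apply, LinearMap.smul_apply,
      TensorProduct.tmul_sum, LinearMap.lTensor_tmul, LinearMap.rTensor_tmul,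
      TensorProduct.rid_tmul, TensorProduct.lid_tmul, TensorProduct.tmul_smul,
      mul_smul_comm, smul_mul_assoc, TensorProduct.smul_tmul', mul_assoc]
    simp only [Finset.smul_sum, TensorProduct.smul_tmul']
    rw [Finset.sum_comm]

theorem dualPair_leftFactor_rightFactor {ι κ η ξ : Type*} (I : Finset ι) (J : Finset κ)
    (S : Finset η) (T : Finset ξ) (R : RightCoaction Q A) (L : LeftCoaction Q B)
    {l₁ l₂ : ι → G} {l₃ : ι → B} (hl : L.phi⁻¹.val = ∑ i ∈ I, l₁ i ⊗ₜ[k] (l₂ i ⊗ₜ[k] l₃ i))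
    {r₁ : κ → A} {r₂ r₃ : κ → G} (hr : R.phi⁻¹.val = ∑ j ∈ J, r₁ j ⊗ₜ[k] (r₂ j ⊗ₜ[k] r₃ j))
    {φ ψ : Module.Dual k G} {φ₁ φ₂ : η → Module.Dual k G} {ψ₁ ψ₂ : ξ → Module.Dual k G}
    (hφ : dualComul φ = ∑ s ∈ S, φ₁ s ⊗ₜ[k] φ₂ s) (hψ : dualComul ψ = ∑ t ∈ T, ψ₁ t ⊗ₜ[k] ψ₂ t)
    (a a' : A) (b b' : B) :
    dualPair Q φ ψ (leftFactor R a a') (rightFactor L b b') =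
      ∑ i ∈ I, ∑ j ∈ J, ∑ s ∈ S, ∑ t ∈ T,
        ((a * dualActLeft R.coact (φ₁ s) a' * r₁ j) ⊗ₜ[k]
          (l₃ i * dualActRight L.coact b (ψ₂ t) * b')) ⊗ₜ[k]
        dualMul Q (leftHit (l₁ i) (rightHit (r₂ j) (φ₂ s)))
          (leftHit (l₂ i) (rightHit (r₃ j) (ψ₁ t))) := by
  rw [leftFactor, rightFactor, hl, hr, Finset.mul_sum, Finset.sum_mul, dualPair_sum_right]
  refine Finset.sum_congr rfl fun i _ => ?_
  rw [dualPair_sum_left]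
  exact Finset.sum_congr rfl fun j _ => dualPair_expand Q S T hφ hψ _ _ _ _ _ _ _ _ _ _

end Expansion

end QuasiHopf

end

/-! ### The two-sided crossed product theorem -/

open QuasiHopf in
theorem proposition11p4 {k G A B : Type*} [Field k] [Ring G] [Algebra k G]
    [FiniteDimensional k G] [Ring A] [Algebra k A] [Ring B] [Algebra k B]
    (H : QuasiHopfAlgebra k G) (hα : H.counit H.α = 1)
    (R : RightCoaction H.toQuasiBialgebra A) (L : LeftCoaction H.toQuasiBialgebra B) :
    -- `M₁` is an associative algebra with unit
    (∀ X Y Z : CrossedSpace k G A B,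
      crossedMul R L (crossedMul R L X Y) Z = crossedMul R L X (crossedMul R L Y Z)) ∧
    (∀ X : CrossedSpace k G A B,
      crossedMul R L (crossedOne H A B) X = X ∧ crossedMul R L X (crossedOne H A B) = X) ∧
    ∃ μ : A ⊗[k] (Module.Dual k G ⊗[k] B) ≃ₗ[k] CrossedSpace k G A B,
      -- (i) `μ(a ⊗ φ ⊗ b) = a Γ(φ) b`
      (∀ (a : A) (φ : Module.Dual k G) (b : B),
        μ (a ⊗ₜ[k] (φ ⊗ₜ[k] b)) =
          crossedMul R L (crossedMul R L (inclA H B a) (crossedGamma R L φ)) (inclB H A b)) ∧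
      -- (ii) the unit and the product induced by `μ`
      μ.symm (crossedOne H A B) = 1 ⊗ₜ[k] (dualOne H.toQuasiBialgebra ⊗ₜ[k] 1) ∧
      ∀ (a a' : A) (φ ψ : Module.Dual k G) (b b' : B)
        -- `φ_λ⁻¹ = ∑ l₁ ⊗ l₂ ⊗ l₃`
        (nl : ℕ) (l₁ l₂ : Fin nl → G) (l₃ : Fin nl → B)
        (_ : ((L.phi⁻¹ : (G ⊗[k] (G ⊗[k] B))ˣ) : G ⊗[k] (G ⊗[k] B)) =
          ∑ i, l₁ i ⊗ₜ[k] (l₂ i ⊗ₜ[k] l₃ i))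
        -- `φ_ρ⁻¹ = ∑ r₁ ⊗ r₂ ⊗ r₃`
        (nr : ℕ) (r₁ : Fin nr → A) (r₂ r₃ : Fin nr → G)
        (_ : ((R.phi⁻¹ : (A ⊗[k] (G ⊗[k] G))ˣ) : A ⊗[k] (G ⊗[k] G)) =
          ∑ j, r₁ j ⊗ₜ[k] (r₂ j ⊗ₜ[k] r₃ j))
        -- `Δ̂ φ = ∑ φ₁ ⊗ φ₂` and `Δ̂ ψ = ∑ ψ₁ ⊗ ψ₂`
        (nφ : ℕ) (φ₁ φ₂ : Fin nφ → Module.Dual k G)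
        (_ : dualComul φ = ∑ s, φ₁ s ⊗ₜ[k] φ₂ s)
        (nψ : ℕ) (ψ₁ ψ₂ : Fin nψ → Module.Dual k G)
        (_ : dualComul ψ = ∑ t, ψ₁ t ⊗ₜ[k] ψ₂ t),
        μ.symm (crossedMul R L (μ (a ⊗ₜ[k] (φ ⊗ₜ[k] b))) (μ (a' ⊗ₜ[k] (ψ ⊗ₜ[k] b')))) =
          ∑ i, ∑ j, ∑ s, ∑ t,
            (a * dualActLeft R.coact (φ₁ s) a' * r₁ j) ⊗ₜ[k]
              (dualMul H.toQuasiBialgebra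
                  (leftHit (l₁ i) (rightHit (r₂ j) (φ₂ s)))
                  (leftHit (l₂ i) (rightHit (r₃ j) (ψ₁ t))) ⊗ₜ[k]
                (l₃ i * dualActRight L.coact b (ψ₂ t) * b')) := by
  have hmul : ∀ X Y, crossedMul R L (muEquiv A H L X) (muEquiv A H L Y) =
      muEquiv A H L (starMul H R L X Y) := fun X Y => by
    rw [starMul_apply, LinearEquiv.apply_symm_apply]
  have hone : crossedOne H A B = muEquiv A H L ((1 ⊗ₜ 1) ⊗ₜ dualOne H.toQuasiBialgebra) :=
    (muEquiv_dualOne H hα L 1 1).symm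
  refine ⟨fun X Y Z => ?_, fun X => ?_, (legsEquiv k G A B).trans (muEquiv A H L), fun a φ b => ?_,
    ?_, fun a a' φ ψ b b' nl l₁ l₂ l₃ hl nr r₁ r₂ r₃ hr nφ φ₁ φ₂ hφ nψ ψ₁ ψ₂ hψ => ?_⟩
  -- Every element is in the image of `muEquiv`, so associativity and the unit laws are inherited
  -- from `starMul`.
  · obtain ⟨X, rfl⟩ := (muEquiv A H L).surjective X
    obtain ⟨Y, rfl⟩ := (muEquiv A H L).surjective Y
    obtain ⟨Z, rfl⟩ := (muEquiv A H L).surjective Z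
    rw [hmul, hmul, hmul, hmul, starMul_assoc]
  · obtain ⟨X, rfl⟩ := (muEquiv A H L).surjective X
    rw [hone, hmul, hmul, starMul_one_left, starMul_one_right]
    exact ⟨rfl, rfl⟩
  -- The three factors `a`, `Γ(φ)`, `b` are the images of `(a ⊗ 1) ⊗ 1̂`, `(1 ⊗ 1) ⊗ φ` and `(1 ⊗ b)
  -- ⊗ 1̂`, whose product under `starMul` is `(a ⊗ b) ⊗ φ`.
  · rw [inclA, inclB, ← muEquiv_dualOne H hα L a 1, ← muEquiv_dualOne H hα L 1 b,
      crossedGamma_eq_muEquiv, hmul, hmul, starMul_dualOne_left, starMul_dualOne_right, mul_one,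
      one_mul, LinearEquiv.trans_apply, legsEquiv_tmul]
  · rw [hone, LinearEquiv.symm_trans_apply, LinearEquiv.symm_apply_apply, legsEquiv_symm_tmul]
  · rw [LinearEquiv.trans_apply, LinearEquiv.trans_apply, hmul, LinearEquiv.symm_trans_apply,
      LinearEquiv.symm_apply_apply, legsEquiv_tmul, legsEquiv_tmul, starMul_tmul,
      dualPair_leftFactor_rightFactor H.toQuasiBialgebra _ _ _ _ R L hl hr hφ hψ]
    simp only [map_sum, legsEquiv_symm_tmul]
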